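/- **Setting.** Let $\bar H=\sum_{j=1}^M h_j\sigma_j$ be a Hamiltonian on $n$ qubits, with real $h_j$ and Pauli operators $\sigma_j$, and let $h_{tot}=\sum_j|h_j|>0$. Let $|\Psi\rangle$ be a unit vector, $E_g$ the lowest eigenvalue of $\bar H$, and $|\Psi_g\rangle$ a normalised eigenvector for $E_g$ with $|\langle\Psi_g|\Psi\rangle|^2\ge p_b$, where $0<p_b\le 1$ is known. Let $O=\sum_j a_jO_j$ with real $a_j$ and Hermitian unitary $O_j$, and let $a_O=\sum_j|a_j|>0$. For $\beta>0$ let $\langle O\rangle(\beta)=\langle\Psi|e^{-\beta \bar H}Oe^{-\beta \bar H}|\Psi\rangle/\langle\Psi|e^{-2\beta \bar H}|\Psi\rangle$ (adding a constant to $\bar H$ does not change this). **ITS** (imaginary-time simulation) has the parameters $E_0\in\mathbb R$, $\beta,\tau,T>0$ and $N_t,N_s\in\{1,2,\dots\}$. Let $g(t)=\frac1\pi\frac{\beta}{\beta^2+t^2}e^{-(\beta^2+t^2)/(2\tau^2)}$. The zeroth-order leading-order-rotation formula writes $e^{-i\bar Ht}=\sum_s w_s(t)e^{i\theta_s(t)}U_s(t)$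 with $w_s\ge 0$ and two kinds of terms: - for $s=j$: $U_s=e^{-i\,\mathrm{sgn}(h_jt)\phi\sigma_j}$ and $w_se^{i\theta_s}=|h_jt|/\sin\phi$, where $\phi=\arctan(h_{tot}|t|)$; - for $s=(j_1,\dots,j_k)$ with $k\ge2$: $U_s=\sigma_{j_k}\cdots\sigma_{j_1}$ and $w_se^{i\theta_s}=\frac1{k!}\prod_{a=1}^k(-ih_{j_a}t)$. For $\boldsymbol S=(s_1,\dots,s_{N_t})$ let $U_{\boldsymbol S}(t)=U_{s_{N_t}}(t/N_t)\cdots U_{s_1}(t/N_t)$ and $w_{\boldsymbol S}(t)e^{i\theta_{\boldsymbol S}(t)}=\prod_l w_{s_l}(t/N_t)e^{i\theta_{s_l}(t/N_t)}$. Let $C_T=\int_{-T}^T g(t)\big(\sum_s w_s(t/N_t)\big)^{N_t}dt$. One sample for $O$ consists of: - times $t,t'\in[-T,T]$ and sequences $\boldsymbol S,\boldsymbol S'$ with density $C_T^{-2}g(t)g(t')w_{\boldsymbol S}(t)w_{\boldsymbol S'}(t')$; - an independent index $j$ with probability $|a_j|/a_O$; - the outcomes $\mu_R,\mu_I=\pm1$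 of one run each of the two Hadamard-test circuits (measurement of $X$ and of $Y$ of the ancillary qubit) for the real and imaginary parts of $\langle\Psi|U_{\boldsymbol S'}(t')^\dagger O_jU_{\boldsymbol S}(t)|\Psi\rangle$. From $N_s$ independent samples, $$\hat O=\frac{a_OC_T^2}{N_s}\sum_{l=1}^{N_s}\mathrm{sgn}(a_{j_l})\,e^{iE_0(t_l-t_l')}e^{i\theta_{\boldsymbol S_l}(t_l)-i\theta_{\boldsymbol S'_l}(t'_l)}(\mu_{R,l}+i\mu_{I,l}).$$ The estimate $\hat{\mathbb 1}$ is obtained in the same way from $N_s$ further independent samples for the observable $\mathbb 1$. The result of ITS is $\hat O/\hat{\mathbb 1}$. **Algorithm.** No prior estimate of $E_g$ is used. Start with $\hat E_g=0$ and $\delta E=h_{tot}$. In each of $N_i$ iterations, run ITS for the observable $\bar H=\sum_jh_j\sigma_j$ at an imaginary time $\beta_i$ with $\frac1{2\beta_i}\ln\big(1+\frac{1-p_b}{e\,p_b}\big)\le\frac{\delta E}2$ and with $E_0=\hat E_g-\delta E-\beta_i^{-1}$, then replace $\hat E_g$ by the real part of the result and $\delta E$ by $\frac34\delta E$. Finally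 run ITS for $O$ at the imaginary time $\beta$ with $E_0=\hat E_g-\delta E-\beta^{-1}$, giving $\hat O/\hat{\mathbb 1}$. All samples of all runs are independent. Let $N_{t,max}$ be the largest $N_t$ of all the runs and $N_{s,tot}$ the sum of their $N_s$. **Theorem.** For all positive $h_{tot},\beta,\eta,\kappa$ one can choose $N_i$ and the parameters $\beta_i,\tau,T,N_t,N_s$ of all the runs, depending only on $p_b,h_{tot},\beta,\eta,\kappa$ (and on the threshold $\zeta_0$ below), such that for all $n$, $\bar H$, $|\Psi\rangle$, $O$ as above, with probability higher than $1-\kappa$, no denominator $\hat{\mathbb 1}$ in the algorithm vanishes and $$\left|\frac{\hat O}{\hat{\mathbb 1}}-\langle O\rangle(\beta)\right|<a_O\eta .$$ The costs are $$N_{t,max}=O\!\left(h_{tot}^2\beta^2\Big(\ln\frac1\zeta\Big)^2\right),\qquad N_{s,tot}=O\!\left(\frac1{\kappa\zeta^2}\Big(\ln\frac1\zeta\Big)^2\right),\qquad \zeta=\min\Big\{\eta,\frac1{h_{tot}\beta}\Big\}.$$ Here $O$ means the following: for every $\zeta_0\in(0,1)$ there is a constant $c$, depending only on $p_b$ and $\zeta_0$,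 such that whenever $\zeta\le\zeta_0$ and $\kappa\le1$, $N_{t,max}\le\max\{1,\,c\,h_{tot}^2\beta^2(\ln\frac1\zeta)^2\}$ and $N_{s,tot}\le c\,\frac1{\kappa\zeta^2}(\ln\frac1\zeta)^2$. -/

import Mathlib

noncomputable section

namespace ITS

open MeasureTheory

/-! ### Qubits, Pauli operators, expectation values -/

/-- Computational basis states of `n` qubits. -/
abbrev Basis (n : ℕ) := Fin n → Fin 2

/-- Vectors of the Hilbert space of `n` qubits. -/
abbrev Vec (n : ℕ) := Basis n → ℂ

/-- Operators on the Hilbert space of `n` qubits. -/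
abbrev Op (n : ℕ) := Matrix (Basis n) (Basis n) ℂ

/-- The inner product `⟨φ|ψ⟩`. -/
def braket {n : ℕ} (φ ψ : Vec n) : ℂ := star φ ⬝ᵥ ψ

/-- The single-qubit Pauli matrices `1, X, Y, Z`. -/
def pauli : Fin 4 → Matrix (Fin 2) (Fin 2) ℂ :=
  ![1, !![0, 1; 1, 0], !![0, -Complex.I; Complex.I, 0], !![1, 0; 0, -1]]

/-- An `n`-qubit Pauli operator: the tensor product of single-qubit Pauli matrices. -/
def pauliOp {n : ℕ} (P : Fin n → Fin 4) : Op n :=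
  Matrix.of fun x y => ∏ q, pauli (P q) (x q) (y q)

/-- The operator `∑ j, a j • A j`. -/
def linComb {n K : ℕ} (a : Fin K → ℝ) (A : Fin K → Op n) : Op n :=
  ∑ j, (a j : ℂ) • A j

/-- The sum of the absolute values of the coefficients (`h_tot` or `a_O`). -/
def absSum {K : ℕ} (a : Fin K → ℝ) : ℝ := ∑ j, |a j|

/-- The Hamiltonian `∑ j, h j • σ j`, with Pauli operators `σ j` given by Pauli strings. -/
def hamiltonian {n M : ℕ} (h : Fin M → ℝ) (P : Fin M → Fin n → Fin 4) : Op n :=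
  linComb h fun j => pauliOp (P j)

/-- The expected value of `O` after evolution of `ψ` for the imaginary time `β`. The value does not
change when a multiple of the identity is added to `H`. -/
def imagTimeMean {n : ℕ} (H O : Op n) (ψ : Vec n) (β : ℝ) : ℂ :=
  braket ψ ((NormedSpace.exp (-(β : ℂ) • H) * O * NormedSpace.exp (-(β : ℂ) • H)).mulVec ψ) /
    braket ψ ((NormedSpace.exp (-(2 * β : ℂ) • H)).mulVec ψ)

/-- `ψg` is a normalised ground state of `H` and `Eg` is the ground-state energy. -/
structure IsGroundState {n : ℕ} (H : Op n) (Eg : ℝ) (ψg : Vec n) : Prop where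
  normalised : braket ψg ψg = 1
  eigen : H.mulVec ψg = (Eg : ℂ) • ψg
  minimal : ∀ (E : ℝ) (φ : Vec n), φ ≠ 0 → H.mulVec φ = (E : ℂ) • φ → Eg ≤ E

/-! ### The zeroth-order leading-order-rotation (LOR) formula -/

/-- Labels of the terms in the LOR formula: a rotation about the term `j` of the Hamiltonian, or the
product of the Pauli operators with labels `J 0, …, J (k + 1)` (at least two factors). -/
inductive LORIndex (M : ℕ) : Type where
  | rot (j : Fin M) : LORIndex M
  | mul (k : ℕ) (J : Fin (k + 2) → Fin M) : LORIndex M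

/-- The set of labels is countable and carries the discrete σ-algebra. -/
instance (M : ℕ) : MeasurableSpace (LORIndex M) := ⊤

/-- The rotation angle `φ(t) = arctan (h_tot |t|)`. -/
def lorAngle {M : ℕ} (h : Fin M → ℝ) (t : ℝ) : ℝ := Real.arctan (absSum h * |t|)

/-- The coefficient `w_s(t) exp(i θ_s(t))` of the term `s` (at `t ≠ 0`; the value at the single time
`t = 0` is immaterial). -/
def lorCoeff {M : ℕ} (h : Fin M → ℝ) (t : ℝ) : LORIndex M → ℂ
  | .rot j => ((|h j * t| / Real.sin (lorAngle h t) : ℝ) : ℂ)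
  | .mul k J => (∏ a, (-Complex.I * (h (J a) : ℂ) * (t : ℂ))) / ((k + 2).factorial : ℂ)

/-- The unitary operator `U_s(t)`: a rotation, or the product `σ_{j_k} ⋯ σ_{j_1}`. -/
def lorUnitary {n M : ℕ} (h : Fin M → ℝ) (P : Fin M → Fin n → Fin 4) (t : ℝ) : LORIndex M → Op n
  | .rot j =>
      NormedSpace.exp
        ((-Complex.I * (Real.sign (h j * t) : ℂ) * (lorAngle h t : ℂ)) • pauliOp (P j))
  | .mul _ J => (List.ofFn fun a => pauliOp (P (J a))).reverse.prod

/-- The weight `w_S(t)` of a sequence `S` of terms, one for each of the `N` Trotter steps. -/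
def seqWeight {M N : ℕ} (h : Fin M → ℝ) (t : ℝ) (S : Fin N → LORIndex M) : ℝ :=
  ∏ l, ‖lorCoeff h (t / N) (S l)‖

/-- The phase `θ_S(t)` of a sequence `S` of terms. -/
def seqPhase {M N : ℕ} (h : Fin M → ℝ) (t : ℝ) (S : Fin N → LORIndex M) : ℝ :=
  ∑ l, (lorCoeff h (t / N) (S l)).arg

/-- The unitary operator `U_S(t) = U_{s_N}(t/N) ⋯ U_{s_1}(t/N)`. -/
def seqUnitary {n M N : ℕ} (h : Fin M → ℝ) (P : Fin M → Fin n → Fin 4) (t : ℝ)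
    (S : Fin N → LORIndex M) : Op n :=
  (List.ofFn fun l => lorUnitary h P (t / N) (S l)).reverse.prod

/-- The total weight `C_A(t)` of the terms of the LOR formula. -/
def lorTotal {M : ℕ} (h : Fin M → ℝ) (t : ℝ) : ℝ :=
  Real.sqrt (1 + (absSum h * |t|) ^ 2) + Real.exp (absSum h * |t|) - (1 + absSum h * |t|)

/-! ### Parameters of one imaginary-time simulation (ITS) -/

/-- Input parameters of one ITS, apart from the energy shift `E₀`: the imaginary time `β`, the width
`τ` of the Gaussian, the truncation time `T`, the number `Nt` of Trotter steps and the sample size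
`Ns`. Each sampled circuit is run once for the real and once for the imaginary part. -/
structure Params where
  β : ℝ
  τ : ℝ
  T : ℝ
  Nt : ℕ
  Ns : ℕ
  β_pos : 0 < β
  τ_pos : 0 < τ
  T_pos : 0 < T
  Nt_pos : 0 < Nt
  Ns_pos : 0 < Ns

/-- The Lorentz-Gaussian function `g(t)`. -/
def Params.g (p : Params) (t : ℝ) : ℝ :=
  1 / Real.pi * (p.β / (p.β ^ 2 + t ^ 2)) * Real.exp (-((p.β ^ 2 + t ^ 2) / (2 * p.τ ^ 2)))

/-- The normalisation factor `C_T`. -/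
def Params.CT {M : ℕ} (p : Params) (h : Fin M → ℝ) : ℝ :=
  ∫ t in (-p.T)..p.T, p.g t * lorTotal h (t / p.Nt) ^ p.Nt

/-! ### The Hadamard test -/

/-- The measurement outcome `±1` encoded by a Boolean value. -/
def outcome (b : Bool) : ℝ := if b then 1 else -1

/-- The operation that applies `U` to the system if the ancillary qubit is in the state `c`. -/
def controlled {n : ℕ} (c : Fin 2) (U : Op n) (Φ : Fin 2 → Vec n) : Fin 2 → Vec n :=
  fun a => if a = c then U.mulVec (Φ a) else Φ a

/-- The state of the ancillary qubit and the system before the measurement, for the evaluation of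
`⟨ψ| V'† A V |ψ⟩`. The ancillary qubit is prepared in `(|0⟩ + |1⟩)/√2`. -/
def testState {n : ℕ} (V V' A : Op n) (ψ : Vec n) : Fin 2 → Vec n :=
  controlled 0 V' (controlled 1 A (controlled 1 V fun _ => ((1 / Real.sqrt 2 : ℝ) : ℂ) • ψ))

/-- The normalised eigenvector of the Pauli matrix `X` with the eigenvalue `outcome b`. -/
def xVec (b : Bool) : Fin 2 → ℂ :=
  ((1 / Real.sqrt 2 : ℝ) : ℂ) • ![1, (outcome b : ℂ)]

/-- The normalised eigenvector of the Pauli matrix `Y` with the eigenvalue `outcome b`. -/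
def yVec (b : Bool) : Fin 2 → ℂ :=
  ((1 / Real.sqrt 2 : ℝ) : ℂ) • ![1, Complex.I * (outcome b : ℂ)]

/-- The Born probability of finding the ancillary qubit in the state `v`. -/
def bornProb {n : ℕ} (v : Fin 2 → ℂ) (Φ : Fin 2 → Vec n) : ℝ :=
  ∑ x, ‖∑ a, star (v a) * Φ a x‖ ^ 2

/-! ### Monte Carlo estimation of an imaginary-time correlation -/

/-- One Monte Carlo sample `((t, S), (t', S'), j, μR, μI)`. -/
abbrev Sample (M N K : ℕ) :=
  (ℝ × (Fin N → LORIndex M)) × (ℝ × (Fin N → LORIndex M)) × Fin K × Bool × Bool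

instance (M N K : ℕ) : MeasurableSpace (Sample M N K) := Prod.instMeasurableSpace

/-- The reference measure on samples: Lebesgue measure on `[-T, T]` for the two times and counting
measure for everything else. -/
def Params.baseMeasure (p : Params) (M K : ℕ) : Measure (Sample M p.Nt K) :=
  ((volume.restrict (Set.Icc (-p.T) p.T)).prod Measure.count).prod
    (((volume.restrict (Set.Icc (-p.T) p.T)).prod Measure.count).prod Measure.count)

/-- The probability density of a sample: `(t, S, t', S')` has the density
`C_T⁻² g(t) g(t') w_S(t) w_{S'}(t')`, the term `j` of the observable has the probability
`|a j| / a_O`, and the two circuits are then measured once each. -/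
def Params.sampleDensity {n M K : ℕ} (p : Params) (h : Fin M → ℝ) (P : Fin M → Fin n → Fin 4)
    (ψ : Vec n) (a : Fin K → ℝ) (A : Fin K → Op n) : Sample M p.Nt K → ℝ
  | ((t, S), (t', S'), j, bR, bI) =>
      (p.g t * p.g t' * seqWeight h t S * seqWeight h t' S' / p.CT h ^ 2) *
        (|a j| / absSum a) *
        bornProb (xVec bR) (testState (seqUnitary h P t S) (seqUnitary h P t' S') (A j) ψ) *
        bornProb (yVec bI) (testState (seqUnitary h P t S) (seqUnitary h P t' S') (A j) ψ)

/-- The probability law of one sample. -/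
def Params.sampleLaw {n M K : ℕ} (p : Params) (h : Fin M → ℝ) (P : Fin M → Fin n → Fin 4)
    (ψ : Vec n) (a : Fin K → ℝ) (A : Fin K → Op n) : Measure (Sample M p.Nt K) :=
  (p.baseMeasure M K).withDensity fun x => ENNReal.ofReal (p.sampleDensity h P ψ a A x)

/-- The number that a sample contributes to the estimator with the energy shift `E₀`. -/
def sampleValue {M N K : ℕ} (h : Fin M → ℝ) (a : Fin K → ℝ) (E₀ : ℝ) : Sample M N K → ℂ
  | ((t, S), (t', S'), j, bR, bI) =>
      (Real.sign (a j) : ℂ) * Complex.exp (Complex.I * (E₀ * (t - t') : ℝ)) *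
        Complex.exp (Complex.I * (seqPhase h t S : ℂ)) *
        Complex.exp (-Complex.I * (seqPhase h t' S' : ℂ)) *
        ((outcome bR : ℂ) + Complex.I * (outcome bI : ℂ))

/-- The estimate of the imaginary-time correlation of the observable `∑ j, a j • A j`. -/
def Params.estimate {M K : ℕ} (p : Params) (h : Fin M → ℝ) (a : Fin K → ℝ) (E₀ : ℝ)
    (x : Fin p.Ns → Sample M p.Nt K) : ℂ :=
  ((absSum a * p.CT h ^ 2 / p.Ns : ℝ) : ℂ) * ∑ l, sampleValue h a E₀ (x l)

/-! ### Imaginary-time simulation -/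

/-- The data collected in one ITS: `Ns` samples for the observable and `Ns` samples for the
identity operator, as an observable with one term. -/
abbrev Params.Data (p : Params) (M K : ℕ) :=
  (Fin p.Ns → Sample M p.Nt K) × (Fin p.Ns → Sample M p.Nt 1)

instance (p : Params) (M K : ℕ) : MeasurableSpace (p.Data M K) := Prod.instMeasurableSpace

/-- The law of the data of one ITS: all samples are independent. It does not involve `E₀`, which
enters only when the data are evaluated. -/
def Params.dataLaw {n M K : ℕ} (p : Params) (h : Fin M → ℝ) (P : Fin M → Fin n → Fin 4)
    (ψ : Vec n) (a : Fin K → ℝ) (A : Fin K → Op n) : Measure (p.Data M K) :=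
  (Measure.pi fun _ => p.sampleLaw h P ψ a A).prod
    (Measure.pi fun _ => p.sampleLaw h P ψ (fun _ : Fin 1 => (1 : ℝ)) (fun _ => (1 : Op n)))

/-- The estimate of the numerator of the expected value of the observable. -/
def Params.num {M K : ℕ} (p : Params) (h : Fin M → ℝ) (a : Fin K → ℝ) (E₀ : ℝ)
    (d : p.Data M K) : ℂ :=
  p.estimate h a E₀ d.1

/-- The estimate of the denominator of the expected value of the observable. -/
def Params.den {M K : ℕ} (p : Params) (h : Fin M → ℝ) (E₀ : ℝ) (d : p.Data M K) : ℂ :=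
  p.estimate h (fun _ : Fin 1 => (1 : ℝ)) E₀ d.2

/-! ### The iterative ground-state solver (GSS), followed by the task ITS -/

/-- The uncertainty of the energy estimate after `i` iterations. -/
def uncertainty {M : ℕ} (h : Fin M → ℝ) (i : ℕ) : ℝ := absSum h * (3 / 4) ^ i

/-- The energy shift used in an ITS, given an energy estimate with its uncertainty. -/
def Params.shift (p : Params) (E δE : ℝ) : ℝ := E - δE - 1 / p.β

/-- The energy estimate after `i` iterations. It is initially zero, and each iteration replaces it
by the result of an ITS with the Hamiltonian as the observable (the real part is taken, because the
exact value is real). -/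
def gssEnergy {M Ni : ℕ} (h : Fin M → ℝ) (r : Fin Ni → Params)
    (ω : ∀ i, (r i).Data M M) : Fin (Ni + 1) → ℝ :=
  Fin.induction (motive := fun _ => ℝ) 0 fun i E =>
    ((r i).num h h ((r i).shift E (uncertainty h i)) (ω i) /
      (r i).den h ((r i).shift E (uncertainty h i)) (ω i)).re

/-- The energy shift used in the `i`-th iteration. -/
def gssShift {M Ni : ℕ} (h : Fin M → ℝ) (r : Fin Ni → Params)
    (ω : ∀ i, (r i).Data M M) (i : Fin Ni) : ℝ :=
  (r i).shift (gssEnergy h r ω i.castSucc) (uncertainty h i)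

/-- The energy shift used in the task ITS, after the last iteration. -/
def taskShift {M Ni : ℕ} (h : Fin M → ℝ) (r : Fin Ni → Params) (q : Params)
    (ω : ∀ i, (r i).Data M M) : ℝ :=
  q.shift (gssEnergy h r ω (Fin.last Ni)) (uncertainty h Ni)

/-- The law of all the data, for the iterations with parameters `r` and the task ITS with
parameters `q`. -/
def totalLaw {n M Ni K : ℕ} (h : Fin M → ℝ) (P : Fin M → Fin n → Fin 4) (ψ : Vec n)
    (r : Fin Ni → Params) (q : Params) (a : Fin K → ℝ) (A : Fin K → Op n) :
    Measure ((∀ i, (r i).Data M M) × q.Data M K) :=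
  (Measure.pi fun i => (r i).dataLaw h P ψ h fun j => pauliOp (P j)).prod (q.dataLaw h P ψ a A)

/-- The event that no denominator vanishes and that the final result is closer than `err` to the
expected value of the observable at the imaginary time `q.β`. -/
def successEvent {n M Ni K : ℕ} (h : Fin M → ℝ) (P : Fin M → Fin n → Fin 4) (ψ : Vec n)
    (r : Fin Ni → Params) (q : Params) (a : Fin K → ℝ) (A : Fin K → Op n) (err : ℝ) :
    Set ((∀ i, (r i).Data M M) × q.Data M K) :=
  {ω | (∀ i, (r i).den h (gssShift h r ω.1 i) (ω.1 i) ≠ 0) ∧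
    q.den h (taskShift h r q ω.1) ω.2 ≠ 0 ∧
    ‖q.num h a (taskShift h r q ω.1) ω.2 / q.den h (taskShift h r q ω.1) ω.2 -
      imagTimeMean (hamiltonian h P) (linComb a A) ψ q.β‖ < err}

/-- The bound `(1/(2β)) ln(1 + 1/(e α))`, `α = pb/(1 - pb)`, of the projection error. -/
def projectionBound (pb β : ℝ) : ℝ :=
  1 / (2 * β) * Real.log (1 + (1 - pb) / (Real.exp 1 * pb))

end ITS

end

/-! The LOR formula is an exact expansion of e^{-iHt} into unitaries: the rotations reproduce orders
0 and 1 of the exponential series, the Pauli products the higher orders (`hasSum_lor`,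
`hasSum_seqCoeff`). Importance sampling therefore has no Trotter error, and up to the factor a_O
C_T² a sample for O has the expectation ⟨v|O|v⟩ with v = ∫_{-T}^{T} g(t) e^{iE₀t} e^{-iHt} ψ dt
(`Params.integral_sampleValue`).

In an eigenbasis of H, v = F(H - E₀)ψ with F the truncated Fourier transform of g. Without
truncation F(ω) is e^{-β²/(2τ²)} times the mean of e^{-β|x|} for x normal about ω with variance
1/τ². Dropping the absolute value would give e^{-βω} exactly, so the error is a Gaussian tail
(`Params.norm_filter_sub_le`). When E₀ is at least 1/β below E_g, every ω is at least 1/β, and τ =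
√(2ℓ) β, T = 2ℓβ make v agree with w = e^{-β(H-E₀)}ψ up to 2e^{-ℓ}. When E₀ is not too far below, at
β(E_g - E₀) ≤ L, overlap with the ground state gives ‖w‖² ≥ d = p_b e^{-2L}, so the quotient of the
two estimates is stable (`dist_div_lt`).

The total weight of one step is at most exp(3x²/2) with x = h_tot|t|/N_t, so N_t ≥ (h_tot T)² keeps
C_T below a constant (`Params.CT_le`). The samples are then bounded and Chebyshev's inequality gives
a sample size of order 1/(failure probability × precision²), see `Params.dataLaw_not_accurate_le`.

The energy iteration supplies E₀. It starts from |E_g| ≤ h_tot. With β_i = 1/(p_b δE), the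
projection error is at most δE/2 (`IsGroundState.abs_mean_energy_sub_le`) and the statistical error
is kept below δE/4, which gives the factor 3/4. It stops as soon as δE ≤ 1/β. Hence β_i ≤ β/p_b,
there are O(ln(1/ζ)) iterations, and since δE > 1/β ≥ h_tot ζ in each of them, relative precision of
order ζ suffices everywhere. The shift of a run depends only on data independent of that run, so the
failure bounds, uniform in the admissible shift, survive by Fubini (`pi_adaptive_le`), and a union
bound concludes (`totalLaw_compl_successEvent_le`). -/

noncomputable section
namespace ITS
open MeasureTheory

/-! ### Pauli operators -/

theorem pauli_conjTranspose (k : Fin 4) : (pauli k).conjTranspose = pauli k := by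
  fin_cases k <;> ext i j <;> fin_cases i <;> fin_cases j <;> simp [pauli]

theorem pauli_mul_self (k : Fin 4) : pauli k * pauli k = 1 := by
  fin_cases k <;> ext i j <;> fin_cases i <;> fin_cases j <;> simp [pauli, Matrix.mul_apply]

theorem pauliOp_isHermitian {n : ℕ} (P : Fin n → Fin 4) : (pauliOp P).IsHermitian := by
  ext x y
  simp only [pauliOp, Matrix.conjTranspose_apply, Matrix.of_apply, star_prod]
  refine Finset.prod_congr rfl fun q _ => ?_
  conv_rhs => rw [← pauli_conjTranspose (P q)]
  rfl

/-- The sum over intermediate basis states of a product over qubits factorises into single-qubit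
matrix products, each equal to the identity. -/
theorem pauliOp_mul_self {n : ℕ} (P : Fin n → Fin 4) : pauliOp P * pauliOp P = 1 := by
  ext x z
  have h : ∀ q, ∑ y : Fin 2, pauli (P q) (x q) y * pauli (P q) y (z q) =
      if x q = z q then 1 else 0 := by
    intro q
    rw [← Matrix.mul_apply, pauli_mul_self, Matrix.one_apply]
  simp only [pauliOp, Matrix.mul_apply, Matrix.of_apply, ← Finset.prod_mul_distrib]
  have := Finset.prod_univ_sum (fun _ : Fin n => (Finset.univ : Finset (Fin 2)))
    (fun q y => pauli (P q) (x q) y * pauli (P q) y (z q))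
  rw [Fintype.piFinset_univ] at this
  rw [← this, Matrix.one_apply]
  simp only [h]
  rw [Finset.prod_ite_zero]
  simp [funext_iff]

theorem pauliOp_mem_unitary {n : ℕ} (P : Fin n → Fin 4) :
    pauliOp P ∈ Matrix.unitaryGroup (Basis n) ℂ := by
  rw [Matrix.mem_unitaryGroup_iff, Matrix.star_eq_conjTranspose, (pauliOp_isHermitian P).eq,
    pauliOp_mul_self]

theorem linComb_isHermitian {n K : ℕ} (a : Fin K → ℝ) (A : Fin K → Op n)
    (hA : ∀ j, (A j).IsHermitian) : (linComb a A).IsHermitian := by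
  simp only [linComb, Matrix.IsHermitian, Matrix.conjTranspose_sum, Matrix.conjTranspose_smul]
  refine Finset.sum_congr rfl fun j _ => ?_
  rw [(hA j).eq]
  simp

theorem hamiltonian_isHermitian {n M : ℕ} (h : Fin M → ℝ) (P : Fin M → Fin n → Fin 4) :
    (hamiltonian h P).IsHermitian :=
  linComb_isHermitian _ _ fun j => pauliOp_isHermitian (P j)

theorem absSum_nonneg {K : ℕ} (a : Fin K → ℝ) : 0 ≤ absSum a :=
  Finset.sum_nonneg fun _ _ => abs_nonneg _

/-! ### Ordered products of families -/

theorem list_prod_smul {R : Type*} [Ring R] [Algebra ℂ R] {N : ℕ} (c : Fin N → ℂ) (U : Fin N → R) :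
    (List.ofFn fun l => c l • U l).reverse.prod =
      (∏ l, c l) • (List.ofFn fun l => U l).reverse.prod := by
  induction N with
  | zero => simp
  | succ N ih =>
    simp only [List.ofFn_succ, List.reverse_cons, List.prod_append, List.prod_singleton, ih,
      Fin.prod_univ_succ]
    rw [smul_mul_smul_comm, mul_comm]

/-- Iterated Cauchy product. Absolute summability travels with the induction because multiplying two
series over arbitrary index types requires it. Peeling off the first entry puts its factor on the
right, in line with the reversed time order. It serves for the weights, for the unitaries and for
powers of H. -/
theorem hasSum_list_prod {R ι : Type*} [NormedRing R] [NormOneClass R] [CompleteSpace R] (f : ι → R)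
    (hf : Summable fun i => ‖f i‖) (N : ℕ) :
    (Summable fun S : Fin N → ι => ‖(List.ofFn fun l => f (S l)).reverse.prod‖) ∧
    HasSum (fun S : Fin N → ι => (List.ofFn fun l => f (S l)).reverse.prod) ((∑' i, f i) ^ N) := by
  induction N with
  | zero =>
    constructor
    · exact (hasSum_fintype _).summable
    · convert hasSum_fintype (fun S : Fin 0 → ι => (List.ofFn fun l => f (S l)).reverse.prod) using 1
      simp
  | succ N ih =>
    obtain ⟨ih1, ih2⟩ := ih
    have key : ∀ x : ι × (Fin N → ι),
        (List.ofFn fun l => f ((Fin.consEquiv (fun _ : Fin (N + 1) => ι) x) l)).reverse.prod =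
          (List.ofFn fun l => f (x.2 l)).reverse.prod * f x.1 := by
      intro x
      simp [List.ofFn_succ, Fin.consEquiv]
    have hs : Summable fun x : (Fin N → ι) × ι =>
        ‖(List.ofFn fun l => f (x.1 l)).reverse.prod * f x.2‖ :=
      ih1.mul_norm hf
    constructor
    · rw [← (Fin.consEquiv (fun _ : Fin (N + 1) => ι)).summable_iff]
      rw [← (Equiv.prodComm _ _).summable_iff] at hs
      refine hs.congr fun x => ?_
      simp only [Function.comp_apply, key]
      rfl
    · rw [← (Fin.consEquiv (fun _ : Fin (N + 1) => ι)).hasSum_iff]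
      have := ih2.mul hf.of_norm.hasSum hs.of_norm
      rw [← (Equiv.prodComm _ _).hasSum_iff] at this
      rw [pow_succ]
      refine this.congr_fun ?_
      intro x
      simp only [Function.comp_apply, key]
      rfl

theorem list_prod_mem_unitary {n N : ℕ} (U : Fin N → Op n)
    (hU : ∀ l, U l ∈ Matrix.unitaryGroup (Basis n) ℂ) :
    (List.ofFn fun l => U l).reverse.prod ∈ Matrix.unitaryGroup (Basis n) ℂ := by
  refine Submonoid.list_prod_mem _ fun x hx => ?_
  rw [List.mem_reverse, List.mem_ofFn] at hx
  obtain ⟨l, rfl⟩ := hx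
  exact hU l

theorem list_prod_measurable {n N : ℕ} {α : Type*} [MeasurableSpace α] (U : Fin N → α → Op n)
    (hU : ∀ l x y, Measurable fun t => U l t x y) (x y : Basis n) :
    Measurable fun t => (List.ofFn fun l => U l t).reverse.prod x y := by
  induction N generalizing x y with
  | zero => simp
  | succ N ih =>
    simp only [List.ofFn_succ, List.reverse_cons, List.prod_append, List.prod_singleton,
      Matrix.mul_apply]
    exact Finset.measurable_sum _ fun z _ =>
      (ih (fun l => U l.succ) (fun l => hU l.succ) x z).mul (hU 0 z y)

/-! ### The LOR formula -/

/-- The two kinds of labels as a sum type. -/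
def LORIndex.equiv (M : ℕ) : LORIndex M ≃ Fin M ⊕ (Σ k : ℕ, (Fin (k + 2) → Fin M)) where
  toFun
    | .rot j => .inl j
    | .mul k J => .inr ⟨k, J⟩
  invFun
    | .inl j => .rot j
    | .inr ⟨k, J⟩ => .mul k J
  left_inv s := by cases s <;> rfl
  right_inv s := by rcases s with j | ⟨k, J⟩ <;> rfl

instance (M : ℕ) : Countable (LORIndex M) := (LORIndex.equiv M).countable_iff.2 inferInstance

instance (M : ℕ) : DiscreteMeasurableSpace (LORIndex M) := ⟨fun _ => trivial⟩

/-- Even powers of `A` are 1 and odd powers are `A`, so the exponential series splits into those of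
cosh and sinh. -/
theorem exp_smul_of_mul_self_eq_one {R : Type*} [NormedRing R] [NormedAlgebra ℂ R] [CompleteSpace R]
    (A : R) (hA : A * A = 1) (z : ℂ) :
    NormedSpace.exp (z • A) = Complex.cosh z • (1 : R) + Complex.sinh z • A := by
  have h2 : ∀ k : ℕ, A ^ (2 * k) = 1 := fun k => by rw [pow_mul, pow_two, hA, one_pow]
  have h := NormedSpace.exp_series_hasSum_exp' (𝕂 := ℂ) (z • A)
  refine h.unique (HasSum.even_add_odd ?_ ?_)
  · convert (Complex.hasSum_cosh z).smul_const (1 : R) using 2 with k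
    rw [smul_pow, h2, smul_smul, div_eq_inv_mul]
  · convert (Complex.hasSum_sinh z).smul_const A using 2 with k
    rw [smul_pow, pow_succ A, h2, one_mul, smul_smul, div_eq_inv_mul]

open scoped Matrix.Norms.L2Operator

theorem exp_pauliOp {n : ℕ} (P : Fin n → Fin 4) (s φ : ℝ) :
    NormedSpace.exp ((-Complex.I * (s : ℂ) * (φ : ℂ)) • pauliOp P) =
      (Real.cos (s * φ) : ℂ) • (1 : Op n) - (Complex.I * (Real.sin (s * φ) : ℝ)) • pauliOp P := by
  rw [exp_smul_of_mul_self_eq_one _ (pauliOp_mul_self P)]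
  have : (-Complex.I * (s : ℂ) * (φ : ℂ)) = -((s * φ : ℝ) : ℂ) * Complex.I := by push_cast; ring
  rw [this, neg_mul, Complex.cosh_neg, Complex.sinh_neg, Complex.cosh_mul_I, Complex.sinh_mul_I,
    sub_eq_add_neg, ← neg_smul, mul_comm Complex.I]
  simp

theorem exp_I_smul_mem_unitary {n : ℕ} (A : Op n) (hA : A.IsHermitian) (z : ℂ) (hz : star z = -z) :
    NormedSpace.exp (z • A) ∈ Matrix.unitaryGroup (Basis n) ℂ := by
  let : NormedAlgebra ℚ (Op n) := NormedAlgebra.restrictScalars ℚ ℂ (Op n)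
  refine NormedSpace.exp_mem_unitary_of_mem_skewAdjoint ?_
  rw [skewAdjoint.mem_iff, Matrix.star_eq_conjTranspose, Matrix.conjTranspose_smul, hA.eq, hz,
    neg_smul]

theorem lorUnitary_mem_unitary {n M : ℕ} (h : Fin M → ℝ) (P : Fin M → Fin n → Fin 4) (t : ℝ)
    (s : LORIndex M) : lorUnitary h P t s ∈ Matrix.unitaryGroup (Basis n) ℂ := by
  cases s with
  | rot j =>
    refine exp_I_smul_mem_unitary _ (pauliOp_isHermitian _) _ ?_
    simp
  | mul k J => exact list_prod_mem_unitary _ fun l => pauliOp_mem_unitary _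

theorem seqUnitary_mem_unitary {n M N : ℕ} (h : Fin M → ℝ) (P : Fin M → Fin n → Fin 4) (t : ℝ)
    (S : Fin N → LORIndex M) : seqUnitary h P t S ∈ Matrix.unitaryGroup (Basis n) ℂ :=
  list_prod_mem_unitary _ fun _ => lorUnitary_mem_unitary _ _ _ _

theorem norm_of_mem_unitaryGroup {n : ℕ} {U : Op n} (hU : U ∈ Matrix.unitaryGroup (Basis n) ℂ) :
    ‖U‖ = 1 := CStarRing.norm_of_mem_unitary hU

theorem lorAngle_sin {M : ℕ} (h : Fin M → ℝ) (t : ℝ) :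
    Real.sin (lorAngle h t) = absSum h * |t| / Real.sqrt (1 + (absSum h * |t|) ^ 2) :=
  Real.sin_arctan _

theorem lorAngle_cos {M : ℕ} (h : Fin M → ℝ) (t : ℝ) :
    Real.cos (lorAngle h t) = 1 / Real.sqrt (1 + (absSum h * |t|) ^ 2) :=
  Real.cos_arctan _

/-- The terms with one rotation add up to the first two terms of the exponential series. -/
theorem sum_lorCoeff_rot {n M : ℕ} (h : Fin M → ℝ) (P : Fin M → Fin n → Fin 4) (t : ℝ)
    (hh : 0 < absSum h) (ht : t ≠ 0) :
    ∑ j, lorCoeff h t (.rot j) • lorUnitary h P t (.rot j) =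
      1 + (-Complex.I * (t : ℂ)) • hamiltonian h P := by
  have hx : 0 < absSum h * |t| := mul_pos hh (abs_pos.2 ht)
  have hr : 0 < Real.sqrt (1 + (absSum h * |t|) ^ 2) := Real.sqrt_pos.2 (by positivity)
  have hsin : 0 < Real.sin (lorAngle h t) := by rw [lorAngle_sin]; positivity
  -- Since tan φ = h_tot|t|, division by sin φ turns the cosine part into the share |h_j|/h_tot of
  -- the identity and the sine part into exactly -i t h_j σ_j.
  have key : ∀ j, lorCoeff h t (.rot j) • lorUnitary h P t (.rot j) =
      ((|h j| / absSum h : ℝ) : ℂ) • (1 : Op n) +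
        (-Complex.I * (t : ℂ)) • ((h j : ℂ) • pauliOp (P j)) := by
    intro j
    simp only [lorCoeff, lorUnitary]
    rw [exp_pauliOp, smul_sub, smul_smul, smul_smul, smul_smul, sub_eq_add_neg, ← neg_smul]
    have hc : |h j * t| / Real.sin (lorAngle h t) * Real.cos (Real.sign (h j * t) * lorAngle h t) =
        |h j| / absSum h := by
      rcases lt_trichotomy (h j * t) 0 with hj | hj | hj
      · rw [Real.sign_of_neg hj, neg_one_mul, Real.cos_neg, lorAngle_sin, lorAngle_cos, abs_mul]
        have := abs_pos.2 ht
        field_simp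
      · have : h j = 0 := by simpa [ht] using hj
        simp [this]
      · rw [Real.sign_of_pos hj, one_mul, lorAngle_sin, lorAngle_cos, abs_mul]
        have := abs_pos.2 ht
        field_simp
    have hs : |h j * t| / Real.sin (lorAngle h t) * Real.sin (Real.sign (h j * t) * lorAngle h t) =
        h j * t := by
      rcases lt_trichotomy (h j * t) 0 with hj | hj | hj
      · rw [Real.sign_of_neg hj, neg_one_mul, Real.sin_neg, abs_of_neg hj]
        field_simp
      · simp [hj]
      · rw [Real.sign_of_pos hj, one_mul, abs_of_pos hj]
        field_simp
    congr 1
    · rw [← Complex.ofReal_mul, hc]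
    · congr 1
      rw [mul_left_comm, ← Complex.ofReal_mul, hs]
      push_cast
      ring
  simp only [key, Finset.sum_add_distrib, ← Finset.sum_smul, ← Finset.smul_sum]
  congr 1
  rw [← Complex.ofReal_sum, ← Finset.sum_div]
  rw [show (∑ j, |h j|) = absSum h from rfl, div_self hh.ne']
  simp

/-- With x = h_tot|t| the weights add up to x / sin(arctan x). This is 1 + O(x²), whereas the first
two Taylor terms taken separately have weight 1 + x; the missing linear term is what keeps C_T
bounded for N_t of order (h_tot T)². -/
theorem sum_norm_lorCoeff_rot {M : ℕ} (h : Fin M → ℝ) (t : ℝ) (hh : 0 < absSum h) (ht : t ≠ 0) :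
    ∑ j, ‖lorCoeff h t (.rot j)‖ = Real.sqrt (1 + (absSum h * |t|) ^ 2) := by
  have hx : 0 < absSum h * |t| := mul_pos hh (abs_pos.2 ht)
  have hr : 0 < Real.sqrt (1 + (absSum h * |t|) ^ 2) := Real.sqrt_pos.2 (by positivity)
  have hsin : 0 < Real.sin (lorAngle h t) := by rw [lorAngle_sin]; positivity
  have : ∀ j, ‖lorCoeff h t (.rot j)‖ = |h j| * (|t| / Real.sin (lorAngle h t)) := by
    intro j
    simp only [lorCoeff]
    rw [Complex.norm_real, Real.norm_of_nonneg (by positivity), abs_mul, mul_div_assoc]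
  simp only [this, ← Finset.sum_mul]
  rw [show (∑ j, |h j|) = absSum h from rfl, lorAngle_sin]
  have := abs_pos.2 ht
  field_simp

/-- Expanding a power of H into words of Pauli operators is the finite case of `hasSum_list_prod`.
-/
theorem sum_lorCoeff_mul {n M : ℕ} (h : Fin M → ℝ) (P : Fin M → Fin n → Fin 4) (t : ℝ) (k : ℕ) :
    ∑ J, lorCoeff h t (.mul k J) • lorUnitary h P t (.mul k J) =
      ((k + 2).factorial : ℂ)⁻¹ • ((-Complex.I * (t : ℂ)) • hamiltonian h P) ^ (k + 2) := by
  have h1 := (hasSum_list_prod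
    (fun j : Fin M => (-Complex.I * (h j : ℂ) * (t : ℂ)) • pauliOp (P j))
    (hasSum_fintype _).summable (k + 2)).2
  have h2 := (hasSum_fintype _).unique h1
  simp only [list_prod_smul] at h2
  have h3 : (-Complex.I * (t : ℂ)) • hamiltonian h P =
      ∑' j, (-Complex.I * (h j : ℂ) * (t : ℂ)) • pauliOp (P j) := by
    rw [tsum_fintype, hamiltonian, linComb, Finset.smul_sum]
    refine Finset.sum_congr rfl fun j _ => ?_
    rw [smul_smul]
    congr 1
    ring
  rw [h3, ← h2, Finset.smul_sum]
  refine Finset.sum_congr rfl fun J _ => ?_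
  simp only [lorCoeff, lorUnitary]
  rw [smul_smul, div_eq_inv_mul]

theorem sum_norm_lorCoeff_mul {M : ℕ} (h : Fin M → ℝ) (t : ℝ) (k : ℕ) :
    ∑ J, ‖lorCoeff h t (.mul k J)‖ = (absSum h * |t|) ^ (k + 2) / ((k + 2).factorial : ℝ) := by
  have : ∀ J : Fin (k + 2) → Fin M, ‖lorCoeff h t (.mul k J)‖ =
      (∏ a, (|h (J a)| * |t|)) / ((k + 2).factorial : ℝ) := by
    intro J
    simp [lorCoeff, norm_prod]
  simp only [this, ← Finset.sum_div]
  congr 1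
  have h1 := Finset.prod_univ_sum (fun _ : Fin (k + 2) => (Finset.univ : Finset (Fin M)))
    (fun _ j => |h j| * |t|)
  rw [Fintype.piFinset_univ] at h1
  rw [← h1, Finset.prod_const, ← Finset.sum_mul]
  simp [absSum]

theorem hasSum_norm_lorCoeff {M : ℕ} (h : Fin M → ℝ) (t : ℝ) (hh : 0 < absSum h) (ht : t ≠ 0) :
    HasSum (fun s => ‖lorCoeff h t s‖) (lorTotal h t) := by
  have hk : HasSum (fun k : ℕ => (absSum h * |t|) ^ (k + 2) / ((k + 2).factorial : ℝ))
      (Real.exp (absSum h * |t|) - (1 + absSum h * |t|)) := by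
    have := NormedSpace.expSeries_div_hasSum_exp (absSum h * |t|)
    rw [← Real.exp_eq_exp_ℝ] at this
    have := (hasSum_nat_add_iff' 2).2 this
    simpa [Finset.sum_range_succ] using this
  have hs : Summable fun x : Σ k : ℕ, (Fin (k + 2) → Fin M) => ‖lorCoeff h t (.mul x.1 x.2)‖ := by
    rw [summable_sigma_of_nonneg fun _ => norm_nonneg _]
    refine ⟨fun k => (hasSum_fintype _).summable, ?_⟩
    simp only [tsum_fintype, sum_norm_lorCoeff_mul]
    exact hk.summable
  have h2 : HasSum (fun x : Σ k : ℕ, (Fin (k + 2) → Fin M) => ‖lorCoeff h t (.mul x.1 x.2)‖)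
      (Real.exp (absSum h * |t|) - (1 + absSum h * |t|)) := by
    refine HasSum.sigma_of_hasSum hk (fun k => ?_) hs
    rw [← sum_norm_lorCoeff_mul]
    exact hasSum_fintype _
  have h1 := hasSum_fintype fun j : Fin M => ‖lorCoeff h t (.rot j)‖
  rw [sum_norm_lorCoeff_rot h t hh ht] at h1
  rw [← (LORIndex.equiv M).symm.hasSum_iff, lorTotal, add_sub_assoc]
  exact HasSum.sum (f := (fun s => ‖lorCoeff h t s‖) ∘ (LORIndex.equiv M).symm) h1 h2

/-- The rotations supply orders 0 and 1 of the exponential series, the products of k + 2 factors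
supply order k + 2. Unitaries have operator norm one, so absolute convergence is that of the
weights. -/
theorem hasSum_lor {n M : ℕ} (h : Fin M → ℝ) (P : Fin M → Fin n → Fin 4) (t : ℝ)
    (hh : 0 < absSum h) (ht : t ≠ 0) :
    HasSum (fun s => lorCoeff h t s • lorUnitary h P t s)
      (NormedSpace.exp ((-Complex.I * (t : ℂ)) • hamiltonian h P)) := by
  have hn : Summable fun s => ‖lorCoeff h t s • lorUnitary h P t s‖ := by
    simp only [norm_smul, norm_of_mem_unitaryGroup (lorUnitary_mem_unitary h P t _), mul_one]
    exact (hasSum_norm_lorCoeff h t hh ht).summable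
  have hk : HasSum (fun k : ℕ => ((k + 2).factorial : ℂ)⁻¹ •
        ((-Complex.I * (t : ℂ)) • hamiltonian h P) ^ (k + 2))
      (NormedSpace.exp ((-Complex.I * (t : ℂ)) • hamiltonian h P) -
        (1 + (-Complex.I * (t : ℂ)) • hamiltonian h P)) := by
    have := NormedSpace.exp_series_hasSum_exp' (𝕂 := ℂ) ((-Complex.I * (t : ℂ)) • hamiltonian h P)
    have := (hasSum_nat_add_iff' 2).2 this
    simpa [Finset.sum_range_succ] using this
  have h2 : HasSum (fun x : Σ k : ℕ, (Fin (k + 2) → Fin M) =>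
        lorCoeff h t (.mul x.1 x.2) • lorUnitary h P t (.mul x.1 x.2))
      (NormedSpace.exp ((-Complex.I * (t : ℂ)) • hamiltonian h P) -
        (1 + (-Complex.I * (t : ℂ)) • hamiltonian h P)) := by
    refine HasSum.sigma_of_hasSum hk (fun k => ?_) ?_
    · rw [← sum_lorCoeff_mul]
      exact hasSum_fintype _
    · have hi : Function.Injective
          fun x : Σ k : ℕ, (Fin (k + 2) → Fin M) => LORIndex.mul x.1 x.2 :=
        (LORIndex.equiv M).symm.injective.comp Sum.inr_injective
      exact hn.of_norm.comp_injective hi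
  have h1 := hasSum_fintype fun j : Fin M => lorCoeff h t (.rot j) • lorUnitary h P t (.rot j)
  rw [sum_lorCoeff_rot h P t hh ht] at h1
  rw [← (LORIndex.equiv M).symm.hasSum_iff]
  have := HasSum.sum (f := (fun s => lorCoeff h t s • lorUnitary h P t s) ∘
    (LORIndex.equiv M).symm) h1 h2
  simpa using this

/-! ### Sequences of terms -/

/-- The complex coefficient of a sequence of terms. -/
def seqCoeff {M N : ℕ} (h : Fin M → ℝ) (t : ℝ) (S : Fin N → LORIndex M) : ℂ :=
  ∏ l, lorCoeff h (t / N) (S l)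

theorem norm_seqCoeff {M N : ℕ} (h : Fin M → ℝ) (t : ℝ) (S : Fin N → LORIndex M) :
    ‖seqCoeff h t S‖ = seqWeight h t S := norm_prod _ _

theorem seqWeight_nonneg {M N : ℕ} (h : Fin M → ℝ) (t : ℝ) (S : Fin N → LORIndex M) :
    0 ≤ seqWeight h t S := Finset.prod_nonneg fun _ _ => norm_nonneg _

theorem seqWeight_mul_exp {M N : ℕ} (h : Fin M → ℝ) (t : ℝ) (S : Fin N → LORIndex M) :
    (seqWeight h t S : ℂ) * Complex.exp (Complex.I * (seqPhase h t S : ℂ)) = seqCoeff h t S := by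
  simp only [seqWeight, seqPhase, seqCoeff, Complex.ofReal_sum, Complex.ofReal_prod, Finset.mul_sum,
    Complex.exp_sum, ← Finset.prod_mul_distrib]
  refine Finset.prod_congr rfl fun l _ => ?_
  rw [mul_comm Complex.I]
  exact Complex.norm_mul_exp_arg_mul_I _

theorem hasSum_seqWeight {M N : ℕ} (h : Fin M → ℝ) (t : ℝ) (hh : 0 < absSum h) (ht : t ≠ 0)
    (hN : 0 < N) :
    HasSum (fun S : Fin N → LORIndex M => seqWeight h t S) (lorTotal h (t / N) ^ N) := by
  have ht' : t / (N : ℝ) ≠ 0 := div_ne_zero ht (by positivity)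
  have h1 := hasSum_norm_lorCoeff h (t / N) hh ht'
  have h2 := (hasSum_list_prod (fun s => ‖lorCoeff h (t / N) s‖) h1.summable.norm N).2
  rw [h1.tsum_eq] at h2
  refine h2.congr_fun ?_
  intro S
  rw [List.prod_reverse, List.prod_ofFn, seqWeight]

/-- Each step expands the evolution for time t/N exactly, and the N-th power of that evolution is
e^{-iHt}; no Trotter error arises. -/
theorem hasSum_seqCoeff {n M N : ℕ} (h : Fin M → ℝ) (P : Fin M → Fin n → Fin 4) (t : ℝ)
    (hh : 0 < absSum h) (ht : t ≠ 0) (hN : 0 < N) :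
    HasSum (fun S : Fin N → LORIndex M => seqCoeff h t S • seqUnitary h P t S)
      (NormedSpace.exp ((-Complex.I * (t : ℂ)) • hamiltonian h P)) := by
  have hN' : (N : ℝ) ≠ 0 := by positivity
  have ht' : t / (N : ℝ) ≠ 0 := div_ne_zero ht hN'
  have h1 := hasSum_lor h P (t / N) hh ht'
  have hn : Summable fun s => ‖lorCoeff h (t / N) s • lorUnitary h P (t / N) s‖ := by
    simp only [norm_smul, norm_of_mem_unitaryGroup (lorUnitary_mem_unitary h P _ _), mul_one]
    exact (hasSum_norm_lorCoeff h _ hh ht').summable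
  have h2 := (hasSum_list_prod _ hn N).2
  rw [h1.tsum_eq, ← Matrix.exp_nsmul, ← Nat.cast_smul_eq_nsmul ℂ, smul_smul] at h2
  have h3 : (N : ℂ) * (-Complex.I * ((t / N : ℝ) : ℂ)) = -Complex.I * (t : ℂ) := by
    have : (N : ℂ) ≠ 0 := by exact_mod_cast hN'
    push_cast
    field_simp
  rw [h3] at h2
  refine h2.congr_fun ?_
  intro S
  rw [list_prod_smul]
  rfl

/-! ### The Hadamard test -/

theorem norm_sq_eq_braket {n : ℕ} (p : Vec n) : (∑ x, ‖p x‖ ^ 2 : ℝ) = (braket p p).re := by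
  simp only [braket, dotProduct, Complex.re_sum, Pi.star_apply]
  refine Finset.sum_congr rfl fun x _ => ?_
  rw [Complex.star_def, ← Complex.normSq_eq_conj_mul_self, Complex.ofReal_re, Complex.normSq_eq_norm_sq]

theorem sum_norm_sq_add {n : ℕ} (p q : Vec n) (c : ℂ) (hc : ‖c‖ = 1) :
    ∑ x, ‖p x + c * q x‖ ^ 2 =
      (braket p p).re + (braket q q).re + 2 * (c * braket p q).re := by
  rw [← norm_sq_eq_braket, ← norm_sq_eq_braket]
  simp only [braket, dotProduct, Finset.mul_sum, Complex.re_sum, ← Finset.sum_add_distrib]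
  refine Finset.sum_congr rfl fun x _ => ?_
  have h := Complex.normSq_add (p x) (c * q x)
  rw [Complex.normSq_eq_norm_sq, Complex.normSq_eq_norm_sq, Complex.normSq_eq_norm_sq, norm_mul, hc,
    one_mul] at h
  rw [h]
  have : (p x * (starRingEnd ℂ) (c * q x)).re = (c * (star p x * q x)).re := by
    rw [← Complex.conj_re]
    simp only [map_mul, Complex.conj_conj, Pi.star_apply, Complex.star_def]
    congr 1
    ring
  rw [this]

theorem braket_mulVec_unitary {n : ℕ} {U : Op n} (hU : U ∈ Matrix.unitaryGroup (Basis n) ℂ)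
    (φ : Vec n) : braket (U.mulVec φ) (U.mulVec φ) = braket φ φ := by
  rw [braket, Matrix.star_mulVec, ← Matrix.dotProduct_mulVec, Matrix.mulVec_mulVec,
    ← Matrix.star_eq_conjTranspose, Matrix.mem_unitaryGroup_iff'.1 hU, Matrix.one_mulVec, braket]

theorem norm_outcome (b : Bool) : ‖(outcome b : ℂ)‖ = 1 := by cases b <;> simp [outcome]

theorem testState_zero {n : ℕ} (V V' A : Op n) (ψ : Vec n) :
    testState V V' A ψ 0 = ((1 / Real.sqrt 2 : ℝ) : ℂ) • V'.mulVec ψ := by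
  simp [testState, controlled, Matrix.mulVec_smul]

theorem testState_one {n : ℕ} (V V' A : Op n) (ψ : Vec n) :
    testState V V' A ψ 1 = ((1 / Real.sqrt 2 : ℝ) : ℂ) • A.mulVec (V.mulVec ψ) := by
  simp [testState, controlled, Matrix.mulVec_smul]

/-- The ancilla branches 0 and 1 carry V'ψ and AVψ, each of unit norm before the factor 1/√2.
Projection of the ancilla onto (1, c̄)/√2 makes them interfere, and the cross term is the real part
of c times the overlap. Measuring X is c = ±1; measuring Y is c = ∓i, which selects the imaginary
part. -/
theorem bornProb_testState {n : ℕ} (V V' A : Op n) (ψ : Vec n) (c : ℂ) (hc : ‖c‖ = 1)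
    (hV : V ∈ Matrix.unitaryGroup (Basis n) ℂ) (hV' : V' ∈ Matrix.unitaryGroup (Basis n) ℂ)
    (hA : A ∈ Matrix.unitaryGroup (Basis n) ℂ) (hψ : braket ψ ψ = 1) :
    bornProb (((1 / Real.sqrt 2 : ℝ) : ℂ) • ![1, star c]) (testState V V' A ψ) =
      (1 + (c * braket (V'.mulVec ψ) (A.mulVec (V.mulVec ψ))).re) / 2 := by
  have h2 : ((1 / Real.sqrt 2 : ℝ) : ℂ) * ((1 / Real.sqrt 2 : ℝ) : ℂ) = 1 / 2 := by
    rw [← Complex.ofReal_mul, div_mul_div_comm, Real.mul_self_sqrt (by norm_num)]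
    norm_num
  have key : ∀ x, ‖∑ a, star ((((1 / Real.sqrt 2 : ℝ) : ℂ) • ![1, star c]) a) *
      testState V V' A ψ a x‖ ^ 2 =
      (1 / 4) * ‖V'.mulVec ψ x + c * A.mulVec (V.mulVec ψ) x‖ ^ 2 := by
    intro x
    rw [Fin.sum_univ_two, testState_zero, testState_one]
    have : star ((((1 / Real.sqrt 2 : ℝ) : ℂ) • ![1, star c]) 0) *
          (((1 / Real.sqrt 2 : ℝ) : ℂ) • V'.mulVec ψ) x +
        star ((((1 / Real.sqrt 2 : ℝ) : ℂ) • ![1, star c]) 1) *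
          (((1 / Real.sqrt 2 : ℝ) : ℂ) • A.mulVec (V.mulVec ψ)) x =
        (1 / 2 : ℂ) * (V'.mulVec ψ x + c * A.mulVec (V.mulVec ψ) x) := by
      simp only [Pi.smul_apply, smul_eq_mul, star_mul', Matrix.cons_val_zero, Matrix.cons_val_one,
        Complex.star_def, Complex.conj_ofReal, mul_one, Complex.conj_conj]
      linear_combination (V'.mulVec ψ x + c * A.mulVec (V.mulVec ψ) x) * h2
    rw [this, norm_mul, mul_pow]
    norm_num
  rw [bornProb]
  simp only [key]
  rw [← Finset.mul_sum, sum_norm_sq_add _ _ _ hc, braket_mulVec_unitary hV',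
    braket_mulVec_unitary hA, braket_mulVec_unitary hV, hψ, Complex.one_re]
  ring

theorem bornProb_xVec {n : ℕ} (V V' A : Op n) (ψ : Vec n) (b : Bool)
    (hV : V ∈ Matrix.unitaryGroup (Basis n) ℂ) (hV' : V' ∈ Matrix.unitaryGroup (Basis n) ℂ)
    (hA : A ∈ Matrix.unitaryGroup (Basis n) ℂ) (hψ : braket ψ ψ = 1) :
    bornProb (xVec b) (testState V V' A ψ) =
      (1 + outcome b * (braket (V'.mulVec ψ) (A.mulVec (V.mulVec ψ))).re) / 2 := by
  have := bornProb_testState V V' A ψ (outcome b : ℂ) (norm_outcome b) hV hV' hA hψ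
  rw [Complex.re_ofReal_mul] at this
  rw [← this, xVec]
  simp

theorem bornProb_yVec {n : ℕ} (V V' A : Op n) (ψ : Vec n) (b : Bool)
    (hV : V ∈ Matrix.unitaryGroup (Basis n) ℂ) (hV' : V' ∈ Matrix.unitaryGroup (Basis n) ℂ)
    (hA : A ∈ Matrix.unitaryGroup (Basis n) ℂ) (hψ : braket ψ ψ = 1) :
    bornProb (yVec b) (testState V V' A ψ) =
      (1 + outcome b * (braket (V'.mulVec ψ) (A.mulVec (V.mulVec ψ))).im) / 2 := by
  have := bornProb_testState V V' A ψ (-Complex.I * (outcome b : ℂ)) (by rw [norm_mul, norm_outcome]; simp)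
    hV hV' hA hψ
  rw [show yVec b = ((1 / Real.sqrt 2 : ℝ) : ℂ) • ![1, star (-Complex.I * (outcome b : ℂ))] by
    simp [yVec], this]
  congr 2
  simp [mul_comm]

theorem bornProb_nonneg {n : ℕ} (v : Fin 2 → ℂ) (Φ : Fin 2 → Vec n) : 0 ≤ bornProb v Φ :=
  Finset.sum_nonneg fun _ _ => by positivity

/-! ### The measure on pairs of a time and a sequence of terms -/

/-- Lebesgue measure on `[-T, T]` times counting measure on sequences. -/
def Params.seqMeasure (p : Params) (M : ℕ) : Measure (ℝ × (Fin p.Nt → LORIndex M)) :=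
  (volume.restrict (Set.Icc (-p.T) p.T)).prod Measure.count

instance (p : Params) (M : ℕ) : SigmaFinite (p.seqMeasure M) := by
  unfold Params.seqMeasure; infer_instance

theorem Params.baseMeasure_eq (p : Params) (M K : ℕ) :
    p.baseMeasure M K = (p.seqMeasure M).prod ((p.seqMeasure M).prod Measure.count) := rfl

theorem lorTotal_continuous {M : ℕ} (h : Fin M → ℝ) : Continuous (lorTotal h) := by
  unfold lorTotal; fun_prop

theorem Params.g_continuous (p : Params) : Continuous p.g := by
  have := p.β_pos
  have h1 : ∀ t : ℝ, p.β ^ 2 + t ^ 2 ≠ 0 := fun t => by positivity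
  have h2 : (2 * p.τ ^ 2) ≠ 0 := by have := p.τ_pos; positivity
  unfold Params.g
  fun_prop (disch := simp_all)

theorem Params.g_pos (p : Params) (t : ℝ) : 0 < p.g t := by
  have := p.β_pos
  unfold Params.g
  positivity

theorem lorCoeff_measurable {M : ℕ} (h : Fin M → ℝ) (s : LORIndex M) :
    Measurable fun t => lorCoeff h t s := by
  cases s with
  | rot j =>
    simp only [lorCoeff, lorAngle]
    fun_prop
  | mul k J =>
    simp only [lorCoeff]
    fun_prop

theorem real_sign_measurable : Measurable Real.sign := by
  unfold Real.sign
  exact Measurable.ite measurableSet_Iio measurable_const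
    (Measurable.ite measurableSet_Ioi measurable_const measurable_const)

theorem lorUnitary_measurable {n M : ℕ} (h : Fin M → ℝ) (P : Fin M → Fin n → Fin 4)
    (s : LORIndex M) (x y : Basis n) : Measurable fun t => lorUnitary h P t s x y := by
  cases s with
  | rot j =>
    simp only [lorUnitary, exp_pauliOp, lorAngle, Matrix.sub_apply, Matrix.smul_apply]
    have := real_sign_measurable
    fun_prop
  | mul k J => simp only [lorUnitary, measurable_const]

theorem seqCoeff_measurable {M N : ℕ} (h : Fin M → ℝ) :
    Measurable fun x : ℝ × (Fin N → LORIndex M) => seqCoeff h x.1 x.2 := by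
  refine measurable_from_prod_countable_left fun S => ?_
  exact Finset.measurable_prod _ fun l _ =>
    (lorCoeff_measurable h (S l)).comp (measurable_id.div_const _)

theorem seqWeight_measurable {M N : ℕ} (h : Fin M → ℝ) :
    Measurable fun x : ℝ × (Fin N → LORIndex M) => seqWeight h x.1 x.2 := by
  simp only [← norm_seqCoeff]
  exact (seqCoeff_measurable h).norm

theorem seqPhase_measurable {M N : ℕ} (h : Fin M → ℝ) :
    Measurable fun x : ℝ × (Fin N → LORIndex M) => seqPhase h x.1 x.2 := by
  refine measurable_from_prod_countable_left fun S => ?_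
  exact Finset.measurable_sum _ fun l _ =>
    Complex.measurable_arg.comp ((lorCoeff_measurable h (S l)).comp (measurable_id.div_const _))

theorem seqUnitary_mulVec_measurable {n M N : ℕ} (h : Fin M → ℝ) (P : Fin M → Fin n → Fin 4)
    (ψ : Vec n) (y : Basis n) :
    Measurable fun x : ℝ × (Fin N → LORIndex M) => (seqUnitary h P x.1 x.2).mulVec ψ y := by
  refine measurable_from_prod_countable_left fun S => ?_
  simp only [Matrix.mulVec, dotProduct]
  refine Finset.measurable_sum _ fun z _ => Measurable.mul_const ?_ _
  exact list_prod_measurable _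
    (fun l x y => (lorUnitary_measurable h P (S l) x y).comp (measurable_id.div_const _)) _ _

/-- At t = 0 the rotation coefficient is 0/0, evaluated as 0, and the LOR identities fail there. All
integrals over time discard this null set. -/
theorem ae_ne_zero_Icc (T : ℝ) : ∀ᵐ t : ℝ ∂(volume.restrict (Set.Icc (-T) T)), t ≠ 0 :=
  ae_restrict_of_ae (Measure.ae_ne volume 0)

theorem Params.CT_eq {M : ℕ} (p : Params) (h : Fin M → ℝ) :
    p.CT h = ∫ t in Set.Icc (-p.T) p.T, p.g t * lorTotal h (t / p.Nt) ^ p.Nt := by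
  rw [Params.CT, intervalIntegral.integral_of_le (by linarith [p.T_pos]), integral_Icc_eq_integral_Ioc]

theorem Params.integrand_continuous {M : ℕ} (p : Params) (h : Fin M → ℝ) :
    Continuous fun t => p.g t * lorTotal h (t / p.Nt) ^ p.Nt :=
  p.g_continuous.mul (((lorTotal_continuous h).comp (continuous_id.div_const _)).pow _)

/-- The unnormalised density of a time and a sequence. -/
def Params.density {M : ℕ} (p : Params) (h : Fin M → ℝ) (x : ℝ × (Fin p.Nt → LORIndex M)) : ℝ :=
  p.g x.1 * seqWeight h x.1 x.2

theorem Params.density_nonneg {M : ℕ} (p : Params) (h : Fin M → ℝ)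
    (x : ℝ × (Fin p.Nt → LORIndex M)) : 0 ≤ p.density h x :=
  mul_nonneg (p.g_pos _).le (seqWeight_nonneg _ _ _)

theorem Params.density_measurable {M : ℕ} (p : Params) (h : Fin M → ℝ) :
    Measurable (p.density h) :=
  (p.g_continuous.measurable.comp measurable_fst).mul (seqWeight_measurable h)

theorem Params.hasSum_density {M : ℕ} (p : Params) (h : Fin M → ℝ) (hh : 0 < absSum h) (t : ℝ)
    (ht : t ≠ 0) :
    HasSum (fun S => p.density h (t, S)) (p.g t * lorTotal h (t / p.Nt) ^ p.Nt) :=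
  (hasSum_seqWeight h t hh ht p.Nt_pos).mul_left _

theorem integral_count_of_hasSum {ι E : Type*} [MeasurableSpace ι] [Countable ι]
    [MeasurableSingletonClass ι] [NormedAddCommGroup E] [NormedSpace ℝ E] [CompleteSpace E]
    {f : ι → E} {a : E} (hn : Summable fun i => ‖f i‖) (hf : HasSum f a) :
    ∫ i, f i ∂Measure.count = a := by
  rw [integral_countable (integrable_count_iff.2 hn)]
  simp [Measure.real, hf.tsum_eq]

theorem Params.density_integrable {M : ℕ} (p : Params) (h : Fin M → ℝ) (hh : 0 < absSum h) :
    Integrable (p.density h) (p.seqMeasure M) := by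
  unfold Params.seqMeasure
  rw [integrable_prod_iff (p.density_measurable h).aestronglyMeasurable]
  constructor
  · filter_upwards [ae_ne_zero_Icc p.T] with t ht
    exact integrable_count_iff.2 (p.hasSum_density h hh t ht).summable.norm
  · refine Integrable.congr
      ((p.integrand_continuous h).continuousOn.integrableOn_compact isCompact_Icc) ?_
    filter_upwards [ae_ne_zero_Icc p.T] with t ht
    have h1 := p.hasSum_density h hh t ht
    simp only [Real.norm_of_nonneg (p.density_nonneg h _)]
    exact (integral_count_of_hasSum h1.summable.norm h1).symm

theorem Params.integral_density {M : ℕ} (p : Params) (h : Fin M → ℝ) (hh : 0 < absSum h) :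
    ∫ x, p.density h x ∂(p.seqMeasure M) = p.CT h := by
  have := p.density_integrable h hh
  unfold Params.seqMeasure at this ⊢
  rw [integral_prod _ this, p.CT_eq]
  refine integral_congr_ae ?_
  filter_upwards [ae_ne_zero_Icc p.T] with t ht
  have h1 := p.hasSum_density h hh t ht
  exact integral_count_of_hasSum h1.summable.norm h1

theorem lorTotal_ge_one {M : ℕ} (h : Fin M → ℝ) (t : ℝ) : 1 ≤ lorTotal h t := by
  have h1 : 1 ≤ Real.sqrt (1 + (absSum h * |t|) ^ 2) := Real.one_le_sqrt.2 (by nlinarith)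
  have h2 := Real.add_one_le_exp (absSum h * |t|)
  unfold lorTotal
  linarith

theorem Params.CT_pos {M : ℕ} (p : Params) (h : Fin M → ℝ) : 0 < p.CT h := by
  refine intervalIntegral.intervalIntegral_pos_of_pos_on
    ((p.integrand_continuous h).intervalIntegrable _ _) (fun t _ => ?_) (by linarith [p.T_pos])
  exact mul_pos (p.g_pos t) (pow_pos (by linarith [lorTotal_ge_one h (t / p.Nt)]) _)

/-! ### The amplitude of a sample -/

/-- The vector that a time and a sequence contribute to the approximate imaginary-time evolution. -/
def Params.amplitude {n M : ℕ} (p : Params) (h : Fin M → ℝ) (P : Fin M → Fin n → Fin 4)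
    (ψ : Vec n) (E₀ : ℝ) (x : ℝ × (Fin p.Nt → LORIndex M)) (y : Basis n) : ℂ :=
  (p.g x.1 : ℂ) * Complex.exp (Complex.I * (E₀ * x.1 : ℝ)) * seqCoeff h x.1 x.2 *
    (seqUnitary h P x.1 x.2).mulVec ψ y

/-- The approximate imaginary-time evolution, implemented by ITS on average. -/
def Params.mean {n M : ℕ} (p : Params) (h : Fin M → ℝ) (P : Fin M → Fin n → Fin 4)
    (ψ : Vec n) (E₀ : ℝ) (y : Basis n) : ℂ :=
  ∫ t in Set.Icc (-p.T) p.T, (p.g t : ℂ) * Complex.exp (Complex.I * (E₀ * t : ℝ)) *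
    (NormedSpace.exp ((-Complex.I * (t : ℂ)) • hamiltonian h P)).mulVec ψ y

theorem norm_mulVec_apply_le {n : ℕ} {U : Op n} (hU : U ∈ Matrix.unitaryGroup (Basis n) ℂ)
    {ψ : Vec n} (hψ : braket ψ ψ = 1) (y : Basis n) : ‖U.mulVec ψ y‖ ≤ 1 := by
  have h1 : ∑ x, ‖U.mulVec ψ x‖ ^ 2 = 1 := by
    rw [norm_sq_eq_braket, braket_mulVec_unitary hU, hψ, Complex.one_re]
  have h2 := Finset.single_le_sum (f := fun x => ‖U.mulVec ψ x‖ ^ 2)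
    (fun x _ => by positivity) (Finset.mem_univ y)
  rw [h1] at h2
  nlinarith [norm_nonneg (U.mulVec ψ y)]

theorem Params.norm_amplitude_le {n M : ℕ} (p : Params) (h : Fin M → ℝ) (P : Fin M → Fin n → Fin 4)
    (ψ : Vec n) (hψ : braket ψ ψ = 1) (E₀ : ℝ) (x : ℝ × (Fin p.Nt → LORIndex M)) (y : Basis n) :
    ‖p.amplitude h P ψ E₀ x y‖ ≤ p.density h x := by
  rw [Params.amplitude, norm_mul, norm_mul, norm_mul, norm_seqCoeff, mul_comm Complex.I,
    Complex.norm_exp_ofReal_mul_I, Complex.norm_real, Real.norm_of_nonneg (p.g_pos _).le, mul_one]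
  exact mul_le_of_le_one_right (p.density_nonneg h x)
    (norm_mulVec_apply_le (seqUnitary_mem_unitary h P _ _) hψ y)

theorem Params.amplitude_measurable {n M : ℕ} (p : Params) (h : Fin M → ℝ)
    (P : Fin M → Fin n → Fin 4) (ψ : Vec n) (E₀ : ℝ) (y : Basis n) :
    Measurable fun x => p.amplitude h P ψ E₀ x y := by
  have := p.g_continuous.measurable
  refine Measurable.mul (Measurable.mul ?_ (seqCoeff_measurable h))
    (seqUnitary_mulVec_measurable h P ψ y)
  fun_prop

theorem Params.amplitude_integrable {n M : ℕ} (p : Params) (h : Fin M → ℝ) (hh : 0 < absSum h)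
    (P : Fin M → Fin n → Fin 4) (ψ : Vec n) (hψ : braket ψ ψ = 1) (E₀ : ℝ) (y : Basis n) :
    Integrable (fun x => p.amplitude h P ψ E₀ x y) (p.seqMeasure M) :=
  (p.density_integrable h hh).mono' (p.amplitude_measurable h P ψ E₀ y).aestronglyMeasurable
    (.of_forall fun x => p.norm_amplitude_le h P ψ hψ E₀ x y)

/-- Domination by `Params.density` permits Fubini. Summing over the sequences first resums the LOR
formula to e^{-iHt} at each time, and only the time integral remains. -/
theorem Params.integral_amplitude {n M : ℕ} (p : Params) (h : Fin M → ℝ) (hh : 0 < absSum h)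
    (P : Fin M → Fin n → Fin 4) (ψ : Vec n) (hψ : braket ψ ψ = 1) (E₀ : ℝ) (y : Basis n) :
    ∫ x, p.amplitude h P ψ E₀ x y ∂(p.seqMeasure M) = p.mean h P ψ E₀ y := by
  have hi := p.amplitude_integrable h hh P ψ hψ E₀ y
  unfold Params.seqMeasure at hi ⊢
  rw [integral_prod _ hi, Params.mean]
  refine integral_congr_ae ?_
  filter_upwards [ae_ne_zero_Icc p.T] with t ht
  refine integral_count_of_hasSum ?_ ?_
  · exact (p.hasSum_density h hh t ht).summable.of_nonneg_of_le (fun _ => norm_nonneg _)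
      fun S => p.norm_amplitude_le h P ψ hψ E₀ (t, S) y
  · have h1 := hasSum_seqCoeff h P t hh ht p.Nt_pos
    have hc : Continuous fun A : Op n => A.mulVec ψ y := by
      simp only [Matrix.mulVec, dotProduct]
      fun_prop
    let L : Op n →+ ℂ := ⟨⟨fun A => A.mulVec ψ y, by simp⟩, fun A B => by simp [Matrix.add_mulVec]⟩
    have h2 := (h1.map L hc).mul_left ((p.g t : ℂ) * Complex.exp (Complex.I * (E₀ * t : ℝ)))
    refine h2.congr_fun fun S => ?_
    simp [L, Params.amplitude, Matrix.smul_mulVec, mul_assoc]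

/-! ### The law of a sample -/

/-- The overlap measured in the Hadamard test. -/
def overlap {n M N : ℕ} (h : Fin M → ℝ) (P : Fin M → Fin n → Fin 4) (ψ : Vec n) (A : Op n)
    (x x' : ℝ × (Fin N → LORIndex M)) : ℂ :=
  braket ((seqUnitary h P x'.1 x'.2).mulVec ψ) (A.mulVec ((seqUnitary h P x.1 x.2).mulVec ψ))

theorem braket_mulVec_eq_sum {n : ℕ} (A : Op n) (φ χ : Vec n) :
    braket φ (A.mulVec χ) = ∑ y, ∑ z, A y z * (star (φ y) * χ z) := by
  simp only [braket, dotProduct, Matrix.mulVec, Finset.mul_sum, Pi.star_apply]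
  refine Finset.sum_congr rfl fun y _ => Finset.sum_congr rfl fun z _ => ?_
  ring

theorem overlap_measurable {n M N : ℕ} (h : Fin M → ℝ) (P : Fin M → Fin n → Fin 4) (ψ : Vec n)
    (A : Op n) : Measurable fun x : (ℝ × (Fin N → LORIndex M)) × (ℝ × (Fin N → LORIndex M)) =>
      overlap h P ψ A x.1 x.2 := by
  simp only [overlap, braket_mulVec_eq_sum]
  refine Finset.measurable_sum _ fun y _ => Finset.measurable_sum _ fun z _ =>
    Measurable.const_mul (Measurable.mul ?_ ?_) _
  · exact continuous_star.measurable.comp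
      ((seqUnitary_mulVec_measurable h P ψ y).comp measurable_snd)
  · exact (seqUnitary_mulVec_measurable h P ψ z).comp measurable_fst

section Law

variable {n M K : ℕ} (p : Params) (h : Fin M → ℝ) (P : Fin M → Fin n → Fin 4)
  (ψ : Vec n) (a : Fin K → ℝ) (A : Fin K → Op n)

theorem Params.sampleDensity_eq (hψ : braket ψ ψ = 1)
    (hA : ∀ j, A j ∈ Matrix.unitaryGroup (Basis n) ℂ)
    (x x' : ℝ × (Fin p.Nt → LORIndex M)) (d : Fin K × Bool × Bool) :
    p.sampleDensity h P ψ a A (x, x', d) =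
      p.density h x * p.density h x' / p.CT h ^ 2 * (|a d.1| / absSum a) *
        ((1 + outcome d.2.1 * (overlap h P ψ (A d.1) x x').re) / 2) *
        ((1 + outcome d.2.2 * (overlap h P ψ (A d.1) x x').im) / 2) := by
  obtain ⟨t, S⟩ := x
  obtain ⟨t', S'⟩ := x'
  obtain ⟨j, bR, bI⟩ := d
  simp only [Params.sampleDensity]
  rw [bornProb_xVec _ _ _ _ _ (seqUnitary_mem_unitary _ _ _ _) (seqUnitary_mem_unitary _ _ _ _)
    (hA j) hψ, bornProb_yVec _ _ _ _ _ (seqUnitary_mem_unitary _ _ _ _)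
    (seqUnitary_mem_unitary _ _ _ _) (hA j) hψ]
  simp only [Params.density, overlap]
  ring

theorem Params.sampleDensity_nonneg (x : Sample M p.Nt K) :
    0 ≤ p.sampleDensity h P ψ a A x := by
  obtain ⟨⟨t, S⟩, ⟨t', S'⟩, j, bR, bI⟩ := x
  have := p.g_pos t
  have := p.g_pos t'
  have := seqWeight_nonneg h t S
  have := seqWeight_nonneg h t' S'
  have := absSum_nonneg a
  have h1 := bornProb_nonneg (xVec bR) (testState (seqUnitary h P t S) (seqUnitary h P t' S') (A j) ψ)
  have h2 := bornProb_nonneg (yVec bI) (testState (seqUnitary h P t S) (seqUnitary h P t' S') (A j) ψ)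
  simp only [Params.sampleDensity]
  positivity

/-- Functions of a sample are measurable if they are measurable in the continuous part. -/
theorem measurable_sample {N : ℕ} {γ : Type*} [MeasurableSpace γ] {f : Sample M N K → γ}
    (hf : ∀ d, Measurable fun x : (ℝ × (Fin N → LORIndex M)) × (ℝ × (Fin N → LORIndex M)) =>
      f (x.1, x.2, d)) : Measurable f := by
  have h1 : Measurable fun y : ((ℝ × (Fin N → LORIndex M)) × (ℝ × (Fin N → LORIndex M))) ×
      (Fin K × Bool × Bool) => f (y.1.1, y.1.2, y.2) := measurable_from_prod_countable_left hf
  exact h1.comp MeasurableEquiv.prodAssoc.symm.measurable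

theorem Params.sampleDensity_measurable (hψ : braket ψ ψ = 1)
    (hA : ∀ j, A j ∈ Matrix.unitaryGroup (Basis n) ℂ) :
    Measurable (p.sampleDensity h P ψ a A) := by
  refine measurable_sample fun d => ?_
  simp only [p.sampleDensity_eq h P ψ a A hψ hA]
  have h1 := overlap_measurable (N := p.Nt) h P ψ (A d.1)
  have h2 : Measurable fun x : (ℝ × (Fin p.Nt → LORIndex M)) × (ℝ × (Fin p.Nt → LORIndex M)) =>
    p.density h x.1 := (p.density_measurable h).comp measurable_fst
  have h3 : Measurable fun x : (ℝ × (Fin p.Nt → LORIndex M)) × (ℝ × (Fin p.Nt → LORIndex M)) =>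
    p.density h x.2 := (p.density_measurable h).comp measurable_snd
  have h4 := Complex.measurable_re.comp h1
  have h5 := Complex.measurable_im.comp h1
  simp only [Function.comp_def] at h4 h5
  fun_prop

/-- Reassociating the product makes the finitely many outcomes the innermost variable. The product
of the two densities is integrable and dominates, so Fubini applies and counting measure becomes a
finite sum. -/
theorem Params.integral_baseMeasure {E : Type*} [NormedAddCommGroup E] [NormedSpace ℝ E]
    [CompleteSpace E] (hh : 0 < absSum h) (G : Sample M p.Nt K → E) (hG : StronglyMeasurable G)
    (C : ℝ) (hC : ∀ x x' d, ‖G (x, x', d)‖ ≤ C * (p.density h x * p.density h x')) :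
    Integrable G (p.baseMeasure M K) ∧ ∫ x, G x ∂(p.baseMeasure M K) =
      ∫ y, ∑ d, G (y.1, y.2, d) ∂((p.seqMeasure M).prod (p.seqMeasure M)) := by
  have hF := p.density_integrable h hh
  have hmp := measurePreserving_prodAssoc (p.seqMeasure M) (p.seqMeasure M)
    (Measure.count : Measure (Fin K × Bool × Bool))
  rw [← Params.baseMeasure_eq] at hmp
  have hi : Integrable (fun y : ((ℝ × (Fin p.Nt → LORIndex M)) × (ℝ × (Fin p.Nt → LORIndex M))) ×
      (Fin K × Bool × Bool) => G (MeasurableEquiv.prodAssoc y))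
      (((p.seqMeasure M).prod (p.seqMeasure M)).prod Measure.count) := by
    have hb : Integrable (fun y : ((ℝ × (Fin p.Nt → LORIndex M)) ×
        (ℝ × (Fin p.Nt → LORIndex M))) × (Fin K × Bool × Bool) =>
        (C * (p.density h y.1.1 * p.density h y.1.2)) * (1 : ℝ))
        (((p.seqMeasure M).prod (p.seqMeasure M)).prod Measure.count) :=
      Integrable.mul_prod ((hF.mul_prod hF).const_mul C) (integrable_const (1 : ℝ))
    refine hb.mono' (hG.comp_measurable MeasurableEquiv.prodAssoc.measurable).aestronglyMeasurable
      (.of_forall fun y => ?_)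
    rw [mul_one]
    exact hC y.1.1 y.1.2 y.2
  refine ⟨(hmp.integrable_comp_emb MeasurableEquiv.prodAssoc.measurableEmbedding).1 hi, ?_⟩
  rw [← hmp.integral_comp MeasurableEquiv.prodAssoc.measurableEmbedding, integral_prod _ hi]
  refine integral_congr_ae (.of_forall fun y => ?_)
  exact integral_count _

/-- The Born probabilities of both outcomes are nonnegative, which forces the real and imaginary
parts into [-1, 1]. -/
theorem norm_overlap_le (hψ : braket ψ ψ = 1) {B : Op n}
    (hB : B ∈ Matrix.unitaryGroup (Basis n) ℂ) {N : ℕ} (x x' : ℝ × (Fin N → LORIndex M)) :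
    |(overlap h P ψ B x x').re| ≤ 1 ∧ |(overlap h P ψ B x x').im| ≤ 1 := by
  have h1 : ∀ b, 0 ≤ (1 + outcome b * (overlap h P ψ B x x').re) / 2 := fun b => by
    rw [overlap, ← bornProb_xVec _ _ _ _ _ (seqUnitary_mem_unitary _ _ _ _)
      (seqUnitary_mem_unitary _ _ _ _) hB hψ]
    exact bornProb_nonneg _ _
  have h2 : ∀ b, 0 ≤ (1 + outcome b * (overlap h P ψ B x x').im) / 2 := fun b => by
    rw [overlap, ← bornProb_yVec _ _ _ _ _ (seqUnitary_mem_unitary _ _ _ _)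
      (seqUnitary_mem_unitary _ _ _ _) hB hψ]
    exact bornProb_nonneg _ _
  have a1 := h1 true
  have a2 := h1 false
  have b1 := h2 true
  have b2 := h2 false
  simp only [outcome, if_true] at a1 b1
  simp only [outcome, Bool.false_eq_true, if_false] at a2 b2
  exact ⟨abs_le.2 ⟨by linarith, by linarith⟩, abs_le.2 ⟨by linarith, by linarith⟩⟩

theorem Params.sampleDensity_le (hψ : braket ψ ψ = 1)
    (hA : ∀ j, A j ∈ Matrix.unitaryGroup (Basis n) ℂ) (x x' : ℝ × (Fin p.Nt → LORIndex M))
    (d : Fin K × Bool × Bool) :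
    p.sampleDensity h P ψ a A (x, x', d) ≤
      (p.CT h ^ 2)⁻¹ * (p.density h x * p.density h x') := by
  rw [p.sampleDensity_eq h P ψ a A hψ hA]
  obtain ⟨h1, h2⟩ := norm_overlap_le h P ψ hψ (hA d.1) x x'
  have h3 : ∀ (b : Bool) (r : ℝ), |r| ≤ 1 → 0 ≤ (1 + outcome b * r) / 2 ∧
      (1 + outcome b * r) / 2 ≤ 1 := by
    intro b r hr
    have := abs_le.1 hr
    cases b <;> simp only [outcome, if_true, Bool.false_eq_true, if_false] <;>
      constructor <;> linarith
  obtain ⟨a1, a2⟩ := h3 d.2.1 _ h1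
  obtain ⟨b1, b2⟩ := h3 d.2.2 _ h2
  have h4 : |a d.1| / absSum a ≤ 1 := by
    refine div_le_one_of_le₀ ?_ (absSum_nonneg a)
    exact Finset.single_le_sum (f := fun j => |a j|) (fun j _ => abs_nonneg _) (Finset.mem_univ _)
  have h5 : 0 ≤ |a d.1| / absSum a := div_nonneg (abs_nonneg _) (absSum_nonneg a)
  have h6 : 0 ≤ p.density h x * p.density h x' / p.CT h ^ 2 :=
    div_nonneg (mul_nonneg (p.density_nonneg _ _) (p.density_nonneg _ _)) (by positivity)
  rw [inv_mul_eq_div]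
  calc _ ≤ p.density h x * p.density h x' / p.CT h ^ 2 * 1 * 1 * 1 := by gcongr
    _ = _ := by ring

theorem sum_abs_div_absSum (ha : 0 < absSum a) : ∑ j, |a j| / absSum a = 1 := by
  rw [← Finset.sum_div]
  exact div_self ha.ne'

theorem Params.sum_sampleDensity (hψ : braket ψ ψ = 1) (ha : 0 < absSum a)
    (hA : ∀ j, A j ∈ Matrix.unitaryGroup (Basis n) ℂ) (x x' : ℝ × (Fin p.Nt → LORIndex M)) :
    ∑ d, p.sampleDensity h P ψ a A (x, x', d) =
      p.density h x * p.density h x' / p.CT h ^ 2 := by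
  simp only [p.sampleDensity_eq h P ψ a A hψ hA, Fintype.sum_prod_type, Fintype.sum_bool, outcome,
    if_true, Bool.false_eq_true, if_false]
  have : ∀ j : Fin K, ∀ D r i : ℝ,
    D * (|a j| / absSum a) * ((1 + 1 * r) / 2) * ((1 + 1 * i) / 2) +
      D * (|a j| / absSum a) * ((1 + 1 * r) / 2) * ((1 + -1 * i) / 2) +
      (D * (|a j| / absSum a) * ((1 + -1 * r) / 2) * ((1 + 1 * i) / 2) +
      D * (|a j| / absSum a) * ((1 + -1 * r) / 2) * ((1 + -1 * i) / 2)) =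
      D * (|a j| / absSum a) := by intros; ring
  simp only [this, ← Finset.mul_sum, sum_abs_div_absSum a ha, mul_one]

theorem Params.integral_sampleDensity (hh : 0 < absSum h) (hψ : braket ψ ψ = 1) (ha : 0 < absSum a)
    (hA : ∀ j, A j ∈ Matrix.unitaryGroup (Basis n) ℂ) :
    Integrable (p.sampleDensity h P ψ a A) (p.baseMeasure M K) ∧
    ∫ x, p.sampleDensity h P ψ a A x ∂(p.baseMeasure M K) = 1 := by
  have h1 := p.integral_baseMeasure h hh (p.sampleDensity h P ψ a A)
    (p.sampleDensity_measurable h P ψ a A hψ hA).stronglyMeasurable (p.CT h ^ 2)⁻¹ (fun x x' d => by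
      rw [Real.norm_of_nonneg (p.sampleDensity_nonneg h P ψ a A _)]
      exact p.sampleDensity_le h P ψ a A hψ hA x x' d)
  refine ⟨h1.1, h1.2.trans ?_⟩
  simp only [p.sum_sampleDensity h P ψ a A hψ ha hA, integral_div]
  rw [integral_prod_mul, p.integral_density h hh]
  have := p.CT_pos h
  field_simp

theorem Params.sampleLaw_isProbabilityMeasure (hh : 0 < absSum h) (hψ : braket ψ ψ = 1)
    (ha : 0 < absSum a) (hA : ∀ j, A j ∈ Matrix.unitaryGroup (Basis n) ℂ) :
    IsProbabilityMeasure (p.sampleLaw h P ψ a A) := by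
  obtain ⟨h1, h2⟩ := p.integral_sampleDensity h P ψ a A hh hψ ha hA
  refine ⟨?_⟩
  rw [Params.sampleLaw, withDensity_apply _ MeasurableSet.univ, Measure.restrict_univ,
    ← ofReal_integral_eq_lintegral_ofReal h1
      (.of_forall fun x => p.sampleDensity_nonneg h P ψ a A x), h2, ENNReal.ofReal_one]

theorem sign_mul_abs' (r : ℝ) : Real.sign r * |r| = r := by
  rcases lt_trichotomy r 0 with hr | rfl | hr
  · rw [Real.sign_of_neg hr, abs_of_neg hr]; ring
  · simp
  · rw [Real.sign_of_pos hr, abs_of_pos hr, one_mul]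

theorem abs_sign_le (r : ℝ) : |Real.sign r| ≤ 1 := by
  rcases Real.sign_apply_eq r with hr | hr | hr <;> simp [hr]

theorem norm_sampleValue_le (E₀ : ℝ) {N : ℕ} (x : Sample M N K) :
    ‖sampleValue h a E₀ x‖ ≤ 2 := by
  obtain ⟨⟨t, S⟩, ⟨t', S'⟩, j, bR, bI⟩ := x
  have e1 : ‖Complex.exp (-Complex.I * (seqPhase h t' S' : ℂ))‖ = 1 := by
    rw [show -Complex.I * (seqPhase h t' S' : ℂ) = ((-seqPhase h t' S' : ℝ) : ℂ) * Complex.I by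
      push_cast; ring, Complex.norm_exp_ofReal_mul_I]
  simp only [sampleValue]
  rw [norm_mul, norm_mul, norm_mul, norm_mul, e1, mul_comm Complex.I, Complex.norm_exp_ofReal_mul_I,
    mul_comm Complex.I, Complex.norm_exp_ofReal_mul_I, Complex.norm_real, Real.norm_eq_abs]
  have h1 : ‖(outcome bR : ℂ) + Complex.I * (outcome bI : ℂ)‖ ≤ 2 := by
    refine (norm_add_le _ _).trans ?_
    rw [norm_mul, norm_outcome, norm_outcome, Complex.norm_I]
    norm_num
  have := abs_sign_le (a j)
  have := abs_nonneg (Real.sign (a j))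
  have := norm_nonneg ((outcome bR : ℂ) + Complex.I * (outcome bI : ℂ))
  nlinarith

theorem sampleValue_measurable (E₀ : ℝ) {N : ℕ} :
    Measurable fun x : Sample M N K => sampleValue h a E₀ x := by
  refine measurable_sample fun d => ?_
  simp only [sampleValue]
  have h2 : Measurable fun x : (ℝ × (Fin N → LORIndex M)) × (ℝ × (Fin N → LORIndex M)) =>
    seqPhase h x.1.1 x.1.2 := (seqPhase_measurable h).comp measurable_fst
  have h3 : Measurable fun x : (ℝ × (Fin N → LORIndex M)) × (ℝ × (Fin N → LORIndex M)) =>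
    seqPhase h x.2.1 x.2.2 := (seqPhase_measurable h).comp measurable_snd
  fun_prop

/-- Isolating the shift in one exponential gives joint measurability in shift and data, needed
because the shift is itself random. -/
theorem sampleValue_eq (E₀ : ℝ) {N : ℕ} (x : Sample M N K) :
    sampleValue h a E₀ x =
      Complex.exp (Complex.I * (E₀ * (x.1.1 - x.2.1.1) : ℝ)) * sampleValue h a 0 x := by
  obtain ⟨⟨t, S⟩, ⟨t', S'⟩, j, bR, bI⟩ := x
  simp only [sampleValue, zero_mul, Complex.ofReal_zero, mul_zero, Complex.exp_zero]
  ring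

/-- For fixed times and sequences the mean of μ_R + iμ_I is the overlap, sgn(a_j)|a_j| = a_j, and
weight times phase is the complex coefficient. The result is bilinear in an amplitude at `x` and a
conjugate amplitude at `x'`, so the later integral over the pair splits into a product. -/
theorem Params.sum_density_smul_value (hψ : braket ψ ψ = 1)
    (hA : ∀ j, A j ∈ Matrix.unitaryGroup (Basis n) ℂ) (E₀ : ℝ)
    (x x' : ℝ × (Fin p.Nt → LORIndex M)) :
    ∑ d, p.sampleDensity h P ψ a A (x, x', d) • sampleValue h a E₀ (x, x', d) =
      ((absSum a * p.CT h ^ 2 : ℝ) : ℂ)⁻¹ *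
        ∑ y, ∑ z, linComb a A y z *
          (p.amplitude h P ψ E₀ x z * star (p.amplitude h P ψ E₀ x' y)) := by
  obtain ⟨t, S⟩ := x
  obtain ⟨t', S'⟩ := x'
  have key : ∀ j : Fin K, ∑ b : Bool × Bool, p.sampleDensity h P ψ a A ((t, S), (t', S'), (j, b)) •
      sampleValue h a E₀ ((t, S), (t', S'), (j, b)) = ((absSum a * p.CT h ^ 2 : ℝ) : ℂ)⁻¹ *
        ((a j : ℂ) * ∑ y, ∑ z, A j y z *
          (p.amplitude h P ψ E₀ (t, S) z * star (p.amplitude h P ψ E₀ (t', S') y))) := by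
    intro j
    have hz : (overlap h P ψ (A j) (t, S) (t', S')) = ∑ y, ∑ z, A j y z *
        (star ((seqUnitary h P t' S').mulVec ψ y) * (seqUnitary h P t S).mulVec ψ z) := by
      rw [overlap, braket_mulVec_eq_sum]
    have hamp : ∑ y, ∑ z, A j y z *
          (p.amplitude h P ψ E₀ (t, S) z * star (p.amplitude h P ψ E₀ (t', S') y)) =
        (p.g t * p.g t' : ℂ) * (Complex.exp (Complex.I * (E₀ * t : ℝ)) *
          Complex.exp (-Complex.I * (E₀ * t' : ℝ))) * (seqCoeff h t S * star (seqCoeff h t' S')) *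
          overlap h P ψ (A j) (t, S) (t', S') := by
      rw [hz, Finset.mul_sum]
      refine Finset.sum_congr rfl fun y _ => ?_
      rw [Finset.mul_sum]
      refine Finset.sum_congr rfl fun z _ => ?_
      have : star (Complex.exp (Complex.I * (E₀ * t' : ℝ))) =
          Complex.exp (-Complex.I * (E₀ * t' : ℝ)) := by
        rw [Complex.star_def, ← Complex.exp_conj, map_mul, Complex.conj_I, Complex.conj_ofReal]
      simp only [Params.amplitude, star_mul', this, Complex.star_def, Complex.conj_ofReal]
      ring
    have hc : star (seqCoeff h t' S') =
        (seqWeight h t' S' : ℂ) * Complex.exp (-Complex.I * (seqPhase h t' S' : ℂ)) := by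
      rw [← seqWeight_mul_exp, star_mul', Complex.star_def, ← Complex.exp_conj,
        map_mul, Complex.conj_I, Complex.conj_ofReal, Complex.conj_ofReal]
    have he : Complex.exp (Complex.I * (E₀ * (t - t') : ℝ)) =
        Complex.exp (Complex.I * (E₀ * t : ℝ)) * Complex.exp (-Complex.I * (E₀ * t' : ℝ)) := by
      rw [← Complex.exp_add]
      congr 1
      push_cast
      ring
    have hs : (Real.sign (a j) : ℂ) * (|a j| : ℝ) = (a j : ℂ) := by
      rw [← Complex.ofReal_mul, sign_mul_abs']
    have hov : ((overlap h P ψ (A j) (t, S) (t', S')).re : ℂ) + Complex.I *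
        ((overlap h P ψ (A j) (t, S) (t', S')).im : ℂ) = overlap h P ψ (A j) (t, S) (t', S') := by
      rw [mul_comm, Complex.re_add_im]
    rw [hamp, hc, ← seqWeight_mul_exp, ← hs, ← hov]
    simp only [p.sampleDensity_eq h P ψ a A hψ hA, sampleValue, Fintype.sum_prod_type,
      Fintype.sum_bool, outcome, if_true, Bool.false_eq_true, if_false, he, Complex.real_smul,
      Params.density]
    push_cast
    rw [mul_inv]
    ring
  rw [Fintype.sum_prod_type]
  simp only [key]
  rw [← Finset.mul_sum]
  congr 1
  simp only [linComb, Matrix.sum_apply, Matrix.smul_apply, smul_eq_mul, Finset.sum_mul,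
    Finset.mul_sum]
  rw [Finset.sum_comm]
  refine Finset.sum_congr rfl fun y _ => ?_
  rw [Finset.sum_comm]
  refine Finset.sum_congr rfl fun z _ => Finset.sum_congr rfl fun j _ => ?_
  ring

/-- The expected value of one sample. -/
theorem Params.integral_sampleValue (hh : 0 < absSum h) (hψ : braket ψ ψ = 1)
    (hA : ∀ j, A j ∈ Matrix.unitaryGroup (Basis n) ℂ) (E₀ : ℝ) :
    ∫ x, sampleValue h a E₀ x ∂(p.sampleLaw h P ψ a A) =
      ((absSum a * p.CT h ^ 2 : ℝ) : ℂ)⁻¹ *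
        braket (p.mean h P ψ E₀) ((linComb a A).mulVec (p.mean h P ψ E₀)) := by
  have hm := p.sampleDensity_measurable h P ψ a A hψ hA
  have hv : Measurable fun x : Sample M p.Nt K => sampleValue h a E₀ x :=
    sampleValue_measurable h a E₀
  rw [Params.sampleLaw, integral_withDensity_eq_integral_toReal_smul hm.ennreal_ofReal
    (.of_forall fun x => ENNReal.ofReal_lt_top)]
  simp only [ENNReal.toReal_ofReal (p.sampleDensity_nonneg h P ψ a A _)]
  rw [(p.integral_baseMeasure h hh
    (fun x => p.sampleDensity h P ψ a A x • sampleValue h a E₀ x)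
    (hm.stronglyMeasurable.smul hv.stronglyMeasurable) (2 * (p.CT h ^ 2)⁻¹) ?_).2]
  · simp only [p.sum_density_smul_value h P ψ a A hψ hA, integral_const_mul]
    congr 1
    have hi := fun y => p.amplitude_integrable h hh P ψ hψ E₀ y
    have hi' : ∀ y, Integrable (fun x => star (p.amplitude h P ψ E₀ x y)) (p.seqMeasure M) :=
      fun y => Complex.conjCLE.toContinuousLinearMap.integrable_comp (hi y)
    have hyz : ∀ y z, Integrable (fun x : (ℝ × (Fin p.Nt → LORIndex M)) ×
        (ℝ × (Fin p.Nt → LORIndex M)) => linComb a A y z *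
        (p.amplitude h P ψ E₀ x.1 z * star (p.amplitude h P ψ E₀ x.2 y)))
        ((p.seqMeasure M).prod (p.seqMeasure M)) :=
      fun y z => ((hi z).mul_prod (hi' y)).const_mul _
    rw [integral_finsetSum _ fun y _ => integrable_finsetSum _ fun z _ => hyz y z,
      braket_mulVec_eq_sum]
    refine Finset.sum_congr rfl fun y _ => ?_
    rw [integral_finsetSum _ fun z _ => hyz y z]
    refine Finset.sum_congr rfl fun z _ => ?_
    rw [integral_const_mul, integral_prod_mul (fun x => p.amplitude h P ψ E₀ x z)
      (fun x => star (p.amplitude h P ψ E₀ x y)), p.integral_amplitude h hh P ψ hψ]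
    have : ∫ x, star (p.amplitude h P ψ E₀ x y) ∂(p.seqMeasure M) = star (p.mean h P ψ E₀ y) := by
      rw [← p.integral_amplitude h hh P ψ hψ]
      exact integral_conj
    rw [this]
    ring
  · intro x x' d
    rw [norm_smul, Real.norm_of_nonneg (p.sampleDensity_nonneg h P ψ a A _)]
    have h1 := p.sampleDensity_le h P ψ a A hψ hA x x' d
    have h2 := norm_sampleValue_le h a E₀ (x, x', d)
    have h3 := p.sampleDensity_nonneg h P ψ a A (x, x', d)
    have h4 := norm_nonneg (sampleValue h a E₀ (x, x', d))
    nlinarith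

end Law

/-! ### The Fourier transform of the Lorentz-Gaussian function -/

section Fourier

open ProbabilityTheory Complex

theorem integrable_exp_neg_abs {β : ℝ} (hβ : 0 < β) :
    Integrable fun x : ℝ => Real.exp (-(β * |x|)) := by
  have h1 : IntegrableOn (fun x : ℝ => Real.exp (-(β * |x|))) (Set.Iic 0) := by
    refine (integrableOn_exp_mul_Iic hβ 0).congr_fun (fun x hx => ?_) measurableSet_Iic
    simp [abs_of_nonpos (Set.mem_Iic.1 hx)]
  have h2 : IntegrableOn (fun x : ℝ => Real.exp (-(β * |x|))) (Set.Ioi 0) := by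
    refine (integrableOn_exp_mul_Ioi (neg_lt_zero.2 hβ) 0).congr_fun (fun x hx => ?_)
      measurableSet_Ioi
    simp [abs_of_pos (Set.mem_Ioi.1 hx)]
  rw [← integrableOn_univ, ← Set.Iic_union_Ioi (a := (0 : ℝ))]
  exact h1.union h2

theorem integral_exp_neg_abs_mul_exp {β : ℝ} (hβ : 0 < β) (t : ℝ) :
    ∫ x : ℝ, (Real.exp (-(β * |x|)) : ℂ) * exp ((t * x : ℝ) * I) =
      ((2 * β / (β ^ 2 + t ^ 2) : ℝ) : ℂ) := by
  have hi : Integrable fun x : ℝ => (Real.exp (-(β * |x|)) : ℂ) * exp ((t * x : ℝ) * I) := by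
    refine (integrable_exp_neg_abs hβ).ofReal.mul_bdd (c := 1) ?_ (.of_forall fun x => ?_)
    · exact Continuous.aestronglyMeasurable (by fun_prop)
    · rw [norm_exp_ofReal_mul_I]
  have h1 : ∀ x ∈ Set.Iic (0 : ℝ), (Real.exp (-(β * |x|)) : ℂ) * exp ((t * x : ℝ) * I) =
      exp ((β + t * I) * x) := by
    intro x hx
    rw [abs_of_nonpos (Set.mem_Iic.1 hx), ofReal_exp, ← Complex.exp_add]
    congr 1
    push_cast
    ring
  have h2 : ∀ x ∈ Set.Ioi (0 : ℝ), (Real.exp (-(β * |x|)) : ℂ) * exp ((t * x : ℝ) * I) =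
      exp ((-β + t * I) * x) := by
    intro x hx
    rw [abs_of_pos (Set.mem_Ioi.1 hx), ofReal_exp, ← Complex.exp_add]
    congr 1
    push_cast
    ring
  rw [← intervalIntegral.integral_Iic_add_Ioi (b := 0) hi.integrableOn hi.integrableOn,
    setIntegral_congr_fun measurableSet_Iic h1, setIntegral_congr_fun measurableSet_Ioi h2,
    integral_exp_mul_complex_Iic (by simpa using hβ), integral_exp_mul_complex_Ioi (by simpa using hβ)]
  have e1 : (β + t * I : ℂ) ≠ 0 := fun h0 => hβ.ne' (by simpa using congrArg re h0)
  have e2 : (-β + t * I : ℂ) ≠ 0 := fun h0 => hβ.ne' (by simpa using congrArg re h0)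
  have e3 : (β ^ 2 + t ^ 2 : ℂ) ≠ 0 := by
    have : β ^ 2 + t ^ 2 ≠ 0 := by positivity
    exact_mod_cast this
  push_cast
  rw [mul_zero, mul_zero, Complex.exp_zero]
  field_simp
  ring_nf
  rw [I_sq]
  ring

theorem integral_gaussian_mul_exp {τ : ℝ} (hτ : 0 < τ) (s : ℝ) :
    ∫ t : ℝ, (Real.exp (-(t ^ 2 / (2 * τ ^ 2))) : ℂ) * exp ((s * t : ℝ) * I) =
      ((Real.sqrt (2 * Real.pi * τ ^ 2) * Real.exp (-(τ ^ 2 * s ^ 2 / 2)) : ℝ) : ℂ) := by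
  let v : NNReal := ⟨τ ^ 2, by positivity⟩
  have hv : v ≠ 0 := fun h0 => (pow_pos hτ 2).ne' (congrArg NNReal.toReal h0)
  have hvc : (v : ℝ) = τ ^ 2 := rfl
  have h1 := charFun_gaussianReal (μ := 0) (v := v) s
  rw [charFun_apply_real, integral_gaussianReal_eq_integral_smul hv] at h1
  have hs : (0 : ℝ) < Real.sqrt (2 * Real.pi * τ ^ 2) := Real.sqrt_pos.2 (by positivity)
  have h2 : ∀ t : ℝ, (Real.exp (-(t ^ 2 / (2 * τ ^ 2))) : ℂ) * exp ((s * t : ℝ) * I) =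
      (Real.sqrt (2 * Real.pi * τ ^ 2) : ℂ) * (gaussianPDFReal 0 v t • exp (s * t * I)) := by
    intro t
    rw [gaussianPDFReal, hvc, real_smul]
    have : (Real.sqrt (2 * Real.pi * τ ^ 2) : ℂ) ≠ 0 := by exact_mod_cast hs.ne'
    rw [ofReal_mul (Real.sqrt _)⁻¹, ofReal_inv, sub_zero, ← mul_assoc, ← mul_assoc, mul_inv_cancel₀ this, one_mul,
      neg_div, ofReal_mul s t]
  simp only [h2, integral_const_mul, h1]
  rw [ofReal_mul, ofReal_exp]
  congr 2
  push_cast [hvc]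
  ring

/-- The Lorentz function, which is the Cauchy density. -/
def Params.lorentz (p : Params) (t : ℝ) : ℝ := 1 / Real.pi * (p.β / (p.β ^ 2 + t ^ 2))

theorem Params.lorentz_eq (p : Params) :
    p.lorentz = cauchyPDFReal 0 p.β.toNNReal := by
  ext t
  rw [Params.lorentz, cauchyPDFReal_def, Real.coe_toNNReal _ p.β_pos.le]
  have := p.β_pos
  have : p.β ^ 2 + t ^ 2 ≠ 0 := by positivity
  have : (t - 0) ^ 2 + p.β ^ 2 ≠ 0 := by rw [sub_zero]; positivity
  field_simp
  ring

theorem Params.lorentz_integrable (p : Params) : Integrable p.lorentz := by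
  rw [p.lorentz_eq]; exact integrable_cauchyPDFReal 0

theorem Params.integral_lorentz (p : Params) : ∫ t, p.lorentz t = 1 := by
  rw [p.lorentz_eq]
  exact integral_cauchyPDFReal_eq_one 0 (Real.toNNReal_pos.2 p.β_pos).ne'

theorem Params.lorentz_nonneg (p : Params) (t : ℝ) : 0 ≤ p.lorentz t := by
  have := p.β_pos
  unfold Params.lorentz
  positivity

theorem Params.g_le_lorentz (p : Params) (t : ℝ) : p.g t ≤ p.lorentz t := by
  refine mul_le_of_le_one_right (p.lorentz_nonneg t) (Real.exp_le_one_iff.2 ?_)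
  have := p.τ_pos
  exact neg_nonpos.2 (by positivity)

theorem Params.g_integrable (p : Params) : Integrable p.g :=
  p.lorentz_integrable.mono' p.g_continuous.aestronglyMeasurable
    (.of_forall fun t => by rw [Real.norm_of_nonneg (p.g_pos t).le]; exact p.g_le_lorentz t)

theorem Params.g_mul_exp_integrable (p : Params) (ω : ℝ) :
    Integrable fun t : ℝ => (p.g t : ℂ) * exp ((-(ω * t) : ℝ) * I) := by
  refine p.g_integrable.ofReal.mul_bdd (c := 1) ?_ (.of_forall fun x => ?_)
  · exact Continuous.aestronglyMeasurable (by fun_prop)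
  · rw [norm_exp_ofReal_mul_I]

/-- The variance of the Gaussian in the frequency domain. -/
def Params.freqVar (p : Params) : NNReal := ⟨(p.τ ^ 2)⁻¹, by positivity⟩

theorem Params.freqVar_ne_zero (p : Params) : p.freqVar ≠ 0 := fun h0 =>
  (inv_pos.2 (pow_pos p.τ_pos 2)).ne' (congrArg NNReal.toReal h0)

/-- The Fourier transform of the Lorentz-Gaussian function as an average of `exp (-β |x|)` over a
normal distribution. -/
theorem Params.fourier_g (p : Params) (ω : ℝ) :
    ∫ t : ℝ, (p.g t : ℂ) * exp ((-(ω * t) : ℝ) * I) =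
      ((Real.exp (-(p.β ^ 2 / (2 * p.τ ^ 2))) *
        ∫ x, Real.exp (-(p.β * |x|)) ∂(gaussianReal ω p.freqVar) : ℝ) : ℂ) := by
  have hτ := p.τ_pos
  have hβ := p.β_pos
  have hπ := Real.pi_pos
  -- The Lorentz factor is replaced by the Fourier integral of exp(-β|x|). After exchanging the
  -- integrals, the Gaussian integral over t produces the normal density centred at ω.
  have h1 : ∀ t : ℝ, (p.g t : ℂ) * exp ((-(ω * t) : ℝ) * I) =
      ((Real.exp (-(p.β ^ 2 / (2 * p.τ ^ 2))) / (2 * Real.pi) : ℝ) : ℂ) *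
        ∫ x : ℝ, ((Real.exp (-(p.β * |x|)) : ℂ) * (Real.exp (-(t ^ 2 / (2 * p.τ ^ 2))) : ℂ)) *
          exp (((x - ω) * t : ℝ) * I) := by
    intro t
    have : ∀ x : ℝ, ((Real.exp (-(p.β * |x|)) : ℂ) * (Real.exp (-(t ^ 2 / (2 * p.τ ^ 2))) : ℂ)) *
          exp (((x - ω) * t : ℝ) * I) = ((Real.exp (-(t ^ 2 / (2 * p.τ ^ 2))) : ℂ) *
          exp ((-(ω * t) : ℝ) * I)) * ((Real.exp (-(p.β * |x|)) : ℂ) * exp ((t * x : ℝ) * I)) := by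
      intro x
      have : exp (((x - ω) * t : ℝ) * I) = exp ((-(ω * t) : ℝ) * I) * exp ((t * x : ℝ) * I) := by
        rw [← Complex.exp_add]
        congr 1
        push_cast
        ring
      rw [this]
      ring
    simp only [this]
    rw [integral_const_mul, integral_exp_neg_abs_mul_exp hβ, mul_comm ((Real.exp _ : ℝ) : ℂ) (exp _),
      mul_assoc (exp _), mul_left_comm, mul_comm _ (exp _)]
    congr 1
    rw [← ofReal_mul, ← ofReal_mul]
    congr 1
    rw [Params.g, add_div, neg_add, Real.exp_add]
    field_simp
  have hint : Integrable (Function.uncurry fun t x : ℝ =>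
      ((Real.exp (-(p.β * |x|)) : ℂ) * (Real.exp (-(t ^ 2 / (2 * p.τ ^ 2))) : ℂ)) *
          exp (((x - ω) * t : ℝ) * I)) (volume.prod volume) := by
    have hg : Integrable fun t : ℝ => Real.exp (-(t ^ 2 / (2 * p.τ ^ 2))) := by
      refine (integrable_exp_neg_mul_sq (b := (2 * p.τ ^ 2)⁻¹) (by positivity)).congr
        (.of_forall fun t => ?_)
      simp only [div_eq_inv_mul, neg_mul]
    have hb := Integrable.mul_prod hg (integrable_exp_neg_abs hβ)
    refine hb.mono' (Continuous.aestronglyMeasurable ?_) (.of_forall fun y => ?_)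
    · simp only [Function.uncurry_def]
      fun_prop
    · simp only [Function.uncurry_def]
      rw [norm_mul, norm_exp_ofReal_mul_I, mul_one, ← ofReal_mul, norm_real,
        Real.norm_of_nonneg (by positivity), mul_comm]
  simp only [h1]
  rw [integral_const_mul, integral_integral_swap hint, ofReal_mul,
    integral_gaussianReal_eq_integral_smul p.freqVar_ne_zero, ← integral_complex_ofReal,
    ← integral_const_mul, ← integral_const_mul]
  refine integral_congr_ae (.of_forall fun x => ?_)
  simp only [mul_assoc]
  rw [integral_const_mul, integral_gaussian_mul_exp hτ, smul_eq_mul, gaussianPDFReal]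
  have hvc : (p.freqVar : ℝ) = (p.τ ^ 2)⁻¹ := rfl
  rw [hvc, ← ofReal_mul, ← ofReal_mul, ← ofReal_mul]
  congr 1
  have e1 : Real.sqrt (2 * Real.pi * p.τ ^ 2) = Real.sqrt (2 * Real.pi) * p.τ := by
    rw [Real.sqrt_mul (by positivity), Real.sqrt_sq hτ.le]
  have e2 : Real.sqrt (2 * Real.pi * (p.τ ^ 2)⁻¹) = Real.sqrt (2 * Real.pi) / p.τ := by
    rw [← div_eq_mul_inv, Real.sqrt_div (by positivity), Real.sqrt_sq hτ.le]
  have e3 : Real.sqrt (2 * Real.pi) * Real.sqrt (2 * Real.pi) = 2 * Real.pi :=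
    Real.mul_self_sqrt (by positivity)
  have e4 : -(x - ω) ^ 2 / (2 * (p.τ ^ 2)⁻¹) = -(p.τ ^ 2 * (x - ω) ^ 2 / 2) := by field_simp
  have e5 : 0 < Real.sqrt (2 * Real.pi) := Real.sqrt_pos.2 (by positivity)
  rw [e1, e2, e4]
  field_simp
  rw [pow_two, e3]

/-- By the Gaussian moment generating function, e^{-βω} is the same average with x in place of |x|.
The two integrands differ only for x < 0, where β ≤ ωτ² bounds the difference by e^{-ωτ²x}. The
exponent -ωτ² is the optimal Chernoff tilt, and its mean is e^{-ω²τ²/2}. -/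
theorem Params.norm_fourier_sub_le (p : Params) (ω : ℝ) (hω : p.β ≤ ω * p.τ ^ 2) :
    ‖(∫ t : ℝ, (p.g t : ℂ) * exp ((-(ω * t) : ℝ) * I)) - (Real.exp (-(p.β * ω)) : ℂ)‖ ≤
      Real.exp (-(ω ^ 2 * p.τ ^ 2 / 2)) := by
  have hτ := p.τ_pos
  have hβ := p.β_pos
  have hvc : (p.freqVar : ℝ) = (p.τ ^ 2)⁻¹ := rfl
  have hm : ∀ s : ℝ, ∫ x, Real.exp (s * x) ∂(gaussianReal ω p.freqVar) =
      Real.exp (ω * s + (p.τ ^ 2)⁻¹ * s ^ 2 / 2) := fun s => by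
    have := congrFun (mgf_id_gaussianReal (μ := ω) (v := p.freqVar)) s
    simpa only [mgf, id, hvc] using this
  have h1 : Real.exp (-(p.β * ω)) = Real.exp (-(p.β ^ 2 / (2 * p.τ ^ 2))) *
      ∫ x, Real.exp (-p.β * x) ∂(gaussianReal ω p.freqVar) := by
    rw [hm, ← Real.exp_add]
    congr 1
    field_simp
    ring
  have hi : Integrable (fun x => Real.exp (-(p.β * |x|))) (gaussianReal ω p.freqVar) := by
    refine (integrable_const (1 : ℝ)).mono' (Continuous.aestronglyMeasurable (by fun_prop))
      (.of_forall fun x => ?_)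
    rw [Real.norm_of_nonneg (Real.exp_pos _).le, Real.exp_le_one_iff]
    exact neg_nonpos.2 (by positivity)
  rw [p.fourier_g, ← ofReal_sub, norm_real, h1, ← mul_sub,
    ← integral_sub hi (integrable_exp_mul_gaussianReal _), norm_mul,
    Real.norm_of_nonneg (Real.exp_pos _).le]
  have h2 : ‖∫ x, Real.exp (-(p.β * |x|)) - Real.exp (-p.β * x) ∂(gaussianReal ω p.freqVar)‖ ≤
      ∫ x, Real.exp (-(ω * p.τ ^ 2) * x) ∂(gaussianReal ω p.freqVar) := by
    refine norm_integral_le_of_norm_le (integrable_exp_mul_gaussianReal _) (.of_forall fun x => ?_)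
    rcases le_total 0 x with hx | hx
    · rw [abs_of_nonneg hx, neg_mul, sub_self, norm_zero]
      positivity
    · rw [abs_of_nonpos hx, Real.norm_eq_abs, abs_le]
      have a1 : Real.exp (-(p.β * -x)) ≤ Real.exp (-p.β * x) := Real.exp_le_exp.2 (by nlinarith)
      have a2 : Real.exp (-p.β * x) ≤ Real.exp (-(ω * p.τ ^ 2) * x) :=
        Real.exp_le_exp.2 (by nlinarith)
      have a3 := Real.exp_pos (-(p.β * -x))
      constructor <;> linarith [Real.exp_pos (-(ω * p.τ ^ 2) * x)]
  rw [hm] at h2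
  have h3 : Real.exp (-(p.β ^ 2 / (2 * p.τ ^ 2))) ≤ 1 :=
    Real.exp_le_one_iff.2 (neg_nonpos.2 (by positivity))
  have h4 : ω * -(ω * p.τ ^ 2) + (p.τ ^ 2)⁻¹ * (-(ω * p.τ ^ 2)) ^ 2 / 2 =
      -(ω ^ 2 * p.τ ^ 2 / 2) := by
    field_simp
    ring
  rw [h4] at h2
  exact (mul_le_of_le_one_left (norm_nonneg _) h3).trans h2

/-- The Fourier transform of the truncated function `g`, by which ITS multiplies an eigenvector with
the energy `ω` above the shift. -/
def Params.filter (p : Params) (ω : ℝ) : ℂ :=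
  ∫ t in Set.Icc (-p.T) p.T, (p.g t : ℂ) * exp ((-(ω * t) : ℝ) * I)

/-- Outside [-T, T] the Gaussian factor is at most e^{-T²/(2τ²)}, while the Lorentz function has
total mass one; this bounds the truncation error. -/
theorem Params.norm_filter_sub_le (p : Params) (ω : ℝ) (hω : p.β ≤ ω * p.τ ^ 2) :
    ‖p.filter ω - (Real.exp (-(p.β * ω)) : ℂ)‖ ≤
      Real.exp (-(p.T ^ 2 / (2 * p.τ ^ 2))) + Real.exp (-(ω ^ 2 * p.τ ^ 2 / 2)) := by
  have hτ := p.τ_pos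
  have hT := p.T_pos
  have h1 := integral_add_compl (s := Set.Icc (-p.T) p.T) measurableSet_Icc
    (p.g_mul_exp_integrable ω)
  have h2 : ‖∫ t in (Set.Icc (-p.T) p.T)ᶜ, (p.g t : ℂ) * exp ((-(ω * t) : ℝ) * I)‖ ≤
      Real.exp (-(p.T ^ 2 / (2 * p.τ ^ 2))) := by
    have h3 : ‖∫ t in (Set.Icc (-p.T) p.T)ᶜ, (p.g t : ℂ) * exp ((-(ω * t) : ℝ) * I)‖ ≤
        ∫ t in (Set.Icc (-p.T) p.T)ᶜ, p.lorentz t * Real.exp (-(p.T ^ 2 / (2 * p.τ ^ 2))) := by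
      refine norm_integral_le_of_norm_le (p.lorentz_integrable.mul_const _).integrableOn ?_
      refine (ae_restrict_iff' measurableSet_Icc.compl).2 (.of_forall fun t ht => ?_)
      rw [norm_mul, norm_exp_ofReal_mul_I, mul_one, norm_real,
        Real.norm_of_nonneg (p.g_pos t).le]
      refine mul_le_mul_of_nonneg_left (Real.exp_le_exp.2 (neg_le_neg ?_)) (p.lorentz_nonneg t)
      have ht' : p.T ^ 2 ≤ t ^ 2 := by
        rw [sq_le_sq, abs_of_pos hT]
        by_contra! hc
        exact ht ⟨by linarith [(abs_lt.1 hc).1], by linarith [(abs_lt.1 hc).2]⟩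
      gcongr
      nlinarith [sq_nonneg p.β]
    refine h3.trans ?_
    rw [integral_mul_const]
    refine mul_le_of_le_one_left (Real.exp_pos _).le ?_
    rw [← p.integral_lorentz]
    exact setIntegral_le_integral p.lorentz_integrable (.of_forall p.lorentz_nonneg)
  have h4 := p.norm_fourier_sub_le ω hω
  have h5 : p.filter ω - (Real.exp (-(p.β * ω)) : ℂ) =
      ((∫ t : ℝ, (p.g t : ℂ) * exp ((-(ω * t) : ℝ) * I)) - (Real.exp (-(p.β * ω)) : ℂ)) -
      ∫ t in (Set.Icc (-p.T) p.T)ᶜ, (p.g t : ℂ) * exp ((-(ω * t) : ℝ) * I) := by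
    rw [← h1, Params.filter]
    ring
  rw [h5]
  exact (norm_sub_le _ _).trans (by linarith)

end Fourier

/-! ### A bound of the normalisation factor -/

/-- For x = h_tot|t| ≤ 1, √(1 + x²) ≤ 1 + x²/2 and e^x - 1 - x ≤ x², which together give 1 + 3x²/2.
-/
theorem lorTotal_le {M : ℕ} (h : Fin M → ℝ) (t : ℝ) (ht : absSum h * |t| ≤ 1) :
    lorTotal h t ≤ Real.exp (3 / 2 * (absSum h * |t|) ^ 2) := by
  have h0 : 0 ≤ absSum h * |t| := mul_nonneg (absSum_nonneg h) (abs_nonneg t)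
  have h1 := Real.abs_exp_sub_one_sub_id_le (x := absSum h * |t|) (by rwa [abs_of_nonneg h0])
  have h2 : Real.sqrt (1 + (absSum h * |t|) ^ 2) ≤ 1 + (absSum h * |t|) ^ 2 / 2 := by
    rw [Real.sqrt_le_left (by positivity)]
    nlinarith [sq_nonneg ((absSum h * |t|) ^ 2)]
  have h3 := Real.add_one_le_exp (3 / 2 * (absSum h * |t|) ^ 2)
  unfold lorTotal
  linarith [(abs_le.1 h1).2]

/-- N_t steps of length t/N_t accumulate the exponent (3/2)(h_tot t)²/N_t ≤ 3/2, and g lies below a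
probability density. The first hypothesis puts each step in the range of `lorTotal_le`. -/
theorem Params.CT_le {M : ℕ} (p : Params) (h : Fin M → ℝ) (h1 : absSum h * p.T ≤ p.Nt)
    (h2 : (absSum h * p.T) ^ 2 ≤ p.Nt) : p.CT h ≤ Real.exp (3 / 2) := by
  have hN : (0 : ℝ) < p.Nt := Nat.cast_pos.2 p.Nt_pos
  rw [p.CT_eq]
  have h3 : ∀ t ∈ Set.Icc (-p.T) p.T, p.g t * lorTotal h (t / p.Nt) ^ p.Nt ≤
      p.lorentz t * Real.exp (3 / 2) := by
    intro t ht
    have ht' : absSum h * |t| ≤ absSum h * p.T :=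
      mul_le_mul_of_nonneg_left (abs_le.2 ht) (absSum_nonneg h)
    have h0 : 0 ≤ absSum h * |t| := mul_nonneg (absSum_nonneg h) (abs_nonneg t)
    have e1 : absSum h * |t / p.Nt| = absSum h * |t| / p.Nt := by
      rw [abs_div, abs_of_pos hN, mul_div_assoc]
    have h4 := lorTotal_le h (t / p.Nt) (by rw [e1]; exact (div_le_one hN).2 (ht'.trans h1))
    have h5 : lorTotal h (t / p.Nt) ^ p.Nt ≤ Real.exp (3 / 2) := by
      refine (pow_le_pow_left₀ (by linarith [lorTotal_ge_one h (t / p.Nt)]) h4 _).trans ?_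
      rw [← Real.exp_nat_mul, Real.exp_le_exp, e1]
      have h6 : (absSum h * |t|) ^ 2 ≤ p.Nt := (pow_le_pow_left₀ h0 ht' 2).trans h2
      have h7 : (p.Nt : ℝ) * (3 / 2 * (absSum h * |t| / p.Nt) ^ 2) =
          3 / 2 * ((absSum h * |t|) ^ 2 / p.Nt) := by field_simp
      rw [h7]
      have := (div_le_one hN).2 h6
      linarith
    exact mul_le_mul (p.g_le_lorentz t) h5
      (pow_nonneg (by linarith [lorTotal_ge_one h (t / p.Nt)]) _) (p.lorentz_nonneg t)
  calc _ ≤ ∫ t in Set.Icc (-p.T) p.T, p.lorentz t * Real.exp (3 / 2) :=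
        setIntegral_mono_on
          ((p.integrand_continuous h).continuousOn.integrableOn_compact isCompact_Icc)
          (p.lorentz_integrable.mul_const _).integrableOn measurableSet_Icc h3
    _ = (∫ t in Set.Icc (-p.T) p.T, p.lorentz t) * Real.exp (3 / 2) := integral_mul_const _ _
    _ ≤ 1 * Real.exp (3 / 2) := by
        refine mul_le_mul_of_nonneg_right ?_ (Real.exp_pos _).le
        rw [← p.integral_lorentz]
        exact setIntegral_le_integral p.lorentz_integrable (.of_forall p.lorentz_nonneg)
    _ = _ := one_mul _

/-! ### Norms of vectors -/

/-- The Euclidean norm of a vector. -/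
def vnorm {n : ℕ} (φ : Vec n) : ℝ := ‖(WithLp.toLp 2 φ : EuclideanSpace ℂ (Basis n))‖

theorem braket_eq_inner {n : ℕ} (φ χ : Vec n) :
    braket φ χ = inner ℂ (WithLp.toLp 2 φ : EuclideanSpace ℂ (Basis n)) (WithLp.toLp 2 χ) := by
  rw [EuclideanSpace.inner_eq_star_dotProduct, braket, dotProduct_comm]

theorem vnorm_nonneg {n : ℕ} (φ : Vec n) : 0 ≤ vnorm φ := norm_nonneg _

theorem braket_self {n : ℕ} (φ : Vec n) : braket φ φ = ((vnorm φ ^ 2 : ℝ) : ℂ) := by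
  rw [braket_eq_inner, inner_self_eq_norm_sq_to_K, vnorm]
  push_cast
  rfl

theorem norm_braket_le {n : ℕ} (φ χ : Vec n) : ‖braket φ χ‖ ≤ vnorm φ * vnorm χ := by
  rw [braket_eq_inner]; exact norm_inner_le_norm _ _

theorem vnorm_add_le {n : ℕ} (φ χ : Vec n) : vnorm (φ + χ) ≤ vnorm φ + vnorm χ :=
  norm_add_le (WithLp.toLp 2 φ : EuclideanSpace ℂ (Basis n)) (WithLp.toLp 2 χ)

theorem vnorm_eq_one {n : ℕ} {φ : Vec n} (hφ : braket φ φ = 1) : vnorm φ = 1 := by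
  rw [braket_self] at hφ
  have h1 : vnorm φ ^ 2 = 1 := by exact_mod_cast hφ
  exact (pow_eq_one_iff_of_nonneg (vnorm_nonneg φ) two_ne_zero).1 h1

theorem vnorm_unitary {n : ℕ} {U : Op n} (hU : U ∈ Matrix.unitaryGroup (Basis n) ℂ) (φ : Vec n) :
    vnorm (U.mulVec φ) = vnorm φ := by
  have h1 := braket_mulVec_unitary hU φ
  rw [braket_self, braket_self] at h1
  have h2 : vnorm (U.mulVec φ) ^ 2 = vnorm φ ^ 2 := by exact_mod_cast h1
  exact (pow_left_inj₀ (vnorm_nonneg _) (vnorm_nonneg _) two_ne_zero).1 h2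

theorem norm_braket_linComb_le {n K : ℕ} (a : Fin K → ℝ) (A : Fin K → Op n)
    (hA : ∀ j, A j ∈ Matrix.unitaryGroup (Basis n) ℂ) (φ χ : Vec n) :
    ‖braket φ ((linComb a A).mulVec χ)‖ ≤ absSum a * (vnorm φ * vnorm χ) := by
  have h1 : braket φ ((linComb a A).mulVec χ) = ∑ j, (a j : ℂ) * braket φ ((A j).mulVec χ) := by
    simp only [linComb, Matrix.sum_mulVec, Matrix.smul_mulVec, braket, dotProduct_sum,
      dotProduct_smul, smul_eq_mul]
  rw [h1, absSum, Finset.sum_mul]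
  refine (norm_sum_le _ _).trans (Finset.sum_le_sum fun j _ => ?_)
  rw [norm_mul, Complex.norm_real, Real.norm_eq_abs]
  refine mul_le_mul_of_nonneg_left ?_ (abs_nonneg _)
  have h2 := norm_braket_le φ ((A j).mulVec χ)
  rwa [vnorm_unitary (hA j)] at h2

/-- Splitting the difference into two terms bounds it by a_O(ε(1 + ε) + ε), and ε ≤ 1 gives the
constant 3. -/
theorem norm_braket_sub_le {n K : ℕ} (a : Fin K → ℝ) (A : Fin K → Op n)
    (hA : ∀ j, A j ∈ Matrix.unitaryGroup (Basis n) ℂ) (v w : Vec n) {ε : ℝ} (hε : ε ≤ 1)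
    (hvw : vnorm (v - w) ≤ ε) (hw : vnorm w ≤ 1) :
    ‖braket v ((linComb a A).mulVec v) - braket w ((linComb a A).mulVec w)‖ ≤
      absSum a * (3 * ε) := by
  have h0 : v = w + (v - w) := by abel
  have h1 : vnorm v ≤ 1 + ε := by
    rw [h0]
    exact (vnorm_add_le _ _).trans (by linarith)
  have h2 : braket v ((linComb a A).mulVec v) - braket w ((linComb a A).mulVec w) =
      braket (v - w) ((linComb a A).mulVec v) + braket w ((linComb a A).mulVec (v - w)) := by
    simp only [braket, star_sub, sub_dotProduct, Matrix.mulVec_sub, dotProduct_sub]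
    ring
  rw [h2]
  refine (norm_add_le _ _).trans ((add_le_add (norm_braket_linComb_le a A hA _ _)
    (norm_braket_linComb_le a A hA _ _)).trans ?_)
  rw [← mul_add]
  refine mul_le_mul_of_nonneg_left ?_ (absSum_nonneg a)
  have e0 := vnorm_nonneg (v - w)
  have e1 := vnorm_nonneg v
  have e2 := vnorm_nonneg w
  have e3 : vnorm (v - w) * vnorm v ≤ ε * (1 + ε) := mul_le_mul hvw h1 e1 (e0.trans hvw)
  have e4 : vnorm w * vnorm (v - w) ≤ 1 * ε := mul_le_mul hw hvw e0 zero_le_one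
  nlinarith

/-! ### Functions of a Hermitian operator, applied to a vector -/

section Spectral

open scoped Matrix.Norms.L2Operator

theorem exp_smul_mulVec_of_eigen {n : ℕ} (H : Op n) (φ : Vec n) (E : ℂ)
    (hφ : H.mulVec φ = E • φ) (z : ℂ) :
    (NormedSpace.exp (z • H)).mulVec φ = Complex.exp (z * E) • φ := by
  have hpow : ∀ k : ℕ, (H ^ k).mulVec φ = E ^ k • φ := by
    intro k
    induction k with
    | zero => simp
    | succ k ih => rw [pow_succ, ← Matrix.mulVec_mulVec, hφ, Matrix.mulVec_smul, ih, smul_smul,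
        pow_succ, mul_comm]
  have hs := NormedSpace.exp_series_hasSum_exp' (𝕂 := ℂ) (z • H)
  let L : Op n →+ Vec n := ⟨⟨fun A => A.mulVec φ, by simp⟩, fun A B => by simp [Matrix.add_mulVec]⟩
  have hc : Continuous L := by
    change Continuous fun A : Op n => A.mulVec φ
    fun_prop
  have h1 := hs.map L hc
  have h2 := (NormedSpace.exp_series_hasSum_exp' (𝕂 := ℂ) (z * E)).smul_const φ
  rw [← Complex.exp_eq_exp_ℂ] at h2
  refine h1.unique (h2.congr_fun fun k => ?_)
  change ((k.factorial : ℂ)⁻¹ • (z • H) ^ k).mulVec φ = _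
  rw [Matrix.smul_mulVec, smul_pow, Matrix.smul_mulVec, hpow, smul_smul, smul_smul, mul_pow,
    smul_eq_mul, mul_assoc]

end Spectral

variable {n : ℕ} {H : Op n}

/-- The vector `f(H) ψ`. -/
def specVec (hH : H.IsHermitian) (ψ : Vec n) (f : ℝ → ℂ) : Vec n :=
  ∑ k, (f (hH.eigenvalues k) * hH.eigenvectorBasis.repr (WithLp.toLp 2 ψ) k) •
    (hH.eigenvectorBasis k).ofLp

theorem toLp_specVec (hH : H.IsHermitian) (ψ : Vec n) (f : ℝ → ℂ) :
    (WithLp.toLp 2 (specVec hH ψ f) : EuclideanSpace ℂ (Basis n)) =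
      ∑ k, (f (hH.eigenvalues k) * hH.eigenvectorBasis.repr (WithLp.toLp 2 ψ) k) •
        hH.eigenvectorBasis k := by
  rw [specVec, WithLp.toLp_sum]
  rfl

theorem specVec_one (hH : H.IsHermitian) (ψ : Vec n) : specVec hH ψ (fun _ => 1) = ψ := by
  have h1 := toLp_specVec hH ψ fun _ => 1
  simp only [one_mul, hH.eigenvectorBasis.sum_repr] at h1
  exact congrArg WithLp.ofLp h1

theorem braket_specVec (hH : H.IsHermitian) (ψ : Vec n) (f g : ℝ → ℂ) :
    braket (specVec hH ψ f) (specVec hH ψ g) = ∑ k, star (f (hH.eigenvalues k)) *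
      g (hH.eigenvalues k) * ((‖hH.eigenvectorBasis.repr (WithLp.toLp 2 ψ) k‖ ^ 2 : ℝ) : ℂ) := by
  rw [braket_eq_inner, toLp_specVec, toLp_specVec,
    hH.eigenvectorBasis.orthonormal.inner_sum]
  refine Finset.sum_congr rfl fun k _ => ?_
  rw [map_mul, ← Complex.normSq_eq_norm_sq, Complex.normSq_eq_conj_mul_self, Complex.star_def]
  ring

theorem specVec_sub (hH : H.IsHermitian) (ψ : Vec n) (f g : ℝ → ℂ) :
    specVec hH ψ f - specVec hH ψ g = specVec hH ψ fun x => f x - g x := by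
  simp only [specVec, ← Finset.sum_sub_distrib, ← sub_smul, sub_mul]

theorem specVec_const_mul (hH : H.IsHermitian) (ψ : Vec n) (c : ℂ) (f : ℝ → ℂ) :
    specVec hH ψ (fun x => c * f x) = c • specVec hH ψ f := by
  simp only [specVec, Finset.smul_sum, smul_smul, mul_assoc]

/-- By Parseval the squared norm is a weighted mean of |f|² over the spectrum. This converts scalar
bounds on the filter into vector bounds. -/
theorem vnorm_specVec_le (hH : H.IsHermitian) {ψ : Vec n} (hψ : braket ψ ψ = 1) (f : ℝ → ℂ)
    {ε : ℝ} (hε : 0 ≤ ε) (hf : ∀ k, ‖f (hH.eigenvalues k)‖ ≤ ε) :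
    vnorm (specVec hH ψ f) ≤ ε := by
  have h1 : vnorm (specVec hH ψ f) ^ 2 = ∑ k, ‖f (hH.eigenvalues k)‖ ^ 2 *
      ‖hH.eigenvectorBasis.repr (WithLp.toLp 2 ψ) k‖ ^ 2 := by
    have := braket_specVec hH ψ f f
    rw [braket_self] at this
    have h2 := congrArg Complex.re this
    rw [Complex.ofReal_re] at h2
    rw [h2, Complex.re_sum]
    refine Finset.sum_congr rfl fun k _ => ?_
    rw [Complex.re_mul_ofReal, Complex.star_def, ← Complex.normSq_eq_conj_mul_self,
      Complex.ofReal_re, Complex.normSq_eq_norm_sq]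
  have h3 : ∑ k, ‖hH.eigenvectorBasis.repr (WithLp.toLp 2 ψ) k‖ ^ 2 = 1 := by
    rw [← EuclideanSpace.norm_sq_eq, LinearIsometryEquiv.norm_map]
    exact (pow_eq_one_iff_of_nonneg (vnorm_nonneg ψ) two_ne_zero).2 (vnorm_eq_one hψ)
  refine (pow_le_pow_iff_left₀ (vnorm_nonneg _) hε two_ne_zero).1 ?_
  rw [h1]
  calc _ ≤ ∑ k, ε ^ 2 * ‖hH.eigenvectorBasis.repr (WithLp.toLp 2 ψ) k‖ ^ 2 := by
        refine Finset.sum_le_sum fun k _ => ?_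
        have := hf k
        gcongr
    _ = ε ^ 2 := by rw [← Finset.mul_sum, h3, mul_one]

theorem mulVec_specVec_of_eigen (hH : H.IsHermitian) (ψ : Vec n) (B : Op n) (b : ℝ → ℂ)
    (hB : ∀ k, B.mulVec (hH.eigenvectorBasis k).ofLp =
      b (hH.eigenvalues k) • (hH.eigenvectorBasis k).ofLp) (f : ℝ → ℂ) :
    B.mulVec (specVec hH ψ f) = specVec hH ψ fun x => b x * f x := by
  simp only [specVec, Matrix.mulVec_sum, Matrix.mulVec_smul, hB, smul_smul]
  refine Finset.sum_congr rfl fun k _ => ?_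
  congr 1
  ring

theorem mulVec_eigenvectorBasis' (hH : H.IsHermitian) (k : Basis n) :
    H.mulVec (hH.eigenvectorBasis k).ofLp =
      (hH.eigenvalues k : ℂ) • (hH.eigenvectorBasis k).ofLp := by
  rw [hH.mulVec_eigenvectorBasis k]
  rfl

theorem exp_mulVec_eq_specVec (hH : H.IsHermitian) (ψ : Vec n) (z : ℂ) :
    (NormedSpace.exp (z • H)).mulVec ψ = specVec hH ψ fun x => Complex.exp (z * x) := by
  have h1 := mulVec_specVec_of_eigen hH ψ (NormedSpace.exp (z • H)) (fun x => Complex.exp (z * x))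
    (fun k => exp_smul_mulVec_of_eigen H _ _ (mulVec_eigenvectorBasis' hH k) z) fun _ => 1
  rw [specVec_one] at h1
  simpa using h1

/-- On an eigenvector of energy x the evolution and the shift combine to the phase e^{-i(x - E₀)t},
whose integral against g is the filter. -/
theorem Params.mean_eq_specVec {M : ℕ} (p : Params) (h : Fin M → ℝ) (P : Fin M → Fin n → Fin 4)
    (ψ : Vec n) (E₀ : ℝ) :
    p.mean h P ψ E₀ =
      specVec (hamiltonian_isHermitian h P) ψ fun x => p.filter (x - E₀) := by
  ext y
  simp only [Params.mean, exp_mulVec_eq_specVec (hamiltonian_isHermitian h P)]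
  simp only [specVec, Finset.sum_apply, Pi.smul_apply, smul_eq_mul, Finset.mul_sum]
  have key : ∀ (x : ℝ) (c e : ℂ) (t : ℝ), (p.g t : ℂ) * Complex.exp (Complex.I * (E₀ * t : ℝ)) *
      (Complex.exp (-Complex.I * t * x) * c * e) =
      ((p.g t : ℂ) * Complex.exp ((-((x - E₀) * t) : ℝ) * Complex.I)) * (c * e) := by
    intro x c e t
    have : Complex.exp ((-((x - E₀) * t) : ℝ) * Complex.I) =
        Complex.exp (Complex.I * (E₀ * t : ℝ)) * Complex.exp (-Complex.I * t * x) := by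
      rw [← Complex.exp_add]
      congr 1
      push_cast
      ring
    rw [this]
    ring
  simp only [key]
  rw [integral_finsetSum]
  · refine Finset.sum_congr rfl fun k _ => ?_
    rw [integral_mul_const, Params.filter, mul_assoc]
  · intro k _
    exact ((p.g_mul_exp_integrable _).mul_const _).integrableOn

/-! ### Ground states and imaginary-time evolution -/

/-- The vector `exp (-β (H - E₀)) ψ`. -/
def evolved (hH : H.IsHermitian) (ψ : Vec n) (β E₀ : ℝ) : Vec n :=
  specVec hH ψ fun x => (Real.exp (-(β * (x - E₀))) : ℂ)

theorem evolved_eq (hH : H.IsHermitian) (ψ : Vec n) (β E₀ : ℝ) :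
    evolved hH ψ β E₀ =
      (Real.exp (β * E₀) : ℂ) • (NormedSpace.exp (-(β : ℂ) • H)).mulVec ψ := by
  rw [exp_mulVec_eq_specVec hH, ← specVec_const_mul, evolved]
  congr 1
  ext x
  push_cast
  rw [← Complex.exp_add]
  congr 1
  ring

theorem braket_mulVec_comm {B : Op n} (hB : B.IsHermitian) (φ χ : Vec n) :
    braket φ (B.mulVec χ) = braket (B.mulVec φ) χ := by
  rw [braket, braket, Matrix.star_mulVec, hB.eq, Matrix.dotProduct_mulVec]

theorem exp_isHermitian (hH : H.IsHermitian) (β : ℝ) :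
    (NormedSpace.exp (-(β : ℂ) • H)).IsHermitian := by
  refine Matrix.IsHermitian.exp ?_
  rw [Matrix.IsHermitian, Matrix.conjTranspose_smul, hH.eq]
  simp

/-- The shift multiplies numerator and denominator by the same factor e^{2βE₀}. -/
theorem imagTimeMean_eq (hH : H.IsHermitian) (O : Op n) (ψ : Vec n) (β E₀ : ℝ) :
    imagTimeMean H O ψ β = braket (evolved hH ψ β E₀) (O.mulVec (evolved hH ψ β E₀)) /
      braket (evolved hH ψ β E₀) (evolved hH ψ β E₀) := by
  have h1 : NormedSpace.exp (-(2 * β : ℂ) • H) =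
      NormedSpace.exp (-(β : ℂ) • H) * NormedSpace.exp (-(β : ℂ) • H) := by
    rw [← Matrix.exp_add_of_commute _ _ (Commute.refl _), ← add_smul]
    congr 2
    ring
  have h2 : ((Real.exp (β * E₀) : ℝ) : ℂ) ≠ 0 := by exact_mod_cast (Real.exp_pos _).ne'
  have h3 : ∀ (φ χ : Vec n) (c : ℝ), braket ((c : ℂ) • φ) ((c : ℂ) • χ) =
      (c * c : ℂ) * braket φ χ := by
    intro φ χ c
    simp only [braket, star_smul, smul_dotProduct, dotProduct_smul, smul_eq_mul, Complex.star_def,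
      Complex.conj_ofReal]
    ring
  rw [imagTimeMean, h1, ← Matrix.mulVec_mulVec, ← Matrix.mulVec_mulVec, ← Matrix.mulVec_mulVec,
    braket_mulVec_comm (exp_isHermitian hH β), braket_mulVec_comm (exp_isHermitian hH β),
    evolved_eq, Matrix.mulVec_smul, h3, h3, mul_div_mul_left _ _ (mul_ne_zero h2 h2)]

theorem IsGroundState.eigenvalue_ge {Eg : ℝ} {ψg : Vec n} (hg : IsGroundState H Eg ψg)
    (hH : H.IsHermitian) (k : Basis n) : Eg ≤ hH.eigenvalues k := by
  refine hg.minimal _ (hH.eigenvectorBasis k).ofLp (fun h0 => ?_) (mulVec_eigenvectorBasis' hH k)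
  have := hH.eigenvectorBasis.orthonormal.ne_zero k
  exact this (congrArg (WithLp.toLp 2) h0)

/-- Cauchy–Schwarz against the ground state, on which the evolution acts as the scalar e^{-β(E_g -
E₀)}. -/
theorem IsGroundState.vnorm_evolved_sq_ge {Eg : ℝ} {ψg : Vec n} (hg : IsGroundState H Eg ψg)
    (hH : H.IsHermitian) (ψ : Vec n) {pb : ℝ} (hp : pb ≤ ‖braket ψg ψ‖ ^ 2) (β E₀ : ℝ) :
    pb * Real.exp (-(2 * (β * (Eg - E₀)))) ≤ vnorm (evolved hH ψ β E₀) ^ 2 := by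
  have h1 : braket ψg (evolved hH ψ β E₀) = (Real.exp (-(β * (Eg - E₀))) : ℂ) * braket ψg ψ := by
    have h2 : ∀ (c : ℂ) (φ χ : Vec n), braket φ (c • χ) = c * braket φ χ := by
      intro c φ χ
      simp [braket, dotProduct_smul]
    have h3 : ∀ (c : ℝ) (φ χ : Vec n), braket ((c : ℂ) • φ) χ = c * braket φ χ := by
      intro c φ χ
      simp [braket, smul_dotProduct]
    have h4 := exp_smul_mulVec_of_eigen H ψg Eg hg.eigen (-(β : ℂ))
    have h5 : Complex.exp (-(β : ℂ) * Eg) = ((Real.exp (-β * Eg) : ℝ) : ℂ) := by push_cast; rfl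
    rw [evolved_eq, h2, braket_mulVec_comm (exp_isHermitian hH β), h4, h5, h3, ← mul_assoc,
      ← Complex.ofReal_mul, ← Real.exp_add]
    congr 3
    ring
  have h2 := norm_braket_le ψg (evolved hH ψ β E₀)
  rw [h1, vnorm_eq_one hg.normalised, one_mul, norm_mul, Complex.norm_real,
    Real.norm_of_nonneg (Real.exp_pos _).le] at h2
  have h3 := pow_le_pow_left₀ (by positivity) h2 2
  rw [mul_pow, ← Real.exp_nat_mul] at h3
  have h4 : Real.exp (-(2 * (β * (Eg - E₀)))) = Real.exp ((2 : ℕ) * -(β * (Eg - E₀))) := by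
    push_cast
    ring_nf
  rw [mul_comm pb, h4]
  exact (mul_le_mul_of_nonneg_left hp (Real.exp_pos _).le).trans h3

theorem IsGroundState.vnorm_evolved_le {Eg : ℝ} {ψg : Vec n} (hg : IsGroundState H Eg ψg)
    (hH : H.IsHermitian) {ψ : Vec n} (hψ : braket ψ ψ = 1) {β E₀ : ℝ} (hβ : 0 ≤ β) (hE : E₀ ≤ Eg) :
    vnorm (evolved hH ψ β E₀) ≤ 1 := by
  refine vnorm_specVec_le hH hψ _ zero_le_one fun k => ?_
  rw [Complex.norm_real, Real.norm_of_nonneg (Real.exp_pos _).le, Real.exp_le_one_iff]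
  have := hg.eigenvalue_ge hH k
  have := mul_nonneg hβ (by linarith : 0 ≤ hH.eigenvalues k - E₀)
  linarith

/-- Validates the starting estimate 0 with uncertainty h_tot. -/
theorem IsGroundState.abs_energy_le {M : ℕ} {h : Fin M → ℝ} {P : Fin M → Fin n → Fin 4} {Eg : ℝ}
    {ψg : Vec n} (hg : IsGroundState (hamiltonian h P) Eg ψg) : |Eg| ≤ absSum h := by
  have h1 := norm_braket_linComb_le h (fun j => pauliOp (P j)) (fun j => pauliOp_mem_unitary _) ψg ψg
  have h2 : braket ψg ((linComb h fun j => pauliOp (P j)).mulVec ψg) = Eg := by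
    have := hg.eigen
    rw [hamiltonian] at this
    rw [this, braket, dotProduct_smul]
    have h3 := hg.normalised
    rw [braket] at h3
    rw [h3, smul_eq_mul, mul_one]
  rw [h2, vnorm_eq_one hg.normalised, Complex.norm_real, Real.norm_eq_abs] at h1
  linarith

/-- The projection error of the energy at a finite imaginary time. -/
theorem IsGroundState.abs_mean_energy_sub_le {Eg : ℝ} {ψg : Vec n} (hg : IsGroundState H Eg ψg)
    (hH : H.IsHermitian) {ψ : Vec n} (hψ : braket ψ ψ = 1) {pb : ℝ} (hpb : 0 < pb)
    (hp : pb ≤ ‖braket ψg ψ‖ ^ 2) {β : ℝ} (hβ : 0 < β) :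
    |(imagTimeMean H H ψ β).re - Eg| ≤ 1 / (2 * β * pb) := by
  -- With the shift at E_g itself the denominator is at least p_b, and the excess energy in the
  -- numerator is a sum of nonnegative terms.
  have hd := hg.vnorm_evolved_sq_ge hH ψ hp β Eg
  rw [sub_self, mul_zero, mul_zero, neg_zero, Real.exp_zero, mul_one] at hd
  have hd0 : 0 < vnorm (evolved hH ψ β Eg) ^ 2 := hpb.trans_le hd
  have hHw : H.mulVec (evolved hH ψ β Eg) - (Eg : ℂ) • evolved hH ψ β Eg =
      specVec hH ψ fun x => ((x : ℂ) - Eg) * (Real.exp (-(β * (x - Eg))) : ℂ) := by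
    rw [evolved, mulVec_specVec_of_eigen hH ψ H (fun x => (x : ℂ)) (mulVec_eigenvectorBasis' hH),
      ← specVec_const_mul, specVec_sub]
    simp only [sub_mul]
  have hnum : braket (evolved hH ψ β Eg) (H.mulVec (evolved hH ψ β Eg)) -
      Eg * braket (evolved hH ψ β Eg) (evolved hH ψ β Eg) =
      ((∑ k, (hH.eigenvalues k - Eg) * Real.exp (-(2 * β * (hH.eigenvalues k - Eg))) *
        ‖hH.eigenvectorBasis.repr (WithLp.toLp 2 ψ) k‖ ^ 2 : ℝ) : ℂ) := by
    have h1 : braket (evolved hH ψ β Eg) (H.mulVec (evolved hH ψ β Eg)) -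
        Eg * braket (evolved hH ψ β Eg) (evolved hH ψ β Eg) = braket (evolved hH ψ β Eg)
        (H.mulVec (evolved hH ψ β Eg) - (Eg : ℂ) • evolved hH ψ β Eg) := by
      simp [braket, dotProduct_sub, dotProduct_smul]
    rw [h1, hHw, evolved, braket_specVec, Complex.ofReal_sum]
    refine Finset.sum_congr rfl fun k _ => ?_
    have h2 : Real.exp (-(2 * β * (hH.eigenvalues k - Eg))) =
        Real.exp (-(β * (hH.eigenvalues k - Eg))) * Real.exp (-(β * (hH.eigenvalues k - Eg))) := by
      rw [← Real.exp_add]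
      congr 1
      ring
    rw [h2, Complex.star_def, Complex.conj_ofReal]
    push_cast
    ring
  have hsum : ∑ k, ‖hH.eigenvectorBasis.repr (WithLp.toLp 2 ψ) k‖ ^ 2 = 1 := by
    rw [← EuclideanSpace.norm_sq_eq, LinearIsometryEquiv.norm_map]
    exact (pow_eq_one_iff_of_nonneg (vnorm_nonneg ψ) two_ne_zero).2 (vnorm_eq_one hψ)
  have hdiff : (imagTimeMean H H ψ β).re - Eg =
      (∑ k, (hH.eigenvalues k - Eg) * Real.exp (-(2 * β * (hH.eigenvalues k - Eg))) *
        ‖hH.eigenvectorBasis.repr (WithLp.toLp 2 ψ) k‖ ^ 2) / vnorm (evolved hH ψ β Eg) ^ 2 := by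
    have h1 : imagTimeMean H H ψ β - Eg = ((∑ k, (hH.eigenvalues k - Eg) *
        Real.exp (-(2 * β * (hH.eigenvalues k - Eg))) *
        ‖hH.eigenvectorBasis.repr (WithLp.toLp 2 ψ) k‖ ^ 2 : ℝ) : ℂ) /
        ((vnorm (evolved hH ψ β Eg) ^ 2 : ℝ) : ℂ) := by
      rw [imagTimeMean_eq hH H ψ β Eg, ← hnum, ← braket_self, sub_div, mul_div_assoc, div_self,
        mul_one]
      rw [braket_self]
      exact_mod_cast hd0.ne'
    rw [← Complex.ofReal_div] at h1
    have := congrArg Complex.re h1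
    rwa [Complex.sub_re, Complex.ofReal_re, Complex.ofReal_re] at this
  have hx : ∀ k, 0 ≤ hH.eigenvalues k - Eg := fun k => by linarith [hg.eigenvalue_ge hH k]
  -- Termwise, y e^{-y} ≤ 1 for y = 2β(E_k - E_g).
  have hb : ∑ k, (hH.eigenvalues k - Eg) * Real.exp (-(2 * β * (hH.eigenvalues k - Eg))) *
      ‖hH.eigenvectorBasis.repr (WithLp.toLp 2 ψ) k‖ ^ 2 ≤ 1 / (2 * β) := by
    calc _ ≤ ∑ k, 1 / (2 * β) * ‖hH.eigenvectorBasis.repr (WithLp.toLp 2 ψ) k‖ ^ 2 := by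
          refine Finset.sum_le_sum fun k _ => mul_le_mul_of_nonneg_right ?_ (by positivity)
          rw [le_div_iff₀ (by positivity), Real.exp_neg, mul_right_comm, ← div_eq_mul_inv,
            div_le_one (Real.exp_pos _)]
          have := Real.add_one_le_exp (2 * β * (hH.eigenvalues k - Eg))
          linarith
      _ = _ := by rw [← Finset.mul_sum, hsum, mul_one]
  have h0 : 0 ≤ ∑ k, (hH.eigenvalues k - Eg) * Real.exp (-(2 * β * (hH.eigenvalues k - Eg))) *
      ‖hH.eigenvectorBasis.repr (WithLp.toLp 2 ψ) k‖ ^ 2 :=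
    Finset.sum_nonneg fun k _ => by have := hx k; positivity
  rw [hdiff, abs_of_nonneg (by positivity), ← div_div]
  exact div_le_div₀ (by positivity) hb hpb hd

/-- The gap puts every spectral value ω = E_k - E₀ above 1/β. With β ≤ τ this gives β ≤ ωτ² and ω²τ²
≥ τ²/β², so the scalar bound is uniform over the spectrum. -/
theorem Params.vnorm_mean_sub_le {M : ℕ} (p : Params) {h : Fin M → ℝ} {P : Fin M → Fin n → Fin 4}
    {Eg : ℝ} {ψg : Vec n} (hg : IsGroundState (hamiltonian h P) Eg ψg) {ψ : Vec n}
    (hψ : braket ψ ψ = 1) {E₀ : ℝ} (hE : 1 / p.β ≤ Eg - E₀) (hτ : p.β ≤ p.τ) :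
    vnorm (p.mean h P ψ E₀ - evolved (hamiltonian_isHermitian h P) ψ p.β E₀) ≤
      Real.exp (-(p.T ^ 2 / (2 * p.τ ^ 2))) + Real.exp (-(p.τ ^ 2 / (2 * p.β ^ 2))) := by
  have hβ := p.β_pos
  rw [p.mean_eq_specVec, evolved, specVec_sub]
  refine vnorm_specVec_le _ hψ _ (by positivity) fun k => ?_
  set ω := (hamiltonian_isHermitian h P).eigenvalues k - E₀ with hω
  have h1 : 1 / p.β ≤ ω := by
    have := hg.eigenvalue_ge (hamiltonian_isHermitian h P) k
    linarith
  have h2 : p.β ≤ ω * p.τ ^ 2 := by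
    calc p.β = 1 / p.β * p.β ^ 2 := by field_simp
      _ ≤ ω * p.τ ^ 2 := by gcongr; exact (by positivity : (0 : ℝ) ≤ 1 / p.β).trans h1
  refine (p.norm_filter_sub_le ω h2).trans (add_le_add le_rfl (Real.exp_le_exp.2 (neg_le_neg ?_)))
  calc p.τ ^ 2 / (2 * p.β ^ 2) = (1 / p.β) ^ 2 * p.τ ^ 2 / 2 := by field_simp
    _ ≤ _ := by gcongr

/-! ### Deviations of sample sums -/

section Chebyshev

open ProbabilityTheory

variable {α : Type*} [MeasurableSpace α] (μ : Measure α) [IsProbabilityMeasure μ]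

theorem pi_abs_sum_sub_ge_le (N : ℕ) {f : α → ℝ} (hf : Measurable f) {B : ℝ}
    (hB : ∀ x, |f x| ≤ B) {δ : ℝ} (hδ : 0 < δ) :
    Measure.pi (fun _ : Fin N => μ) {x | δ ≤ |∑ l, f (x l) - N * ∫ y, f y ∂μ|} ≤
      ENNReal.ofReal (N * B ^ 2 / δ ^ 2) := by
  have hm : ∀ l : Fin N, MemLp (fun x : Fin N → α => f (x l)) 2 (Measure.pi fun _ : Fin N => μ) :=
    fun l => MemLp.of_bound (hf.comp (measurable_pi_apply l)).aestronglyMeasurable B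
      (.of_forall fun x => hB (x l))
  have hsum : MemLp (∑ l : Fin N, fun x : Fin N → α => f (x l)) 2 (Measure.pi fun _ : Fin N => μ) :=
    memLp_finsetSum' _ fun l _ => hm l
  have hind : iIndepFun (fun (l : Fin N) (x : Fin N → α) => f (x l)) (Measure.pi fun _ => μ) :=
    iIndepFun_pi fun _ => hf.aemeasurable
  have hvar : Var[∑ l : Fin N, fun x : Fin N → α => f (x l); Measure.pi fun _ : Fin N => μ] ≤
      N * B ^ 2 := by
    rw [IndepFun.variance_sum (fun l _ => hm l) (fun i _ j _ hij => hind.indepFun hij)]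
    calc _ ≤ ∑ _l : Fin N, B ^ 2 := by
          refine Finset.sum_le_sum fun l _ => ?_
          have h0 : ∀ᵐ x ∂(Measure.pi fun _ : Fin N => μ), f (x l) ∈ Set.Icc (-B) B :=
            .of_forall fun x => Set.mem_Icc.2 (abs_le.1 (hB (x l)))
          refine (variance_le_sq_of_bounded h0 (hm l).aestronglyMeasurable.aemeasurable).trans
            (le_of_eq ?_)
          ring
      _ = N * B ^ 2 := by simp
  have hint : ∫ x, (∑ l : Fin N, fun x : Fin N → α => f (x l)) x ∂(Measure.pi fun _ : Fin N => μ) =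
      N * ∫ y, f y ∂μ := by
    simp only [Finset.sum_apply]
    rw [integral_finsetSum _ fun l _ => (hm l).integrable (by norm_num)]
    simp only [integral_comp_eval (μ := fun _ : Fin N => μ) hf.aestronglyMeasurable]
    simp
  have h1 := meas_ge_le_variance_div_sq hsum hδ
  rw [hint] at h1
  simp only [Finset.sum_apply] at h1
  exact h1.trans (ENNReal.ofReal_le_ofReal (by gcongr))

/-- Real and imaginary parts are treated separately, each allowed half of the deviation. The
constant is 8 = 2 · 2²: two parts, and the square of the halving. -/
theorem pi_norm_sum_sub_ge_le (N : ℕ) {f : α → ℂ} (hf : Measurable f) {B : ℝ}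
    (hB : ∀ x, ‖f x‖ ≤ B) {δ s : ℝ} (hδ : 0 < δ) (hs : 0 < s) :
    Measure.pi (fun _ : Fin N => μ)
      {x | δ ≤ ‖(s : ℂ) * ∑ l, f (x l) - s * N * ∫ y, f y ∂μ‖} ≤
      ENNReal.ofReal (8 * N * B ^ 2 * s ^ 2 / δ ^ 2) := by
  have hi : Integrable f μ := Integrable.of_bound hf.aestronglyMeasurable B (.of_forall hB)
  have hre := pi_abs_sum_sub_ge_le μ N (Complex.measurable_re.comp hf) (B := B)
    (fun x => (Complex.abs_re_le_norm _).trans (hB x)) (δ := δ / (2 * s)) (by positivity)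
  have him := pi_abs_sum_sub_ge_le μ N (Complex.measurable_im.comp hf) (B := B)
    (fun x => (Complex.abs_im_le_norm _).trans (hB x)) (δ := δ / (2 * s)) (by positivity)
  have e1 : ∫ y, (f y).re ∂μ = (∫ y, f y ∂μ).re := integral_re hi
  have e2 : ∫ y, (f y).im ∂μ = (∫ y, f y ∂μ).im := integral_im hi
  simp only [Function.comp_apply, e1, e2] at hre him
  have hsub : {x : Fin N → α | δ ≤ ‖(s : ℂ) * ∑ l, f (x l) - s * N * ∫ y, f y ∂μ‖} ⊆
      {x | δ / (2 * s) ≤ |∑ l, (f (x l)).re - N * (∫ y, f y ∂μ).re|} ∪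
      {x | δ / (2 * s) ≤ |∑ l, (f (x l)).im - N * (∫ y, f y ∂μ).im|} := by
    intro x hx
    by_contra hc
    simp only [Set.mem_union, Set.mem_ofPred_eq, not_or, not_le] at hc
    obtain ⟨c1, c2⟩ := hc
    have h1 : (s : ℂ) * ∑ l, f (x l) - s * N * ∫ y, f y ∂μ =
        s * (∑ l, f (x l) - N * ∫ y, f y ∂μ) := by ring
    have h2 := Complex.norm_le_abs_re_add_abs_im (∑ l, f (x l) - N * ∫ y, f y ∂μ)
    simp only [Complex.sub_re, Complex.sub_im, Complex.re_sum, Complex.im_sum, Complex.mul_re,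
      Complex.mul_im, Complex.natCast_re, Complex.natCast_im, zero_mul, sub_zero, add_zero] at h2
    rw [Set.mem_ofPred_eq, h1, norm_mul, Complex.norm_real, Real.norm_of_nonneg hs.le] at hx
    have h3 : s * ‖∑ l, f (x l) - N * ∫ y, f y ∂μ‖ < s * (δ / (2 * s) + δ / (2 * s)) :=
      mul_lt_mul_of_pos_left (h2.trans_lt (add_lt_add c1 c2)) hs
    have h4 : s * (δ / (2 * s) + δ / (2 * s)) = δ := by field_simp; norm_num
    linarith
  refine (measure_mono hsub).trans ((measure_union_le _ _).trans ((add_le_add hre him).trans ?_))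
  rw [← ENNReal.ofReal_add (by positivity) (by positivity)]
  refine ENNReal.ofReal_le_ofReal (le_of_eq ?_)
  field_simp
  ring

end Chebyshev

/-! ### Adaptively chosen parameters -/

/-- Fubini in coordinate `i`: with the other coordinates fixed, the adaptive parameter `E` is
constant, so each slice lies in one section of `S`, and the section bound is uniform in the
parameter. -/
theorem pi_adaptive_le {N : ℕ} {α : Fin N → Type*} [∀ i, MeasurableSpace (α i)]
    (μ : ∀ i, Measure (α i)) [∀ i, IsProbabilityMeasure (μ i)] (i : Fin N)
    {E : (∀ j, α j) → ℝ} (hE : Measurable E)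
    (hE' : ∀ ω ω', (∀ j, j ≠ i → ω j = ω' j) → E ω = E ω')
    {S : Set (ℝ × α i)} (hS : MeasurableSet S) {κ : ENNReal}
    (hκ : ∀ e, μ i {x | (e, x) ∈ S} ≤ κ) :
    Measure.pi μ {ω | (E ω, ω i) ∈ S} ≤ κ := by
  obtain _ | N := N
  · exact i.elim0
  have hmp := measurePreserving_piFinSuccAbove μ i
  have hmeas : MeasurableSet {ω | (E ω, ω i) ∈ S} := (hE.prodMk (measurable_pi_apply i)) hS
  have h1 := (hmp.symm (MeasurableEquiv.piFinSuccAbove α i)).measure_preimage hmeas.nullMeasurableSet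
  rw [← h1, Measure.prod_apply_symm ((MeasurableEquiv.measurable _) hmeas)]
  refine (lintegral_mono (g := fun _ => κ) fun y => ?_).trans (by simp)
  -- A point of the slice serves only to name the constant value of `E`; an empty slice has measure
  -- zero.
  rcases Set.eq_empty_or_nonempty ((fun x => (x, y)) ⁻¹'
    ((MeasurableEquiv.piFinSuccAbove α i).symm ⁻¹' {ω | (E ω, ω i) ∈ S})) with h0 | ⟨x₀, -⟩
  · simp only [h0, measure_empty, zero_le]
  · refine (measure_mono fun x hx => ?_).trans (hκ (E (i.insertNth x₀ y)))
    have hx' : (E (i.insertNth x y), (i.insertNth x y : ∀ j, α j) i) ∈ S := hx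
    rw [Fin.insertNth_apply_same] at hx'
    have h2 : E (i.insertNth x y) = E (i.insertNth x₀ y) := by
      refine hE' _ _ fun j hj => ?_
      obtain ⟨k, rfl⟩ := Fin.exists_succAbove_eq hj
      rw [Fin.insertNth_apply_succAbove, Fin.insertNth_apply_succAbove]
    rwa [h2] at hx'

theorem prod_adaptive_le {α β : Type*} [MeasurableSpace α] [MeasurableSpace β] (μ : Measure α)
    [IsProbabilityMeasure μ] (ν : Measure β) [IsProbabilityMeasure ν] {E : α → ℝ} (hE : Measurable E)
    {S : Set (ℝ × β)} (hS : MeasurableSet S) {κ : ENNReal} (hκ : ∀ e, ν {x | (e, x) ∈ S} ≤ κ) :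
    (μ.prod ν) {ω | (E ω.1, ω.2) ∈ S} ≤ κ := by
  have hmeas : MeasurableSet {ω : α × β | (E ω.1, ω.2) ∈ S} :=
    ((hE.comp measurable_fst).prodMk measurable_snd) hS
  rw [Measure.prod_apply hmeas]
  exact (lintegral_mono (g := fun _ => κ) fun x => hκ (E x)).trans (by simp)

/-! ### Measurability of the estimates -/

section Measurability

variable {M K : ℕ} (p : Params) (h : Fin M → ℝ) (a : Fin K → ℝ)

theorem Params.estimate_measurable :
    Measurable fun x : ℝ × (Fin p.Ns → Sample M p.Nt K) => p.estimate h a x.1 x.2 := by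
  refine Measurable.const_mul (Finset.measurable_sum _ fun l _ => ?_) _
  have h0 : (fun x : ℝ × (Fin p.Ns → Sample M p.Nt K) => sampleValue h a x.1 (x.2 l)) = fun x =>
      Complex.exp (Complex.I * (x.1 * ((x.2 l).1.1 - (x.2 l).2.1.1) : ℝ)) *
        sampleValue h a 0 (x.2 l) := funext fun x => sampleValue_eq h a x.1 (x.2 l)
  rw [h0]
  have h1 : Measurable fun x : ℝ × (Fin p.Ns → Sample M p.Nt K) => x.2 l :=
    (measurable_pi_apply l).comp measurable_snd
  refine Measurable.mul ?_ ((sampleValue_measurable h a 0).comp h1)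
  have h2 : Measurable fun x : ℝ × (Fin p.Ns → Sample M p.Nt K) => (x.2 l).1.1 :=
    measurable_fst.comp (measurable_fst.comp h1)
  have h3 : Measurable fun x : ℝ × (Fin p.Ns → Sample M p.Nt K) => (x.2 l).2.1.1 :=
    measurable_fst.comp (measurable_fst.comp (measurable_snd.comp h1))
  fun_prop

theorem Params.num_measurable :
    Measurable fun x : ℝ × p.Data M K => p.num h a x.1 x.2 := by
  have h1 : Measurable fun x : ℝ × p.Data M K => (x.1, x.2.1) :=
    measurable_fst.prodMk (measurable_fst.comp measurable_snd)
  have h2 := (p.estimate_measurable h a).comp h1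
  simp only [Params.num]
  exact h2

theorem Params.den_measurable :
    Measurable fun x : ℝ × p.Data M K => p.den h x.1 x.2 := by
  have h1 : Measurable fun x : ℝ × p.Data M K => (x.1, x.2.2) :=
    measurable_fst.prodMk (measurable_snd.comp measurable_snd)
  have h2 := (p.estimate_measurable h fun _ : Fin 1 => (1 : ℝ)).comp h1
  simp only [Params.den]
  exact h2

/-- The event that the result of an ITS is defined and closer than `ξ` to `m`. -/
def Params.Accurate (m : ℂ) (ξ E₀ : ℝ) (d : p.Data M K) : Prop :=
  p.den h E₀ d ≠ 0 ∧ ‖p.num h a E₀ d / p.den h E₀ d - m‖ < ξ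

theorem Params.measurableSet_accurate (m : ℂ) (ξ : ℝ) :
    MeasurableSet {x : ℝ × p.Data M K | p.Accurate h a m ξ x.1 x.2} := by
  have h1 := p.num_measurable h a
  have h2 := p.den_measurable (K := K) h
  exact (measurableSet_eq_fun h2 measurable_const).compl.inter
    (measurableSet_lt ((h1.div h2).sub_const m).norm measurable_const)

end Measurability

/-! ### The energy estimates -/

section Energy

variable {M Ni : ℕ} (h : Fin M → ℝ) (r : Fin Ni → Params)

theorem gssEnergy_zero (ω : ∀ i, (r i).Data M M) : gssEnergy h r ω 0 = 0 := rfl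

theorem gssEnergy_succ (ω : ∀ i, (r i).Data M M) (i : Fin Ni) :
    gssEnergy h r ω i.succ =
      ((r i).num h h (gssShift h r ω i) (ω i) / (r i).den h (gssShift h r ω i) (ω i)).re := by
  simp only [gssEnergy, gssShift, Fin.induction_succ]

/-- The energy entering a run is a function of the earlier runs only, the independence required by
`pi_adaptive_le`. -/
theorem gssEnergy_congr (ω ω' : ∀ i, (r i).Data M M) (k : Fin (Ni + 1))
    (hω : ∀ j : Fin Ni, j.castSucc < k → ω j = ω' j) : gssEnergy h r ω k = gssEnergy h r ω' k := by
  induction k using Fin.induction with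
  | zero => rw [gssEnergy_zero, gssEnergy_zero]
  | succ i ih =>
    rw [gssEnergy_succ, gssEnergy_succ, gssShift, gssShift, hω i Fin.castSucc_lt_succ,
      ih fun j hj => hω j (hj.trans Fin.castSucc_lt_succ)]

theorem gssEnergy_measurable (k : Fin (Ni + 1)) : Measurable fun ω => gssEnergy h r ω k := by
  induction k using Fin.induction with
  | zero =>
    simp only [gssEnergy_zero]
    exact measurable_const
  | succ i ih =>
    simp only [gssEnergy_succ]
    have h1 : Measurable fun ω : ∀ i, (r i).Data M M => (gssShift h r ω i, ω i) :=
      ((ih.sub_const _).sub_const _).prodMk (measurable_pi_apply i)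
    have h2 := ((r i).num_measurable h h).comp h1
    have h3 := ((r i).den_measurable h).comp h1
    exact Complex.measurable_re.comp (h2.div h3)

end Energy

/-! ### The accuracy of one ITS -/

section Run

variable {n M K : ℕ} (p : Params) (h : Fin M → ℝ) (P : Fin M → Fin n → Fin 4)
  (ψ : Vec n) (a : Fin K → ℝ) (A : Fin K → Op n)

/-- Sample values are bounded by 2 and scaled by s = a_O C_T²/N_s, so `pi_norm_sum_sub_ge_le` yields
8 · N_s · 2² · s²/(a_O δ)². -/
theorem Params.estimate_deviation_le (hh : 0 < absSum h) (hψ : braket ψ ψ = 1) (ha : 0 < absSum a)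
    (hA : ∀ j, A j ∈ Matrix.unitaryGroup (Basis n) ℂ) (E₀ : ℝ) {δ : ℝ} (hδ : 0 < δ) :
    Measure.pi (fun _ : Fin p.Ns => p.sampleLaw h P ψ a A)
      {x | absSum a * δ ≤ ‖p.estimate h a E₀ x -
        braket (p.mean h P ψ E₀) ((linComb a A).mulVec (p.mean h P ψ E₀))‖} ≤
      ENNReal.ofReal (32 * p.CT h ^ 4 / (p.Ns * δ ^ 2)) := by
  have hC := p.CT_pos h
  have hN : (0 : ℝ) < p.Ns := Nat.cast_pos.2 p.Ns_pos
  have := p.sampleLaw_isProbabilityMeasure h P ψ a A hh hψ ha hA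
  have h1 := pi_norm_sum_sub_ge_le (p.sampleLaw h P ψ a A) p.Ns (sampleValue_measurable h a E₀)
    (norm_sampleValue_le h a E₀) (δ := absSum a * δ) (s := absSum a * p.CT h ^ 2 / p.Ns)
    (by positivity) (by positivity)
  rw [p.integral_sampleValue h P ψ a A hh hψ hA] at h1
  have h2 : ((absSum a * p.CT h ^ 2 / p.Ns : ℝ) : ℂ) * p.Ns *
      (((absSum a * p.CT h ^ 2 : ℝ) : ℂ)⁻¹ *
        braket (p.mean h P ψ E₀) ((linComb a A).mulVec (p.mean h P ψ E₀))) =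
      braket (p.mean h P ψ E₀) ((linComb a A).mulVec (p.mean h P ψ E₀)) := by
    have e1 : ((absSum a * p.CT h ^ 2 : ℝ) : ℂ) ≠ 0 := by
      exact_mod_cast (by positivity : absSum a * p.CT h ^ 2 ≠ 0)
    have e2 : (p.Ns : ℂ) ≠ 0 := by exact_mod_cast hN.ne'
    rw [Complex.ofReal_div, Complex.ofReal_natCast, div_mul_cancel₀ _ e2, ← mul_assoc,
      mul_inv_cancel₀ e1, one_mul]
  rw [h2] at h1
  refine h1.trans (ENNReal.ofReal_le_ofReal (le_of_eq ?_))
  field_simp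
  norm_num

/-- The difference of quotients is ((num - O) - (O/D)(den - D))/den. The numerator is below 2se, and
|den| > d/2 because the error of the denominator is at most d/2. -/
theorem dist_div_lt {num den O D : ℂ} {s e d : ℝ} (hs : 0 < s) (he : e ≤ d / 2) (hd : 0 < d)
    (hD : d ≤ ‖D‖) (hOD : ‖O / D‖ ≤ s) (h1 : ‖num - O‖ < s * e) (h2 : ‖den - D‖ < e) :
    den ≠ 0 ∧ ‖num / den - O / D‖ < s * (4 * e / d) := by
  have h3 : d / 2 < ‖den‖ := by
    have := norm_sub_norm_le D den
    rw [norm_sub_rev] at this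
    linarith
  have h4 : 0 < ‖den‖ := by linarith
  have hden : den ≠ 0 := norm_pos_iff.1 h4
  have hD0 : D ≠ 0 := norm_pos_iff.1 (hd.trans_le hD)
  refine ⟨hden, ?_⟩
  have h5 : num / den - O / D = ((num - O) - O / D * (den - D)) / den := by
    field_simp
    ring
  have h6 : ‖(num - O) - O / D * (den - D)‖ < s * (2 * e) := by
    refine (norm_sub_le _ _).trans_lt ?_
    rw [norm_mul]
    have : ‖O / D‖ * ‖den - D‖ ≤ s * e := mul_le_mul hOD h2.le (norm_nonneg _) hs.le
    linarith
  have he0 : 0 < e := (norm_nonneg _).trans_lt h2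
  rw [h5, norm_div, div_lt_iff₀ h4]
  refine h6.trans_le ?_
  have h7 : s * (2 * e) = s * (4 * e / d) * (d / 2) := by field_simp; ring
  rw [h7]
  exact mul_le_mul_of_nonneg_left h3.le (by positivity)

theorem Params.dataLaw_isProbabilityMeasure (hh : 0 < absSum h) (hψ : braket ψ ψ = 1)
    (ha : 0 < absSum a) (hA : ∀ j, A j ∈ Matrix.unitaryGroup (Basis n) ℂ) :
    IsProbabilityMeasure (p.dataLaw h P ψ a A) := by
  have := p.sampleLaw_isProbabilityMeasure h P ψ a A hh hψ ha hA
  have := p.sampleLaw_isProbabilityMeasure h P ψ (fun _ : Fin 1 => (1 : ℝ)) (fun _ => (1 : Op n))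
    hh hψ (by simp [absSum]) (fun _ => one_mem _)
  unfold Params.dataLaw
  infer_instance

theorem prod_union_le {α β : Type*} [MeasurableSpace α] [MeasurableSpace β] (μ : Measure α)
    [IsProbabilityMeasure μ] (ν : Measure β) [IsProbabilityMeasure ν] (S : Set α) (T : Set β) :
    (μ.prod ν) {x | x.1 ∈ S ∨ x.2 ∈ T} ≤ μ S + ν T := by
  have h1 : {x : α × β | x.1 ∈ S ∨ x.2 ∈ T} = S ×ˢ Set.univ ∪ Set.univ ×ˢ T := by
    ext x; simp
  rw [h1]
  refine (measure_union_le _ _).trans (le_of_eq ?_)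
  rw [Measure.prod_prod, Measure.prod_prod, measure_univ, measure_univ, mul_one, one_mul]

/-- One ITS with an admissible energy shift fails with a small probability. -/
theorem Params.dataLaw_not_accurate_le {Eg : ℝ} {ψg : Vec n}
    (hg : IsGroundState (hamiltonian h P) Eg ψg)
    (hh : 0 < absSum h) (hψ : braket ψ ψ = 1) (ha : 0 < absSum a)
    (hA : ∀ j, A j ∈ Matrix.unitaryGroup (Basis n) ℂ) {E₀ pb d e L : ℝ} (hpb : 0 < pb)
    (hp : pb ≤ ‖braket ψg ψ‖ ^ 2) (hE : 1 / p.β ≤ Eg - E₀) (hL : p.β * (Eg - E₀) ≤ L)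
    (hd : d = pb * Real.exp (-(2 * L))) (he : 0 < e) (hed : e ≤ d / 2) (he1 : e ≤ 1)
    (hτ : p.β ≤ p.τ) (hfilter : Real.exp (-(p.T ^ 2 / (2 * p.τ ^ 2))) +
      Real.exp (-(p.τ ^ 2 / (2 * p.β ^ 2))) ≤ e / 6) (hC : p.CT h ≤ Real.exp (3 / 2)) :
    p.dataLaw h P ψ a A {x | ¬ p.Accurate h a (imagTimeMean (hamiltonian h P) (linComb a A) ψ p.β)
      (absSum a * (4 * e / d)) E₀ x} ≤ ENNReal.ofReal (256 * Real.exp 6 / (p.Ns * e ^ 2)) := by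
  have hβ := p.β_pos
  have hN : (0 : ℝ) < p.Ns := Nat.cast_pos.2 p.Ns_pos
  have hH := hamiltonian_isHermitian h P
  have hE' : E₀ ≤ Eg := by
    have : 0 < 1 / p.β := by positivity
    linarith
  have h1 : absSum (fun _ : Fin 1 => (1 : ℝ)) = 1 := by simp [absSum]
  have h1' : linComb (fun _ : Fin 1 => (1 : ℝ)) (fun _ => (1 : Op n)) = 1 := by simp [linComb]
  have := p.sampleLaw_isProbabilityMeasure h P ψ a A hh hψ ha hA
  have := p.sampleLaw_isProbabilityMeasure h P ψ (fun _ : Fin 1 => (1 : ℝ)) (fun _ => (1 : Op n))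
    hh hψ (by rw [h1]; exact one_pos) (fun _ => one_mem _)
  set w := evolved hH ψ p.β E₀ with hw
  set v := p.mean h P ψ E₀ with hv
  have hvw : vnorm (v - w) ≤ e / 6 := (p.vnorm_mean_sub_le hg hψ hE hτ).trans hfilter
  have hw1 : vnorm w ≤ 1 := hg.vnorm_evolved_le hH hψ hβ.le hE'
  have hwd : d ≤ vnorm w ^ 2 := by
    refine le_trans ?_ (hg.vnorm_evolved_sq_ge hH ψ hp p.β E₀)
    rw [hd]
    gcongr
  have hd0 : 0 < d := by rw [hd]; positivity
  -- Error budget, relative to a_O for the numerator: the bias is at most 3 · e/6 = e/2, which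
  -- leaves e/2 for the statistical deviation.
  have hb1 := norm_braket_sub_le a A hA v w (ε := e / 6) (by linarith) hvw hw1
  have hb2 := norm_braket_sub_le (fun _ : Fin 1 => (1 : ℝ)) (fun _ => (1 : Op n))
    (fun _ => one_mem _) v w (ε := e / 6) (by linarith) hvw hw1
  rw [h1, h1', Matrix.one_mulVec, Matrix.one_mulVec, one_mul] at hb2
  have hD : ‖braket w w‖ = vnorm w ^ 2 := by
    rw [braket_self, Complex.norm_real, Real.norm_of_nonneg (by positivity)]
  have hOD : ‖braket w ((linComb a A).mulVec w) / braket w w‖ ≤ absSum a := by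
    rw [norm_div, hD, div_le_iff₀ (hd0.trans_le hwd), pow_two]
    exact norm_braket_linComb_le a A hA w w
  have hs1 := p.estimate_deviation_le h P ψ a A hh hψ ha hA E₀ (δ := e / 2) (by linarith)
  have hs2 := p.estimate_deviation_le h P ψ (fun _ : Fin 1 => (1 : ℝ)) (fun _ => (1 : Op n)) hh hψ
    (by rw [h1]; exact one_pos) (fun _ => one_mem _) E₀ (δ := e / 2) (by linarith)
  rw [h1, h1', Matrix.one_mulVec] at hs2
  simp only [one_mul] at hs2
  have hsub : {x | ¬ p.Accurate h a (imagTimeMean (hamiltonian h P) (linComb a A) ψ p.β)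
      (absSum a * (4 * e / d)) E₀ x} ⊆ {x : p.Data M K | x.1 ∈ {x | absSum a * (e / 2) ≤
        ‖p.estimate h a E₀ x - braket v ((linComb a A).mulVec v)‖} ∨ x.2 ∈ {x | e / 2 ≤
        ‖p.estimate h (fun _ : Fin 1 => (1 : ℝ)) E₀ x - braket v v‖}} := by
    intro x hx
    by_contra hc
    simp only [Set.mem_ofPred_eq, not_or, not_le] at hc
    obtain ⟨c1, c2⟩ := hc
    refine hx ?_
    rw [imagTimeMean_eq hH _ _ _ E₀]
    refine dist_div_lt ha hed hd0 (hD ▸ hwd) hOD ?_ ?_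
    · have := norm_sub_le_norm_sub_add_norm_sub (p.estimate h a E₀ x.1)
        (braket v ((linComb a A).mulVec v)) (braket w ((linComb a A).mulVec w))
      refine this.trans_lt ?_
      linarith
    · have := norm_sub_le_norm_sub_add_norm_sub (p.estimate h (fun _ : Fin 1 => (1 : ℝ)) E₀ x.2)
        (braket v v) (braket w w)
      refine this.trans_lt ?_
      linarith
  refine (measure_mono hsub).trans ((prod_union_le _ _ _ _).trans ((add_le_add hs1 hs2).trans ?_))
  rw [← ENNReal.ofReal_add (by positivity) (by positivity)]
  refine ENNReal.ofReal_le_ofReal ?_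
  have hC4 : p.CT h ^ 4 ≤ Real.exp 6 := by
    refine (pow_le_pow_left₀ (p.CT_pos h).le hC 4).trans (le_of_eq ?_)
    rw [← Real.exp_nat_mul]
    norm_num
  -- Two estimates with deviation e/2 each: 2 · 32 · 2² = 256.
  calc 32 * p.CT h ^ 4 / (p.Ns * (e / 2) ^ 2) + 32 * p.CT h ^ 4 / (p.Ns * (e / 2) ^ 2)
      = 256 * p.CT h ^ 4 / (p.Ns * e ^ 2) := by field_simp; ring
    _ ≤ _ := by gcongr

end Run

/-! ### The success probability of the whole algorithm -/

/-- A run is charged only if the energy it receives is within its uncertainty and the run is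
nevertheless inaccurate. If no run is charged, induction shows that all energies are within their
uncertainties, hence all runs are accurate. A union bound over the Ni + 1 runs finishes the
argument. -/
theorem totalLaw_compl_successEvent_le {n M Ni K : ℕ} (h : Fin M → ℝ) (P : Fin M → Fin n → Fin 4)
    (ψ : Vec n) (r : Fin Ni → Params) (q : Params) (a : Fin K → ℝ) (A : Fin K → Op n)
    {Eg err : ℝ} {κ : ENNReal} (hh : 0 < absSum h) (hψ : braket ψ ψ = 1) (ha : 0 < absSum a)
    (hA : ∀ j, A j ∈ Matrix.unitaryGroup (Basis n) ℂ) (hEg : |Eg| ≤ absSum h)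
    (hproj : ∀ i, |(imagTimeMean (hamiltonian h P) (hamiltonian h P) ψ (r i).β).re - Eg| ≤
      uncertainty h i / 2)
    (hr : ∀ (i : Fin Ni) (E : ℝ), |E - Eg| ≤ uncertainty h i →
      (r i).dataLaw h P ψ h (fun j => pauliOp (P j)) {x | ¬ (r i).Accurate h h
        (imagTimeMean (hamiltonian h P) (hamiltonian h P) ψ (r i).β) (uncertainty h i / 4)
        ((r i).shift E (uncertainty h i)) x} ≤ κ)
    (hq : ∀ E : ℝ, |E - Eg| ≤ uncertainty h Ni →
      q.dataLaw h P ψ a A {x | ¬ q.Accurate h a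
        (imagTimeMean (hamiltonian h P) (linComb a A) ψ q.β) err
        (q.shift E (uncertainty h Ni)) x} ≤ κ) :
    totalLaw h P ψ r q a A (successEvent h P ψ r q a A err)ᶜ ≤ (Ni + 1) * κ := by
  have := q.dataLaw_isProbabilityMeasure h P ψ a A hh hψ ha hA
  have := fun i => (r i).dataLaw_isProbabilityMeasure h P ψ h (fun j => pauliOp (P j)) hh hψ hh
    fun _ => pauliOp_mem_unitary _
  -- Including the admissibility of the incoming energy makes the section bound hold for every
  -- energy: for inadmissible ones the section is empty.
  let S : ∀ i : Fin Ni, Set (ℝ × (r i).Data M M) := fun i =>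
    {x | |x.1 - Eg| ≤ uncertainty h i ∧ ¬ (r i).Accurate h h
      (imagTimeMean (hamiltonian h P) (hamiltonian h P) ψ (r i).β) (uncertainty h i / 4)
        ((r i).shift x.1 (uncertainty h i)) x.2}
  let Sq : Set (ℝ × q.Data M K) :=
    {x | |x.1 - Eg| ≤ uncertainty h Ni ∧ ¬ q.Accurate h a
      (imagTimeMean (hamiltonian h P) (linComb a A) ψ q.β) err
        (q.shift x.1 (uncertainty h Ni)) x.2}
  have hSm : ∀ {K' : ℕ} (p : Params) (a' : Fin K' → ℝ) (m : ℂ) (ξ δ : ℝ), MeasurableSet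
      {x : ℝ × p.Data M K' | |x.1 - Eg| ≤ δ ∧ ¬ p.Accurate h a' m ξ (p.shift x.1 δ) x.2} := by
    intro K' p a' m ξ δ
    have h1 : Measurable fun x : ℝ × p.Data M K' => (p.shift x.1 δ, x.2) :=
      ((measurable_fst.sub_const _).sub_const _).prodMk measurable_snd
    exact (measurableSet_le (measurable_fst.sub_const Eg).abs measurable_const).inter
      (h1 (p.measurableSet_accurate h a' m ξ)).compl
  have hSi : ∀ i, (Measure.pi fun i => (r i).dataLaw h P ψ h fun j => pauliOp (P j))
      {ω | (gssEnergy h r ω i.castSucc, ω i) ∈ S i} ≤ κ := by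
    intro i
    refine pi_adaptive_le _ i (gssEnergy_measurable h r _) (fun ω ω' hω => ?_) (hSm _ _ _ _ _)
      fun E => ?_
    · refine gssEnergy_congr h r ω ω' _ fun j hj => hω j ?_
      rintro rfl
      exact lt_irrefl _ hj
    · by_cases hE : |E - Eg| ≤ uncertainty h i
      · exact (measure_mono fun x hx => hx.2).trans (hr i E hE)
      · refine (measure_mono (t := ∅) fun x hx => hE hx.1).trans ?_
        simp
  have hSq : totalLaw h P ψ r q a A {ω | (gssEnergy h r ω.1 (Fin.last Ni), ω.2) ∈ Sq} ≤ κ := by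
    refine prod_adaptive_le _ _ (gssEnergy_measurable h r _) (hSm _ _ _ _ _) fun E => ?_
    by_cases hE : |E - Eg| ≤ uncertainty h Ni
    · exact (measure_mono fun x hx => hx.2).trans (hq E hE)
    · refine (measure_mono (t := ∅) fun x hx => hE hx.1).trans ?_
      simp
  have hsub : (successEvent h P ψ r q a A err)ᶜ ⊆
      (⋃ i, {ω | (gssEnergy h r ω.1 i.castSucc, ω.1 i) ∈ S i}) ∪
        {ω | (gssEnergy h r ω.1 (Fin.last Ni), ω.2) ∈ Sq} := by
    intro ω hω
    by_contra hc
    simp only [Set.mem_union, Set.mem_iUnion, Set.mem_ofPred_eq, not_or, not_exists, S, Sq, not_and,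
      not_not] at hc
    obtain ⟨c1, c2⟩ := hc
    -- The statistical error δE/4 plus the projection error δE/2 is the new uncertainty 3δE/4.
    have hE : ∀ k : Fin (Ni + 1), |gssEnergy h r ω.1 k - Eg| ≤ uncertainty h k := by
      intro k
      induction k using Fin.induction with
      | zero => simpa [gssEnergy_zero, uncertainty] using hEg
      | succ i ih =>
        obtain ⟨-, h2⟩ := c1 i ih
        have h3 := (Complex.abs_re_le_norm _).trans_lt h2
        rw [Complex.sub_re] at h3
        have h4 := hproj i
        rw [gssEnergy_succ]
        have h5 : uncertainty h i.succ = 3 / 4 * uncertainty h i := by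
          simp only [uncertainty, Fin.val_succ, pow_succ]
          ring
        rw [h5]
        refine (abs_sub_le _ (imagTimeMean (hamiltonian h P) (hamiltonian h P) ψ (r i).β).re _).trans
          ?_
        have h6 : gssShift h r ω.1 i = (r i).shift (gssEnergy h r ω.1 i.castSucc)
          (uncertainty h i) := rfl
        rw [h6]
        linarith
    refine hω ⟨fun i => (c1 i (hE i.castSucc)).1, ?_⟩
    exact c2 (hE (Fin.last Ni))
  have hfst : ∀ i, totalLaw h P ψ r q a A {ω | (gssEnergy h r ω.1 i.castSucc, ω.1 i) ∈ S i} ≤ κ := by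
    intro i
    have h1 : {ω : (∀ i, (r i).Data M M) × q.Data M K |
        (gssEnergy h r ω.1 i.castSucc, ω.1 i) ∈ S i} =
        {ω | (gssEnergy h r ω i.castSucc, ω i) ∈ S i} ×ˢ Set.univ := by ext; simp
    rw [h1, totalLaw, Measure.prod_prod, measure_univ, mul_one]
    exact hSi i
  refine (measure_mono hsub).trans ((measure_union_le _ _).trans ?_)
  rw [add_mul, one_mul]
  refine add_le_add ((measure_iUnion_fintype_le _ _).trans
    ((Finset.sum_le_sum fun i _ => hfst i).trans ?_)) hSq
  simp

/-! ### The choice of the parameters -/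

/-- The parameters of an ITS at the imaginary time `β`, with truncation errors of the order
`exp (-ℓ)`. -/
def runParams {htot ℓ β : ℝ} {Ns : ℕ} (hh : 0 < htot) (hℓ : 0 < ℓ) (hN : 0 < Ns) (hβ : 0 < β) :
    Params where
  β := β
  τ := Real.sqrt (2 * ℓ) * β
  T := 2 * ℓ * β
  Nt := ⌈(htot * (2 * ℓ * β)) ^ 2⌉₊
  Ns := Ns
  β_pos := hβ
  τ_pos := by positivity
  T_pos := by positivity
  Nt_pos := Nat.ceil_pos.2 (by positivity)
  Ns_pos := hN

/-- Rounding up gives one step when y ≤ 1 and costs at most a factor of two otherwise; hence the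
`max 1` in the cost of N_t. -/
theorem natCeil_le_max {y : ℝ} (hy : 0 < y) : (⌈y⌉₊ : ℝ) ≤ max 1 (2 * y) := by
  rcases le_or_gt y 1 with h1 | h1
  · refine le_max_of_le_left ?_
    exact_mod_cast Nat.ceil_le.2 (by simpa using h1)
  · refine le_max_of_le_right ?_
    linarith [Nat.ceil_lt_add_one hy.le]

section RunParams

variable {htot ℓ β : ℝ} {Ns : ℕ} (hh : 0 < htot) (hℓ : 0 < ℓ) (hN : 0 < Ns) (hβ : 0 < β)

/-- Both exponents T²/(2τ²) and τ²/(2β²) equal ℓ, which balances the truncation in time against the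
tail in frequency. -/
theorem runParams_truncation :
    Real.exp (-((runParams hh hℓ hN hβ).T ^ 2 / (2 * (runParams hh hℓ hN hβ).τ ^ 2))) +
      Real.exp (-((runParams hh hℓ hN hβ).τ ^ 2 / (2 * (runParams hh hℓ hN hβ).β ^ 2))) =
      2 * Real.exp (-ℓ) := by
  have h1 : Real.sqrt (2 * ℓ) ^ 2 = 2 * ℓ := Real.sq_sqrt (by positivity)
  simp only [runParams, mul_pow, h1]
  have e1 : 2 ^ 2 * ℓ ^ 2 * β ^ 2 / (2 * (2 * ℓ * β ^ 2)) = ℓ := by field_simp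
  have e2 : 2 * ℓ * β ^ 2 / (2 * β ^ 2) = ℓ := by field_simp
  rw [e1, e2]
  ring

theorem runParams_le_τ (h1 : 1 ≤ 2 * ℓ) :
    (runParams hh hℓ hN hβ).β ≤ (runParams hh hℓ hN hβ).τ :=
  le_mul_of_one_le_left hβ.le (Real.one_le_sqrt.2 h1)

theorem runParams_CT_le {M : ℕ} (h : Fin M → ℝ) (ha : absSum h = htot) :
    (runParams hh hℓ hN hβ).CT h ≤ Real.exp (3 / 2) := by
  have h2 : (absSum h * (2 * ℓ * β)) ^ 2 ≤ (runParams hh hℓ hN hβ).Nt := by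
    rw [ha]
    exact Nat.le_ceil _
  refine (runParams hh hℓ hN hβ).CT_le h ?_ h2
  have h0 : 0 < absSum h * (2 * ℓ * β) := by rw [ha]; positivity
  -- N_t ≥ (h_tot T)² also gives h_tot T ≤ N_t: below 1 because N_t ≥ 1, above 1 because squaring
  -- increases.
  rcases le_or_gt (absSum h * (2 * ℓ * β)) 1 with h1 | h1
  · exact h1.trans (by exact_mod_cast (runParams hh hℓ hN hβ).Nt_pos)
  · refine le_trans ?_ h2
    change absSum h * (2 * ℓ * β) ≤ _
    nlinarith

theorem runParams_Nt_le {B : ℝ} (hB : (2 * ℓ * β) ^ 2 * 2 ≤ B) :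
    ((runParams hh hℓ hN hβ).Nt : ℝ) ≤ max 1 (htot ^ 2 * B) := by
  refine (natCeil_le_max (by positivity)).trans (max_le_max le_rfl ?_)
  rw [mul_pow, mul_left_comm, mul_comm 2]
  exact mul_le_mul_of_nonneg_left hB (by positivity)

end RunParams

theorem Params.Accurate.mono {M K : ℕ} {p : Params} {h : Fin M → ℝ} {a : Fin K → ℝ} {m : ℂ}
    {ξ ξ' E₀ : ℝ} {d : p.Data M K} (hd : p.Accurate h a m ξ E₀ d) (hξ : ξ ≤ ξ') :
    p.Accurate h a m ξ' E₀ d := ⟨hd.1, hd.2.trans_le hξ⟩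

/-- By ln(1 + y) ≤ y and e ≥ 1, the choice β_i = 1/(p_b δE) meets the condition prescribed for the
iteration. -/
theorem projectionBound_le {pb β : ℝ} (hpb : 0 < pb) (hpb1 : pb ≤ 1) (hβ : 0 < β) :
    projectionBound pb β ≤ 1 / (2 * β * pb) := by
  have he : (1 : ℝ) ≤ Real.exp 1 := Real.one_le_exp zero_le_one
  have h1 : 0 ≤ (1 - pb) / (Real.exp 1 * pb) := div_nonneg (by linarith) (by positivity)
  have h2 : Real.log (1 + (1 - pb) / (Real.exp 1 * pb)) ≤ 1 / pb := by
    have h3 := Real.log_le_sub_one_of_pos (x := 1 + (1 - pb) / (Real.exp 1 * pb)) (by linarith)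
    have h4 : (1 - pb) / (Real.exp 1 * pb) ≤ 1 / pb :=
      div_le_div₀ zero_le_one (by linarith) hpb (by nlinarith)
    linarith
  rw [projectionBound, ← div_div 1 (2 * β) pb, div_eq_mul_one_div (1 / (2 * β)) pb]
  exact mul_le_mul_of_nonneg_left h2 (by positivity)

/-- The probability that at least one of the runs fails is small. -/
theorem ofReal_lt_totalLaw {n M Ni K : ℕ} {htot ℓ β pb d e κ' κ ζ η : ℝ} {Ns : ℕ}
    (hh : 0 < htot) (hℓ : 0 < ℓ) (hN : 0 < Ns) (hβ : 0 < β) (hpb : 0 < pb) (hpb1 : pb ≤ 1)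
    (hd : d = pb * Real.exp (-(2 * (2 / pb + 1)))) (hζ : 0 < ζ) (hζ1 : ζ ≤ 1)
    (hζη : ζ ≤ η) (hζβ : ζ ≤ 1 / (htot * β)) (he : e = d * ζ / 16)
    (hℓe : 2 * Real.exp (-ℓ) ≤ e / 6) (hℓ1 : 1 ≤ 2 * ℓ) (hκ' : 0 < κ') (hκ'κ : κ' ≤ κ)
    (hκ'1 : κ' ≤ 1) (hNs : 256 * Real.exp 6 / (Ns * e ^ 2) ≤ κ' / (2 * (Ni + 1)))
    (hNi : htot * (3 / 4) ^ Ni ≤ 1 / β) (hNi' : ∀ i < Ni, 1 / β < htot * (3 / 4) ^ i)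
    {β' : Fin Ni → ℝ} (hβ' : ∀ i, 0 < β' i)
    (hβ'' : ∀ i, β' i = 1 / (pb * (htot * (3 / 4) ^ (i : ℕ))))
    (h : Fin M → ℝ) (P : Fin M → Fin n → Fin 4) (ψ : Vec n)
    (Eg : ℝ) (ψg : Vec n) (a : Fin K → ℝ) (A : Fin K → Op n) (hhtot : absSum h = htot)
    (hψ : braket ψ ψ = 1) (hg : IsGroundState (hamiltonian h P) Eg ψg)
    (hp : pb ≤ ‖braket ψg ψ‖ ^ 2) (hA : ∀ j, A j ∈ Matrix.unitaryGroup (Basis n) ℂ)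
    (ha : 0 < absSum a) :
    ENNReal.ofReal (1 - κ) < totalLaw h P ψ (fun i => runParams hh hℓ hN (hβ' i))
      (runParams hh hℓ hN hβ) a A (successEvent h P ψ (fun i => runParams hh hℓ hN (hβ' i))
        (runParams hh hℓ hN hβ) a A (absSum a * η)) := by
  have hh' : 0 < absSum h := hhtot ▸ hh
  have hd0 : 0 < d := by rw [hd]; positivity
  have hd1 : d ≤ 1 := by
    rw [hd]
    have h1 : Real.exp (-(2 * (2 / pb + 1))) ≤ 1 :=
      Real.exp_le_one_iff.2 (neg_nonpos.2 (by positivity))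
    exact mul_le_one₀ hpb1 (Real.exp_pos _).le h1
  have he0 : 0 < e := by rw [he]; positivity
  have hed : e ≤ d / 2 := by rw [he]; nlinarith
  -- The factor 1/16 in e makes the error of a quotient a_O ζ/4, matching the allowance δE/4 of the
  -- iterations.
  have he4 : 4 * e / d = ζ / 4 := by rw [he]; field_simp; norm_num
  have hH := hamiltonian_isHermitian h P
  have hmem : ∀ j, (fun j => pauliOp (P j)) j ∈ Matrix.unitaryGroup (Basis n) ℂ :=
    fun _ => pauliOp_mem_unitary _
  set κ₀ : ENNReal := ENNReal.ofReal (κ' / (2 * (Ni + 1))) with hκ₀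
  -- A correct incoming energy places the shift between 1/β₁ and 2δ + 1/β₁ below E_g. With β₁δ ≤
  -- 1/p_b, the quantity β₁(E_g - E₀) is bounded in terms of p_b alone, so a single d serves all
  -- runs.
  have hshift : ∀ {β₁ δ E : ℝ} (hβ₁ : 0 < β₁), β₁ * δ ≤ 1 / pb → |E - Eg| ≤ δ →
      1 / β₁ ≤ Eg - (E - δ - 1 / β₁) ∧ β₁ * (Eg - (E - δ - 1 / β₁)) ≤ 2 / pb + 1 := by
    intro β₁ δ E hβ₁ h1 h2
    obtain ⟨h3, h4⟩ := abs_le.1 h2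
    refine ⟨by linarith, ?_⟩
    calc β₁ * (Eg - (E - δ - 1 / β₁)) ≤ β₁ * (2 * δ + 1 / β₁) :=
          mul_le_mul_of_nonneg_left (by linarith) hβ₁.le
      _ = 2 * (β₁ * δ) + 1 := by field_simp
      _ ≤ 2 * (1 / pb) + 1 := by linarith
      _ = _ := by ring
  have hrun : ∀ {K' : ℕ} (a' : Fin K' → ℝ) (A' : Fin K' → Op n) (β₁ δ E ξ : ℝ) (hβ₁ : 0 < β₁),
      0 < absSum a' → (∀ j, A' j ∈ Matrix.unitaryGroup (Basis n) ℂ) → β₁ * δ ≤ 1 / pb →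
      |E - Eg| ≤ δ → absSum a' * (ζ / 4) ≤ ξ → (runParams hh hℓ hN hβ₁).dataLaw h P ψ a' A'
        {x | ¬ (runParams hh hℓ hN hβ₁).Accurate h a'
          (imagTimeMean (hamiltonian h P) (linComb a' A') ψ β₁) ξ
          ((runParams hh hℓ hN hβ₁).shift E δ) x} ≤ κ₀ := by
    intro K' a' A' β₁ δ E ξ hβ₁ ha' hA' h1 h2 hξ
    obtain ⟨h3, h4⟩ := hshift hβ₁ h1 h2
    have h5 := (runParams hh hℓ hN hβ₁).dataLaw_not_accurate_le h P ψ a' A' hg hh' hψ ha' hA'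
      (E₀ := (runParams hh hℓ hN hβ₁).shift E δ) (L := 2 / pb + 1) hpb hp h3 h4 hd he0 hed
      (by linarith) (runParams_le_τ hh hℓ hN hβ₁ hℓ1)
      ((runParams_truncation hh hℓ hN hβ₁).trans_le hℓe) (runParams_CT_le hh hℓ hN hβ₁ h hhtot)
    rw [he4] at h5
    refine le_trans (measure_mono ?_) (h5.trans (ENNReal.ofReal_le_ofReal hNs))
    intro x hx hx'
    exact hx (Params.Accurate.mono hx' hξ)
  have hβδ : ∀ i : Fin Ni, β' i * uncertainty h i = 1 / pb := by
    intro i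
    rw [hβ'', uncertainty, hhtot]
    field_simp
  have hproj : ∀ i : Fin Ni,
      |(imagTimeMean (hamiltonian h P) (hamiltonian h P) ψ (β' i)).re - Eg| ≤
        uncertainty h i / 2 := by
    intro i
    refine (hg.abs_mean_energy_sub_le hH hψ hpb hp (hβ' i)).trans (le_of_eq ?_)
    rw [hβ'', uncertainty, hhtot]
    field_simp
  -- Every iteration starts with uncertainty above 1/β ≥ h_tot ζ, so the common relative precision
  -- ζ/4 is at least as fine as required.
  have hξi : ∀ i : Fin Ni, absSum h * (ζ / 4) ≤ uncertainty h i / 4 := by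
    intro i
    have h1 := hNi' i i.2
    have h2 : htot * ζ ≤ 1 / β := by
      calc htot * ζ ≤ htot * (1 / (htot * β)) := mul_le_mul_of_nonneg_left hζβ hh.le
        _ = 1 / β := by field_simp
    rw [uncertainty, hhtot]
    linarith
  have hβq : β * uncertainty h Ni ≤ 1 / pb := by
    rw [uncertainty, hhtot]
    calc β * (htot * (3 / 4) ^ Ni) ≤ β * (1 / β) := mul_le_mul_of_nonneg_left hNi hβ.le
      _ = 1 := by field_simp
      _ ≤ 1 / pb := by rw [le_div_iff₀ hpb, one_mul]; exact hpb1
  have hcompl := totalLaw_compl_successEvent_le h P ψ (fun i => runParams hh hℓ hN (hβ' i))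
    (runParams hh hℓ hN hβ) a A (err := absSum a * η) (κ := κ₀) hh' hψ ha hA hg.abs_energy_le hproj
    (fun i E hE => hrun h (fun j => pauliOp (P j)) (β' i) (uncertainty h i) E _ (hβ' i) hh' hmem
      (hβδ i).le hE (hξi i))
    (fun E hE => hrun a A β (uncertainty h Ni) E _ hβ ha hA hβq hE
      (mul_le_mul_of_nonneg_left (by linarith) ha.le))
  have hsum : ((Ni : ENNReal) + 1) * κ₀ = ENNReal.ofReal (κ' / 2) := by
    have h1 : ((Ni : ENNReal) + 1) = ENNReal.ofReal (Ni + 1) := by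
      rw [ENNReal.ofReal_add (by positivity) zero_le_one, ENNReal.ofReal_natCast, ENNReal.ofReal_one]
    rw [h1, hκ₀, ← ENNReal.ofReal_mul (by positivity)]
    congr 1
    field_simp
  rw [hsum] at hcompl
  have := (runParams hh hℓ hN hβ).dataLaw_isProbabilityMeasure h P ψ a A hh' hψ ha hA
  have := fun i => (runParams hh hℓ hN (hβ' i)).dataLaw_isProbabilityMeasure h P ψ h
    (fun j => pauliOp (P j)) hh' hψ hh' hmem
  have hprob : IsProbabilityMeasure (totalLaw h P ψ (fun i => runParams hh hℓ hN (hβ' i))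
      (runParams hh hℓ hN hβ) a A) := by
    unfold totalLaw
    infer_instance
  -- Subadditivity bounds 1 by success plus failure. The failure is at most κ'/2 < κ', which makes
  -- the inequality strict.
  by_contra hc
  rw [not_lt] at hc
  have h1 := measure_union_le (μ := totalLaw h P ψ (fun i => runParams hh hℓ hN (hβ' i))
      (runParams hh hℓ hN hβ) a A) (successEvent h P ψ (fun i => runParams hh hℓ hN (hβ' i))
        (runParams hh hℓ hN hβ) a A (absSum a * η)) (successEvent h P ψ
        (fun i => runParams hh hℓ hN (hβ' i)) (runParams hh hℓ hN hβ) a A (absSum a * η))ᶜ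
  rw [Set.union_compl_self, measure_univ] at h1
  have h2 := h1.trans (add_le_add (hc.trans (ENNReal.ofReal_le_ofReal
    (by linarith : 1 - κ ≤ 1 - κ'))) hcompl)
  rw [← ENNReal.ofReal_add (by linarith) (by linarith), ← ENNReal.ofReal_one,
    ENNReal.ofReal_le_ofReal_iff (by linarith)] at h2
  linarith

/-- The number of iterations is logarithmic. -/
theorem iterations_le {Ni : ℕ} {htot β ζ ζ₀ : ℝ} (hh : 0 < htot) (hβ : 0 < β) (hζ : 0 < ζ)
    (hζ₀ : ζ ≤ ζ₀) (hζ₀1 : ζ₀ < 1) (hζβ : ζ ≤ 1 / (htot * β))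
    (hNi' : ∀ i < Ni, 1 / β < htot * (3 / 4) ^ i) :
    (Ni : ℝ) + 1 ≤ (2 / Real.log (1 / ζ₀) + 1 / Real.log (4 / 3)) * Real.log (1 / ζ) := by
  have h0 : 0 < ζ₀ := hζ.trans_le hζ₀
  have h1 : 0 < Real.log (1 / ζ₀) := Real.log_pos ((one_lt_div h0).2 hζ₀1)
  have h2 : 0 < Real.log (4 / 3) := Real.log_pos (by norm_num)
  have h3 : Real.log (1 / ζ₀) ≤ Real.log (1 / ζ) :=
    Real.log_le_log (by positivity) (one_div_le_one_div_of_le hζ hζ₀)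
  -- Additive constants are absorbed using ln(1/ζ) ≥ ln(1/ζ₀) > 0, here and in `log_le_mul_log`.
  have h4 : (2 : ℝ) ≤ 2 / Real.log (1 / ζ₀) * Real.log (1 / ζ) := by
    rw [div_mul_eq_mul_div, le_div_iff₀ h1]
    linarith
  have h5 : (Ni : ℝ) - 1 ≤ 1 / Real.log (4 / 3) * Real.log (1 / ζ) := by
    rw [one_div, inv_mul_eq_div, le_div_iff₀ h2]
    obtain _ | N := Ni
    · push_cast
      nlinarith
    -- The last iteration N = Ni - 1 still has uncertainty above 1/β, so (4/3)^N < h_tot β ≤ 1/ζ.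
    · have h6 := hNi' N (Nat.lt_succ_self N)
      have h7 : (4 / 3 : ℝ) ^ N ≤ 1 / ζ := by
        have h8 : (4 / 3 : ℝ) ^ N * (3 / 4) ^ N = 1 := by rw [← mul_pow]; norm_num
        have h9 : htot * β ≤ 1 / ζ := by
          rw [le_div_iff₀ (by positivity)] at hζβ ⊢
          linarith
        refine le_trans ?_ h9
        rw [div_lt_iff₀ hβ] at h6
        have h10 : (0 : ℝ) < (4 / 3) ^ N := by positivity
        calc (4 / 3 : ℝ) ^ N = (4 / 3) ^ N * 1 := (mul_one _).symm
          _ ≤ (4 / 3) ^ N * (htot * (3 / 4) ^ N * β) := mul_le_mul_of_nonneg_left h6.le h10.le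
          _ = (4 / 3 : ℝ) ^ N * (3 / 4) ^ N * (htot * β) := by ring
          _ = htot * β := by rw [h8, one_mul]
      have h8 := Real.log_le_log (by positivity) h7
      rw [Real.log_pow] at h8
      push_cast
      linarith
  rw [add_mul]
  linarith

/-- As ζ/2 ≤ min{ζ, 1/2}, the argument is at most 12 · 16 · 2/(dζ) = 384/(dζ), and the constant
ln(384/d) is absorbed. -/
theorem log_le_mul_log {d ζ ζ₀ : ℝ} (hd : 0 < d) (hd1 : d ≤ 1) (hζ : 0 < ζ)
    (hζ₀ : ζ ≤ ζ₀) (hζ₀1 : ζ₀ < 1) :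
    Real.log (12 / (d * min ζ (1 / 2) / 16)) ≤
      (1 + Real.log (384 / d) / Real.log (1 / ζ₀)) * Real.log (1 / ζ) := by
  have h0 : 0 < ζ₀ := hζ.trans_le hζ₀
  have h1 : 0 < Real.log (1 / ζ₀) := Real.log_pos ((one_lt_div h0).2 hζ₀1)
  have h3 : Real.log (1 / ζ₀) ≤ Real.log (1 / ζ) :=
    Real.log_le_log (by positivity) (one_div_le_one_div_of_le hζ hζ₀)
  have h2 : ζ / 2 ≤ min ζ (1 / 2) := le_min (by linarith) (by linarith)
  have h4 : 12 / (d * min ζ (1 / 2) / 16) ≤ 384 / d * (1 / ζ) := by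
    calc 12 / (d * min ζ (1 / 2) / 16) ≤ 12 / (d * (ζ / 2) / 16) := by gcongr
      _ = _ := by field_simp; norm_num
  have h5 : 0 < min ζ (1 / 2) := lt_min hζ (by norm_num)
  have h6 := Real.log_le_log (by positivity) h4
  rw [Real.log_mul (by positivity) (by positivity)] at h6
  have h7 : 0 ≤ Real.log (384 / d) := Real.log_nonneg (by rw [le_div_iff₀ hd]; linarith)
  have h8 : Real.log (384 / d) ≤ Real.log (384 / d) / Real.log (1 / ζ₀) * Real.log (1 / ζ) := by
    rw [div_mul_eq_mul_div, le_div_iff₀ h1]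
    exact mul_le_mul_of_nonneg_left h3 h7
  rw [add_mul, one_mul]
  linarith

/-- A sufficient number of samples for each of `Ni + 1` runs. -/
def sampleBound (Ni : ℕ) (κ d ζ : ℝ) : ℝ :=
  512 * Real.exp 6 * (Ni + 1) / (min κ 1 * (d * min ζ (1 / 2) / 16) ^ 2)

theorem sampleBound_pos {Ni : ℕ} {κ d ζ : ℝ} (hκ : 0 < κ) (hd : 0 < d) (hζ : 0 < ζ) :
    0 < sampleBound Ni κ d ζ := by
  have h1 : 0 < min κ 1 := lt_min hκ one_pos
  have h2 : 0 < min ζ (1 / 2) := lt_min hζ (by norm_num)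
  unfold sampleBound
  positivity

/-- One factor Ni + 1 counts the runs and another comes from dividing the failure probability among
them; both are logarithmic, hence the squared logarithm. Numerically 2^20 = 1024 · 32², with 32 from
e ≥ dζ/32. -/
theorem sum_samples_le {Ni : ℕ} {κ d ζ c l : ℝ} (hd : 0 < d) (hζ : 0 < ζ) (hζ1 : ζ ≤ 1)
    (hκ : 0 < κ) (hκ1 : κ ≤ 1) (hd1 : d ≤ 1) (hNi : (Ni : ℝ) + 1 ≤ c * l) :
    (∑ _i : Fin Ni, ((⌈sampleBound Ni κ d ζ⌉₊ : ℕ) : ℝ)) + ((⌈sampleBound Ni κ d ζ⌉₊ : ℕ) : ℝ) ≤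
      2 ^ 20 * Real.exp 6 * c ^ 2 / d ^ 2 * (1 / (κ * ζ ^ 2) * l ^ 2) := by
  set x := sampleBound Ni κ d ζ with hx
  have hx0 : 0 < x := sampleBound_pos hκ hd hζ
  rw [sampleBound, min_eq_left hκ1] at hx
  set e := d * min ζ (1 / 2) / 16 with he
  have h2 : 0 < min ζ (1 / 2) := lt_min hζ (by norm_num)
  have he0 : 0 < e := by positivity
  have he1 : e ≤ 1 := by
    have h3 : d * min ζ (1 / 2) ≤ 1 :=
      mul_le_one₀ hd1 h2.le ((min_le_right _ _).trans (by norm_num))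
    linarith
  have hx1 : 1 ≤ x := by
    have h6 : (1 : ℝ) ≤ Real.exp 6 := Real.one_le_exp (by norm_num)
    have h7 : κ * e ^ 2 ≤ 1 := mul_le_one₀ hκ1 (by positivity) (pow_le_one₀ he0.le he1)
    have h8 : (1 : ℝ) ≤ Ni + 1 := by linarith [Nat.cast_nonneg (α := ℝ) Ni]
    have h9 : (1 : ℝ) ≤ Real.exp 6 * (Ni + 1) := one_le_mul_of_one_le_of_one_le h6 h8
    rw [hx, le_div_iff₀ (by positivity)]
    linarith
  have hxc : ((⌈x⌉₊ : ℕ) : ℝ) ≤ 2 * x := by linarith [Nat.ceil_lt_add_one hx0.le]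
  have hζe : d * ζ / 32 ≤ e := by
    have h3 : ζ / 2 ≤ min ζ (1 / 2) := le_min (by linarith) (by linarith)
    have h4 := mul_le_mul_of_nonneg_left h3 hd.le
    rw [he]
    linarith
  rw [Finset.sum_const, Finset.card_univ, Fintype.card_fin, nsmul_eq_mul]
  calc (Ni : ℝ) * ((⌈x⌉₊ : ℕ) : ℝ) + ((⌈x⌉₊ : ℕ) : ℝ) = (Ni + 1) * ((⌈x⌉₊ : ℕ) : ℝ) := by ring
    _ ≤ (Ni + 1) * (2 * x) := by gcongr
    _ = 1024 * Real.exp 6 * (Ni + 1) ^ 2 / (κ * e ^ 2) := by rw [hx]; ring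
    _ ≤ 1024 * Real.exp 6 * (c * l) ^ 2 / (κ * (d * ζ / 32) ^ 2) := by gcongr
    _ = 2 ^ 20 * Real.exp 6 * c ^ 2 / d ^ 2 * (1 / (κ * ζ ^ 2) * l ^ 2) := by
      field_simp
      ring

end ITS
end

/-! ### The main theorem: constants, parameters and costs -/

theorem theorem3 (pb : ℝ) (hpb : 0 < pb) (hpb1 : pb ≤ 1) (ζ₀ : ℝ) (hζ₀ : 0 < ζ₀) (hζ₀1 : ζ₀ < 1) :
    ∃ C : ℝ, 0 < C ∧
      ∀ htot β η κ : ℝ, 0 < htot → 0 < β → 0 < η → 0 < κ →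
        ∃ (Ni : ℕ) (r : Fin Ni → ITS.Params) (q : ITS.Params),
          q.β = β ∧
          (∀ i : Fin Ni, ITS.projectionBound pb (r i).β ≤ htot * (3 / 4) ^ (i : ℕ) / 2) ∧
          (∀ ζ : ℝ, ζ = min η (1 / (htot * β)) → ζ ≤ ζ₀ → κ ≤ 1 →
            (∀ i : Fin Ni,
              ((r i).Nt : ℝ) ≤ max 1 (C * (htot ^ 2 * β ^ 2 * Real.log (1 / ζ) ^ 2))) ∧
            (q.Nt : ℝ) ≤ max 1 (C * (htot ^ 2 * β ^ 2 * Real.log (1 / ζ) ^ 2)) ∧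
            (∑ i, ((r i).Ns : ℝ)) + (q.Ns : ℝ) ≤
              C * (1 / (κ * ζ ^ 2) * Real.log (1 / ζ) ^ 2)) ∧
          (∀ (n M : ℕ) (h : Fin M → ℝ) (P : Fin M → Fin n → Fin 4) (ψ : ITS.Vec n)
            (Eg : ℝ) (ψg : ITS.Vec n) (K : ℕ) (a : Fin K → ℝ) (A : Fin K → ITS.Op n),
            ITS.absSum h = htot →
            ITS.braket ψ ψ = 1 →
            ITS.IsGroundState (ITS.hamiltonian h P) Eg ψg →
            pb ≤ ‖ITS.braket ψg ψ‖ ^ 2 →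
            (∀ j, (A j).IsHermitian ∧ A j ∈ Matrix.unitaryGroup (ITS.Basis n) ℂ) →
            0 < ITS.absSum a →
            ENNReal.ofReal (1 - κ) <
              ITS.totalLaw h P ψ r q a A
                (ITS.successEvent h P ψ r q a A (ITS.absSum a * η))) := by
  -- Lower bound of ‖w‖² in every run, from β(E_g - E₀) ≤ 2/p_b + 1.
  set d : ℝ := pb * Real.exp (-(2 * (2 / pb + 1))) with hd
  have hd0 : 0 < d := by positivity
  have hd1 : d ≤ 1 := by
    have h1 : Real.exp (-(2 * (2 / pb + 1))) ≤ 1 :=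
      Real.exp_le_one_iff.2 (neg_nonpos.2 (by positivity))
    exact mul_le_one₀ hpb1 (Real.exp_pos _).le h1
  -- The constants in ℓ ≤ c₁ ln(1/ζ) and Ni + 1 ≤ c₂ ln(1/ζ); both diverge as ζ₀ → 1.
  set c₁ : ℝ := 1 + Real.log (384 / d) / Real.log (1 / ζ₀) with hc₁
  set c₂ : ℝ := 2 / Real.log (1 / ζ₀) + 1 / Real.log (4 / 3) with hc₂
  have hlog₀ : 0 < Real.log (1 / ζ₀) := Real.log_pos ((one_lt_div hζ₀).2 hζ₀1)
  have hlog₁ : 0 < Real.log (4 / 3) := Real.log_pos (by norm_num)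
  have hc₂0 : 0 < c₂ := by positivity
  have hC₁ : 0 ≤ 8 * c₁ ^ 2 / pb ^ 2 := by positivity
  have hC₂ : 0 < 2 ^ 20 * Real.exp 6 * c₂ ^ 2 / d ^ 2 := by positivity
  refine ⟨8 * c₁ ^ 2 / pb ^ 2 + 2 ^ 20 * Real.exp 6 * c₂ ^ 2 / d ^ 2, by linarith, ?_⟩
  intro htot β η κ hh hβ hη hκ
  set ζ : ℝ := min η (1 / (htot * β)) with hζ
  have hζ0 : 0 < ζ := lt_min hη (by positivity)
  -- The accuracy claim carries no upper bound on ζ. The cap keeps e small, and for ζ ≤ 1 it costs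
  -- at most a factor of two.
  set ζ' : ℝ := min ζ (1 / 2) with hζ'
  have hζ'0 : 0 < ζ' := lt_min hζ0 (by norm_num)
  have hζ'1 : ζ' ≤ 1 := (min_le_right _ _).trans (by norm_num)
  set e : ℝ := d * ζ' / 16 with he
  have he0 : 0 < e := by positivity
  have he1 : e ≤ 1 := by
    rw [he]
    nlinarith
  -- Chosen so that the total truncation error 2e^{-ℓ} equals the allowed e/6.
  set ℓ : ℝ := Real.log (12 / e) with hℓ
  have hℓe : Real.exp (-ℓ) = e / 12 := by
    rw [hℓ, Real.exp_neg, Real.exp_log (by positivity), inv_div]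
  have hℓ1 : 1 ≤ ℓ := by
    rw [hℓ, Real.le_log_iff_exp_le (by positivity), le_div_iff₀ he0]
    have := Real.exp_one_lt_d9
    nlinarith
  have hℓ0 : 0 < ℓ := by linarith
  set κ' : ℝ := min κ 1 with hκ'
  have hκ'0 : 0 < κ' := lt_min hκ one_pos
  have hex : ∃ N : ℕ, htot * (3 / 4) ^ N ≤ 1 / β := by
    obtain ⟨N, hN⟩ := exists_pow_lt_of_lt_one (x := 1 / β / htot) (y := 3 / 4) (by positivity)
      (by norm_num)
    refine ⟨N, ?_⟩
    rw [lt_div_iff₀ hh] at hN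
    linarith
  -- The first iteration count with uncertainty at most 1/β. Minimality bounds both Ni and the
  -- imaginary times of the iterations.
  obtain ⟨Ni, hNi, hNi'⟩ : ∃ Ni : ℕ, htot * (3 / 4) ^ Ni ≤ 1 / β ∧
      ∀ i < Ni, 1 / β < htot * (3 / 4) ^ i := by
    classical
    exact ⟨Nat.find hex, Nat.find_spec hex, fun i hi => not_le.1 (Nat.find_min hex hi)⟩
  set x : ℝ := ITS.sampleBound Ni κ d ζ with hx
  have hx0 : 0 < x := ITS.sampleBound_pos hκ hd0 hζ0
  have hN : 0 < ⌈x⌉₊ := Nat.ceil_pos.2 hx0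
  -- β_i = 1/(p_b δE_i) makes the projection error bound 1/(2β_i p_b) equal to δE_i/2.
  have hβ' : ∀ i : Fin Ni, 0 < 1 / (pb * (htot * (3 / 4) ^ (i : ℕ))) := fun i => by positivity
  refine ⟨Ni, fun i => ITS.runParams hh hℓ0 hN (hβ' i), ITS.runParams hh hℓ0 hN hβ, rfl, ?_, ?_, ?_⟩
  · intro i
    refine (ITS.projectionBound_le hpb hpb1 (hβ' i)).trans (le_of_eq ?_)
    field_simp
  · rintro z rfl hζζ₀ hκ1
    have hζ1 : ζ < 1 := hζζ₀.trans_lt hζ₀1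
    have hℓc : ℓ ≤ c₁ * Real.log (1 / ζ) := ITS.log_le_mul_log hd0 hd1 hζ0 hζζ₀ hζ₀1
    have hNic : (Ni : ℝ) + 1 ≤ c₂ * Real.log (1 / ζ) :=
      ITS.iterations_le hh hβ hζ0 hζζ₀ hζ₀1 (min_le_right _ _) hNi'
    -- All imaginary times are at most β/p_b: in the iterations because δE_i > 1/β, in the final run
    -- because p_b ≤ 1.
    have hNt : ∀ (β₁ : ℝ) (hβ₁ : 0 < β₁), β₁ ≤ β / pb →
        ((ITS.runParams hh hℓ0 hN hβ₁).Nt : ℝ) ≤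
          max 1 ((8 * c₁ ^ 2 / pb ^ 2 + 2 ^ 20 * Real.exp 6 * c₂ ^ 2 / d ^ 2) *
            (htot ^ 2 * β ^ 2 * Real.log (1 / ζ) ^ 2)) := by
      intro β₁ hβ₁ hle
      have h1 : (2 * ℓ * β₁) ^ 2 * 2 ≤ (2 * (c₁ * Real.log (1 / ζ)) * (β / pb)) ^ 2 * 2 := by
        have h0 : 0 ≤ c₁ * Real.log (1 / ζ) := hℓ0.le.trans hℓc
        gcongr
      refine (ITS.runParams_Nt_le hh hℓ0 hN hβ₁ h1).trans (max_le_max le_rfl ?_)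
      have h2 : htot ^ 2 * ((2 * (c₁ * Real.log (1 / ζ)) * (β / pb)) ^ 2 * 2) =
          8 * c₁ ^ 2 / pb ^ 2 * (htot ^ 2 * β ^ 2 * Real.log (1 / ζ) ^ 2) := by
        field_simp
        ring
      rw [h2]
      exact mul_le_mul_of_nonneg_right (by linarith) (by positivity)
    refine ⟨fun i => hNt _ _ ?_, hNt _ _ ?_, ?_⟩
    · have h1 := hNi' i i.2
      have h2 : 1 / (htot * (3 / 4) ^ (i : ℕ)) ≤ β := by
        rw [div_lt_iff₀ hβ] at h1
        rw [div_le_iff₀ (by positivity)]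
        linarith
      rw [mul_comm pb, ← div_div]
      exact div_le_div_of_nonneg_right h2 hpb.le
    · rw [le_div_iff₀ hpb]
      nlinarith
    · refine (ITS.sum_samples_le hd0 hζ0 hζ1.le hκ hκ1 hd1 hNic).trans ?_
      exact mul_le_mul_of_nonneg_right (by linarith) (by positivity)
  · intro n M h P ψ Eg ψg K a A hhtot hψ hg hp hA ha
    refine ITS.ofReal_lt_totalLaw hh hℓ0 hN hβ hpb hpb1 hd hζ'0 hζ'1
      ((min_le_left _ _).trans (min_le_left _ _)) ((min_le_left _ _).trans (min_le_right _ _)) he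
      (by rw [hℓe]; linarith) (by linarith) hκ'0 (min_le_left _ _) (min_le_right _ _) ?_ hNi hNi' hβ'
      (fun _ => rfl) h P ψ Eg ψg a A hhtot hψ hg hp (fun j => (hA j).2) ha
    -- `sampleBound` is the real sample size at which the failure bound 256 e⁶/(N_s e²), with e⁶ the
    -- exponential and the last e the precision, equals κ'/(2(Ni + 1)).
    have h1 := Nat.le_ceil x
    calc 256 * Real.exp 6 / ((⌈x⌉₊ : ℕ) * e ^ 2) ≤ 256 * Real.exp 6 / (x * e ^ 2) := by gcongr
      _ = κ' / (2 * (Ni + 1)) := by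
        change 256 * Real.exp 6 / (512 * Real.exp 6 * (Ni + 1) / (κ' * e ^ 2) * e ^ 2) = _
        field_simp
        norm_num
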